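/- Let $d\ge 1$, $\alpha\in(1,2)$, $1<p<\infty$ and $T\in(0,\infty)$. **Fundamental solution.** For $u_0\in C_c^\infty(\mathbb R^d)$ consider the Cauchy problem with Caputo derivative $$\partial_t^\alpha u=\Delta u\ (t>0),\qquad u(0,\cdot)=u_0,\qquad \partial_t u(0,\cdot)=0,$$ understood in the sense of distributions: $u\in L_1((0,T')\times\mathbb R^d)$ for all $T'>0$ and, for every real-valued $\phi\in\mathcal S(\mathbb R^d)$ and almost every $t>0$, $$\int_{\mathbb R^d}(u(t,x)-u_0(x))\phi(x)\,dx=\frac1{\Gamma(\alpha)}\int_0^t(t-s)^{\alpha-1}\int_{\mathbb R^d}u(s,x)\Delta\phi(x)\,dx\,ds .$$ A real-valued function $p(t,x)$, integrable on $(0,T')\times\mathbb R^d$ for every $T'>0$, is called a fundamental solution if $u(t,\cdot)=p(t,\cdot)*u_0$ solves this problem for every real-valued $u_0\in C_c^\infty(\mathbb R^d)$. Put $$P(t,x)=\int_0^t p(s,x)\,ds .$$ **Besov norm.** Let $\hat f(\xi)=\int e^{-ix\cdot\xi}f(x)\,dx$. Fix $\Psi\in\mathcal S(\mathbb R^d)$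 such that $\hat\Psi$ is supported in $\{\frac12\le|\xi|\le2\}$, $\hat\Psi(\xi)>0$ for $\frac12<|\xi|<2$, and $\sum_{j\in\mathbb Z}\hat\Psi(2^{-j}\xi)=1$ for $\xi\ne0$. Let $\hat\Psi_j(\xi)=\hat\Psi(2^{-j}\xi)$ for $j\ge1$, $\hat\Psi_0=1-\sum_{j\ge1}\hat\Psi_j$, $h_j=\Psi_j*h$, and for $s\in\mathbb R$ $$\|h\|_{B_p^s}=\|h_0\|_{L_p}+\Big(\sum_{j=1}^\infty2^{spj}\|h_j\|_{L_p}^p\Big)^{1/p}.$$ **Theorem.** A fundamental solution exists, and there is a constant $C$ depending only on $\alpha,d,p,T$ (and the fixed function $\Psi$) such that, for every fundamental solution $p(t,x)$ and every real-valued $h\in C_c^\infty(\mathbb R^d)$, $$\int_0^T\int_{\mathbb R^d}|(P(t,\cdot)*h)(x)|^p\,dx\,dt\le C\,\|h\|^p_{B_p^{-\frac2{\alpha p}-\frac2\alpha}}\qquad\text{if }\alpha>1+\tfrac1p,$$ $$\int_0^T\int_{\mathbb R^d}|(P(t,\cdot)*h)(x)|^p\,dx\,dt\le C\,\|h\|^p_{B_p^{-\frac2\alpha}}\qquad\text{if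 }1<\alpha\le1+\tfrac1p .$$ -/

import Mathlib

open MeasureTheory Set
open scoped ENNReal NNReal ContDiff SchwartzMap FourierTransform Laplacian Convolution

noncomputable section

namespace FracDiffusion

/-- The Fourier transform `f̂(ξ) = ∫ e^{-i x·ξ} f(x) dx` (angular frequency), expressed through
Mathlib's transform, whose character is `e^{-2πi x·ξ}`. -/
def angularFourier {d : ℕ} (f : EuclideanSpace ℝ (Fin d) → ℂ) (ξ : EuclideanSpace ℝ (Fin d)) : ℂ :=
  𝓕 f ((2 * Real.pi)⁻¹ • ξ)

/-- The inverse transform `(2π)^{-d} ∫ e^{i x·ξ} g(ξ) dξ`. -/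
def angularFourierInv {d : ℕ} (g : EuclideanSpace ℝ (Fin d) → ℂ) (x : EuclideanSpace ℝ (Fin d)) :
    ℂ :=
  𝓕⁻ (fun ξ => g ((2 * Real.pi) • ξ)) x

theorem angularFourier_eq_integral {d : ℕ} (f : EuclideanSpace ℝ (Fin d) → ℂ)
    (ξ : EuclideanSpace ℝ (Fin d)) :
    angularFourier f ξ = ∫ x, Complex.exp (-(Complex.I * (inner ℝ x ξ : ℝ))) * f x := by
  rw [angularFourier, Real.fourier_eq']
  congr 1
  ext x
  rw [smul_eq_mul, inner_smul_right]
  congr 2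
  push_cast
  have : (Real.pi : ℂ) ≠ 0 := by exact_mod_cast Real.pi_ne_zero
  field_simp

theorem angularFourierInv_eq_integral {d : ℕ} (g : EuclideanSpace ℝ (Fin d) → ℂ)
    (x : EuclideanSpace ℝ (Fin d)) :
    angularFourierInv g x =
      (((2 * Real.pi) ^ d)⁻¹ : ℝ) • ∫ ξ, Complex.exp (Complex.I * (inner ℝ x ξ : ℝ)) * g ξ := by
  have h := Measure.integral_comp_smul (volume : Measure (EuclideanSpace ℝ (Fin d)))
    (fun ξ => Complex.exp (Complex.I * (inner ℝ x ξ : ℝ)) * g ξ) (2 * Real.pi)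
  rw [finrank_euclideanSpace_fin, abs_of_pos (by positivity)] at h
  rw [← h, angularFourierInv, Real.fourierInv_eq']
  congr 1
  ext ξ
  rw [smul_eq_mul, inner_smul_right, real_inner_comm]
  congr 2
  push_cast
  ring

/-- The conditions on the function `Ψ` that generates the dyadic partition of unity. -/
structure IsLittlewoodPaley {d : ℕ} (Ψ : 𝓢(EuclideanSpace ℝ (Fin d), ℂ)) : Prop where
  support : ∀ ξ, angularFourier Ψ ξ ≠ 0 → 1 / 2 ≤ ‖ξ‖ ∧ ‖ξ‖ ≤ 2
  pos : ∀ ξ, 1 / 2 < ‖ξ‖ → ‖ξ‖ < 2 → ∃ r : ℝ, 0 < r ∧ angularFourier Ψ ξ = r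
  sum_eq_one : ∀ ξ, ξ ≠ 0 → HasSum (fun j : ℤ => angularFourier Ψ ((2 : ℝ) ^ (-j) • ξ)) 1

/-- The symbols `Ψ̂_j(ξ) = Ψ̂(2^{-j} ξ)` for `j ≥ 1` and `Ψ̂_0 = 1 - ∑_{j ≥ 1} Ψ̂_j`. -/
def dyadicSymbol {d : ℕ} (Ψ : 𝓢(EuclideanSpace ℝ (Fin d), ℂ)) :
    ℕ → EuclideanSpace ℝ (Fin d) → ℂ
  | 0, ξ => 1 - ∑' j : ℕ, angularFourier Ψ ((2 : ℝ) ^ (-((j : ℤ) + 1)) • ξ)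
  | j + 1, ξ => angularFourier Ψ ((2 : ℝ) ^ (-((j : ℤ) + 1)) • ξ)

/-- `f_j = Ψ_j * f`, where `Ψ_j` is the function with Fourier transform `Ψ̂_j`. -/
def dyadicBlock {d : ℕ} (Ψ : 𝓢(EuclideanSpace ℝ (Fin d), ℂ)) (j : ℕ)
    (f : EuclideanSpace ℝ (Fin d) → ℝ) : EuclideanSpace ℝ (Fin d) → ℂ :=
  angularFourierInv (dyadicSymbol Ψ j) ⋆[ContinuousLinearMap.mul ℝ ℂ, volume]
    (fun x => (f x : ℂ))

/-- The Besov norm `‖f_0‖_{L_p} + (∑_{j ≥ 1} 2^{spj} ‖f_j‖_{L_p}^p)^{1/p}`, with values in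
`[0, ∞]`. -/
def besovNorm {d : ℕ} (Ψ : 𝓢(EuclideanSpace ℝ (Fin d), ℂ)) (s p : ℝ)
    (f : EuclideanSpace ℝ (Fin d) → ℝ) : ℝ≥0∞ :=
  eLpNorm (dyadicBlock Ψ 0 f) (ENNReal.ofReal p) volume +
    (∑' j : ℕ, ENNReal.ofReal ((2 : ℝ) ^ (s * p * ((j : ℝ) + 1))) *
      eLpNorm (dyadicBlock Ψ (j + 1) f) (ENNReal.ofReal p) volume ^ p) ^ (1 / p)

/-- The Riemann–Liouville fractional integral `I_t^a φ(t) = Γ(a)⁻¹ ∫_0^t (t-s)^{a-1} φ(s) ds`. -/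
def fracIntegral (a : ℝ) (φ : ℝ → ℝ) (t : ℝ) : ℝ :=
  (Real.Gamma a)⁻¹ * ∫ s in (0 : ℝ)..t, (t - s) ^ (a - 1) * φ s

/-- `u` solves, for an order `α ∈ (1, 2)`, the Cauchy problem
`∂_t^α u = Δ u` for `t > 0`, `u(0) = u₀`, `∂_t u(0) = v₀` (Caputo derivative)
in the sense of distributions: `(u(t) - u₀ - t v₀, φ) = I_t^α (u, Δ φ)` for almost every `t > 0`,
for every real Schwartz function `φ`. -/
structure IsDistribSolution {d : ℕ} (α : ℝ) (u₀ v₀ : EuclideanSpace ℝ (Fin d) → ℝ)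
    (u : ℝ → EuclideanSpace ℝ (Fin d) → ℝ) : Prop where
  integrable : ∀ T : ℝ, 0 < T → IntegrableOn (Function.uncurry u) (Ioc 0 T ×ˢ univ)
  equation : ∀ φ : 𝓢(EuclideanSpace ℝ (Fin d), ℝ), ∀ᵐ t ∂(volume.restrict (Ioi (0 : ℝ))),
    ∫ x, (u t x - u₀ x - t * v₀ x) * φ x =
      fracIntegral α (fun s => ∫ x, u s x * (Δ φ) x) t

/-- `k(t, x)` is a fundamental solution of `∂_t^α u = Δ u`, `u(0) = u₀`, `∂_t u(0) = 0`: an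
integrable kernel on every strip `(0, T] × ℝ^d` such that `u(t) = k(t, ·) * u₀` solves this problem
for every smooth compactly supported `u₀`. These conditions determine `k` almost everywhere. -/
structure IsFundamentalSolution {d : ℕ} (α : ℝ) (k : ℝ → EuclideanSpace ℝ (Fin d) → ℝ) :
    Prop where
  integrable : ∀ T : ℝ, 0 < T → IntegrableOn (Function.uncurry k) (Ioc 0 T ×ˢ univ)
  solves : ∀ u₀ : EuclideanSpace ℝ (Fin d) → ℝ, ContDiff ℝ ∞ u₀ → HasCompactSupport u₀ →
    IsDistribSolution α u₀ 0
      (fun t => k t ⋆[ContinuousLinearMap.mul ℝ ℝ, volume] u₀)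

/-- `P(t, x) = ∫_0^t k(s, x) ds`. -/
def velocityKernel {d : ℕ} (k : ℝ → EuclideanSpace ℝ (Fin d) → ℝ) (t : ℝ)
    (x : EuclideanSpace ℝ (Fin d)) : ℝ :=
  ∫ s in (0 : ℝ)..t, k s x

end FracDiffusion

end

noncomputable section

namespace FracDiffusion

/-! ### Smooth compactly supported functions as Schwartz functions. -/

section SchwartzOfCompactSupport

variable {E : Type*} [NormedAddCommGroup E] [NormedSpace ℝ E]

/-! Write `x = |2πξ|²` for the symbol of `-Δ`. In frequency the Cauchy problem becomes the scalar
Volterra equation `y = 1 - x I^α y`, solved by the Mittag-Leffler function `E_α(-x t^α)`. Its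
Laplace transform is `z^{α-1}/(z^α+x)`, and Laplace inversion expresses it as `π⁻¹ Im ∫ e^{st}
s^α/(s^α+x) ds/s` over one ray `arg s = θ`. Since `1 < α < 2` there is a `θ` with `π/2 < θ < π/α`:
then `e^{st}` decays along the ray, and `s^α` stays in the sector `|arg| < π`, away from `-x`. In
the variable `s = e^w` the ray is a horizontal line, `ds/s` is `dw`, and contour deformation takes
place in a strip.

On the ray, `s^α/(s^α+|2πξ|²)` is the symbol of a dilation of one fixed integrable resolvent kernel,
up to a unimodular constant. Dilations preserve the `L¹` norm, so every integrable weight on the ray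
yields an `L¹` kernel with norm controlled by the weight (`IsRayAngle.exists_ray_mixture`). This
gives an integrable self-similar fundamental solution, hence `‖P(t)‖₁ ≤ Bt`. For the time primitive,
`x s^{α-1}/(s^α+x) = s^{α-1} - s^{α-1} s^α/(s^α+x)` shows that `-ΔP(t)` is a multiple of the Dirac
mass plus an `L¹` function, both of size `t^{1-α}` (`IsRayAngle.exists_velocity_remainder`). On the
`j`-th dyadic block, convolution with `P(t)` therefore has norm `O(min(t, t^{1-α} 4^{-j}))` on `L_p`
(`IsRayAngle.exists_eLpNorm_velocity_le`).

The space-time bound is then a Schur test. For each `σ` the block bound factors as `t^{1-ασ/2}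
φ(t^{α/2} 2^j) 2^{-σj}` with `φ(z) = min(z^σ, z^{σ-2})`. If `0 < σ < 2`, the sum of `φ(y 2^j)` over
`j` is bounded uniformly in `y`, and only `∫_0^T t^{p(1-ασ/2)} φ(t^{α/2} 2^j) dt` remains. The
choice `σ = 2/(αp) + 2/α` makes the power of `t` equal to `-1`, a scale-invariant integral; it
satisfies `σ < 2` exactly when `α > 1 + 1/p`. Otherwise `σ = 2/α` makes the power `0` and the
integral is at most `T`.

Finally the estimate is transferred to every fundamental solution by uniqueness
(`IsFundamentalSolution.velocityKernel_convolution_ae_eq`). The difference of two solutions, tested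
against a band-limited function, is an `n`-fold fractional integral of pairings that grow only
geometrically in `n`, so it vanishes. -/

theorem exists_schwartzMap {g : E → ℂ} (hg : ContDiff ℝ ∞ g) (hgc : HasCompactSupport g) :
    ∃ G : 𝓢(E, ℂ), ⇑G = g := ⟨hgc.toSchwartzMap hg, by ext x; simp⟩

theorem exists_schwartzMap_ofReal {g : E → ℝ} (hg : ContDiff ℝ ∞ g) (hgc : HasCompactSupport g) :
    ∃ G : 𝓢(E, ℂ), ∀ x, G x = g x := by
  have h1 : HasCompactSupport (Complex.ofRealCLM ∘ g) := hgc.comp_left (map_zero _)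
  obtain ⟨G, hG⟩ := exists_schwartzMap (Complex.ofRealCLM.contDiff.comp hg) h1
  exact ⟨G, fun x => by rw [hG]; simp⟩

end SchwartzOfCompactSupport

/-! ### Fourier transform, dilations and Young's inequality. -/

section FourierTools

variable {E : Type*} [NormedAddCommGroup E] [InnerProductSpace ℝ E] [FiniteDimensional ℝ E]
  [MeasurableSpace E] [BorelSpace E]

/-- The `L¹`-normalised dilation `δ^n Q(δ x)`. -/
def dilate {F : Type*} [AddCommGroup F] [Module ℝ F] (δ : ℝ) (Q : E → F) (x : E) : F :=
  δ ^ Module.finrank ℝ E • Q (δ • x)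

theorem integrable_dilate {F : Type*} [NormedAddCommGroup F] [NormedSpace ℝ F] {δ : ℝ} (hδ : 0 < δ)
    {Q : E → F} (hQ : Integrable Q) : Integrable (dilate δ Q) :=
  ((integrable_comp_smul_iff volume Q hδ.ne').2 hQ).smul _

theorem integral_norm_dilate {F : Type*} [NormedAddCommGroup F] [NormedSpace ℝ F] {δ : ℝ}
    (hδ : 0 < δ) (Q : E → F) : ∫ x, ‖dilate δ Q x‖ = ∫ x, ‖Q x‖ := by
  simp only [dilate, norm_smul]
  rw [integral_const_mul, Measure.integral_comp_smul volume (fun x => ‖Q x‖) δ, norm_pow,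
    Real.norm_of_nonneg hδ.le, abs_of_pos (by positivity), smul_eq_mul, ← mul_assoc,
    mul_inv_cancel₀ (by positivity), one_mul]

theorem fourier_dilate {δ : ℝ} (hδ : 0 < δ) (Q : E → ℂ) (ξ : E) :
    𝓕 (dilate δ Q) ξ = 𝓕 Q (δ⁻¹ • ξ) := by
  have h := Measure.integral_comp_smul (volume : Measure E)
    (fun y => Real.fourierChar (-inner ℝ y (δ⁻¹ • ξ)) • Q y) δ
  rw [abs_of_pos (by positivity)] at h
  rw [Real.fourier_eq, Real.fourier_eq, ← inv_smul_smul₀ (pow_pos hδ (Module.finrank ℝ E)).ne'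
    (∫ y, Real.fourierChar (-inner ℝ y (δ⁻¹ • ξ)) • Q y), smul_comm, ← h, ← integral_smul]
  congr 1
  ext v
  have : inner ℝ (δ • v) (δ⁻¹ • ξ) = inner ℝ v ξ := by
    rw [inner_smul_left, inner_smul_right]
    simp [hδ.ne']
  rw [this, dilate, smul_comm]

theorem integral_fourier_mul_eq {f g : E → ℂ} (hf : Integrable f) (hg : Integrable g) :
    ∫ ξ, 𝓕 f ξ * g ξ = ∫ x, f x * 𝓕 g x := by
  have := VectorFourier.integral_fourierIntegral_smul_eq_flip (μ := (volume : Measure E))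
    (ν := (volume : Measure E)) (L := innerₗ E) Real.continuous_fourierChar continuous_inner hf hg
  rw [flip_innerₗ] at this
  exact this

theorem norm_fourier_le (f : E → ℂ) (ξ : E) : ‖𝓕 f ξ‖ ≤ ∫ x, ‖f x‖ :=
  VectorFourier.norm_fourierIntegral_le_integral_norm _ _ _ _ _

theorem continuous_fourier {f : E → ℂ} (hf : Integrable f) : Continuous (𝓕 f) :=
  VectorFourier.fourierIntegral_continuous Real.continuous_fourierChar continuous_inner hf

/-- An integrable function is determined almost everywhere by its Fourier transform. -/
theorem ae_eq_zero_of_fourier_eq_zero {f : E → ℂ} (hf : Integrable f)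
    (h : 𝓕 f =ᵐ[volume] 0) : f =ᵐ[volume] 0 := by
  -- A test function `G` is the transform of `𝓕⁻ G`, so pairing `f` with `G` is pairing `𝓕 f` with
  -- `𝓕⁻ G`.
  refine ae_eq_zero_of_integral_contDiff_smul_eq_zero hf.locallyIntegrable fun g hg hgc => ?_
  obtain ⟨G, hG⟩ := exists_schwartzMap_ofReal hg hgc
  have h1 := integral_fourier_mul_eq hf (𝓕⁻ G : 𝓢(E, ℂ)).integrable
  have h2 : 𝓕 (⇑(𝓕⁻ G : 𝓢(E, ℂ))) = ⇑G := by
    rw [← SchwartzMap.fourier_coe, FourierTransform.fourier_fourierInv_eq]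
  rw [h2] at h1
  have h3 : ∫ ξ, 𝓕 f ξ * (𝓕⁻ G : 𝓢(E, ℂ)) ξ = 0 := by
    refine integral_eq_zero_of_ae ?_
    filter_upwards [h] with x hx
    simp only [hx, Pi.zero_apply, zero_mul]
  rw [← h3, h1]
  congr 1
  ext x
  rw [mul_comm, Complex.real_smul, hG]

theorem ae_eq_of_fourier_eq {f g : E → ℂ} (hf : Integrable f) (hg : Integrable g)
    (h : 𝓕 f =ᵐ[volume] 𝓕 g) : f =ᵐ[volume] g := by
  have h0 : 𝓕 (f - g) = 𝓕 f - 𝓕 g := by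
    ext ξ
    rw [Real.fourier_eq, Pi.sub_apply, Real.fourier_eq, Real.fourier_eq, ← integral_sub]
    · simp [smul_sub]
    · exact (Real.fourierIntegral_convergent_iff ξ).2 hf
    · exact (Real.fourierIntegral_convergent_iff ξ).2 hg
  have := ae_eq_zero_of_fourier_eq_zero (hf.sub hg) (by
    rw [h0]; filter_upwards [h] with x hx; simp [hx])
  filter_upwards [this] with x hx
  simpa [sub_eq_zero] using hx

/-- For a kernel with even Fourier transform, the transform of the imaginary part is the imaginary
part of the transform. -/
theorem fourier_im {K : E → ℂ} (hK : Integrable K) {ξ : E} (hev : 𝓕 K (-ξ) = 𝓕 K ξ) :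
    𝓕 (fun x => ((K x).im : ℂ)) ξ = ((𝓕 K ξ).im : ℂ) := by
  have hconj : 𝓕 (fun x => (starRingEnd ℂ) (K x)) ξ = (starRingEnd ℂ) (𝓕 K (-ξ)) := by
    rw [Real.fourier_eq, Real.fourier_eq, ← integral_conj]
    congr 1
    ext x
    simp only [Circle.smul_def, smul_eq_mul, map_mul, inner_neg_right, neg_neg]
    rw [← Circle.coe_inv_eq_conj, ← AddChar.map_neg_eq_inv]
  have him : (fun x => ((K x).im : ℂ)) =
      fun x => (2 * Complex.I)⁻¹ * (K x - (starRingEnd ℂ) (K x)) := by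
    ext x
    rw [Complex.sub_conj]
    field_simp
    push_cast
    ring
  have hKc : Integrable fun x => (starRingEnd ℂ) (K x) := hK.congr' 
    (Complex.continuous_conj.comp_aestronglyMeasurable hK.aestronglyMeasurable) (by simp)
  have h1 : 𝓕 (fun x => ((K x).im : ℂ)) ξ =
      (2 * Complex.I)⁻¹ * (𝓕 K ξ - 𝓕 (fun x => (starRingEnd ℂ) (K x)) ξ) := by
    rw [him, Real.fourier_eq, Real.fourier_eq, Real.fourier_eq, ← integral_sub,
      ← integral_const_mul]
    · congr 1
      ext x
      simp only [Circle.smul_def, smul_eq_mul]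
      ring
    · exact (Real.fourierIntegral_convergent_iff ξ).2 hK
    · exact (Real.fourierIntegral_convergent_iff ξ).2 hKc
  rw [h1, hconj, hev, Complex.sub_conj]
  field_simp
  push_cast
  ring

/-! ### Superpositions of dilated kernels. -/

section Mixture

variable {Ω : Type*} [MeasurableSpace Ω] {μ : Measure Ω} {m : Ω → ℂ} {δ : Ω → ℝ}
  {Q : E → ℂ}

/-- The mixture `∫ m(u) δ(u)^n Q(δ(u) x) dμ(u)` of dilations of a kernel. -/
def mixture (μ : Measure Ω) (m : Ω → ℂ) (δ : Ω → ℝ) (Q : E → ℂ) (x : E) : ℂ :=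
  ∫ u, m u * dilate (δ u) Q x ∂μ

theorem integrable_prod_mixture (hm : Integrable m μ) (hδm : Measurable δ) (hδ : ∀ᵐ u ∂μ, 0 < δ u)
    (hQm : StronglyMeasurable Q) (hQ : Integrable Q) :
    Integrable (fun z : Ω × E => m z.1 * dilate (δ z.1) Q z.2) (μ.prod volume) := by
  have hmeas : AEStronglyMeasurable (fun z : Ω × E => m z.1 * dilate (δ z.1) Q z.2)
      (μ.prod volume) := by
    refine (hm.aestronglyMeasurable.comp_fst).mul ?_
    unfold dilate
    refine StronglyMeasurable.aestronglyMeasurable ?_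
    refine StronglyMeasurable.smul ?_ ?_
    · exact (Complex.measurable_ofReal.comp
        ((hδm.comp measurable_fst).pow_const _)).stronglyMeasurable
    · exact hQm.comp_measurable ((hδm.comp measurable_fst).smul measurable_snd)
  rw [integrable_prod_iff hmeas]
  constructor
  · filter_upwards [hδ] with u hu
    exact (integrable_dilate hu hQ).const_mul _
  · refine (hm.norm.mul_const (∫ x, ‖Q x‖)).congr ?_
    filter_upwards [hδ] with u hu
    simp only [norm_mul, integral_const_mul, integral_norm_dilate hu]

theorem integrable_mixture [SFinite μ] (hm : Integrable m μ) (hδm : Measurable δ)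
    (hδ : ∀ᵐ u ∂μ, 0 < δ u) (hQm : StronglyMeasurable Q) (hQ : Integrable Q) :
    Integrable (mixture μ m δ Q) :=
  (integrable_prod_mixture hm hδm hδ hQm hQ).integral_prod_right

theorem integral_norm_mixture_le [SFinite μ] (hm : Integrable m μ) (hδm : Measurable δ)
    (hδ : ∀ᵐ u ∂μ, 0 < δ u) (hQm : StronglyMeasurable Q) (hQ : Integrable Q) :
    ∫ x, ‖mixture μ m δ Q x‖ ≤ (∫ u, ‖m u‖ ∂μ) * ∫ x, ‖Q x‖ := by
  have hi := integrable_prod_mixture hm hδm hδ hQm hQ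
  calc ∫ x, ‖mixture μ m δ Q x‖ ≤ ∫ x, ∫ u, ‖m u * dilate (δ u) Q x‖ ∂μ :=
        integral_mono (integrable_mixture hm hδm hδ hQm hQ).norm hi.integral_norm_prod_right
          fun x => norm_integral_le_integral_norm _
    _ = ∫ u, (∫ x, ‖m u * dilate (δ u) Q x‖) ∂μ := (integral_integral_swap hi.norm).symm
    _ = ∫ u, (‖m u‖ * ∫ x, ‖Q x‖) ∂μ := by
        refine integral_congr_ae ?_
        filter_upwards [hδ] with u hu
        simp only [norm_mul, integral_const_mul, integral_norm_dilate hu]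
    _ = _ := integral_mul_const _ _

theorem fourier_mixture [SFinite μ] (hm : Integrable m μ) (hδm : Measurable δ)
    (hδ : ∀ᵐ u ∂μ, 0 < δ u) (hQm : StronglyMeasurable Q) (hQ : Integrable Q) (ξ : E) :
    𝓕 (mixture μ m δ Q) ξ = ∫ u, m u * 𝓕 Q ((δ u)⁻¹ • ξ) ∂μ := by
  have hi := integrable_prod_mixture hm hδm hδ hQm hQ
  have hi' : Integrable (fun z : E × Ω =>
      Real.fourierChar (-inner ℝ z.1 ξ) • (m z.2 * dilate (δ z.2) Q z.1)) (volume.prod μ) := by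
    refine hi.swap.mono ?_ ?_
    · exact ((Real.continuous_fourierChar.comp (by fun_prop :
        Continuous fun x : E => -inner ℝ x ξ)).aestronglyMeasurable.comp_fst).smul
        hi.swap.aestronglyMeasurable
    · filter_upwards with z using by simp
  calc 𝓕 (mixture μ m δ Q) ξ
      = ∫ x, ∫ u, Real.fourierChar (-inner ℝ x ξ) • (m u * dilate (δ u) Q x) ∂μ := by
        rw [Real.fourier_eq]
        congr 1
        ext x
        rw [mixture, Circle.smul_def, ← integral_smul]
        rfl
    _ = ∫ u, (∫ x, Real.fourierChar (-inner ℝ x ξ) • (m u * dilate (δ u) Q x)) ∂μ :=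
        integral_integral_swap hi'
    _ = ∫ u, m u * 𝓕 Q ((δ u)⁻¹ • ξ) ∂μ := by
        refine integral_congr_ae ?_
        filter_upwards [hδ] with u hu
        rw [← fourier_dilate hu, Real.fourier_eq, ← integral_const_mul]
        congr 1
        ext x
        simp only [Circle.smul_def, smul_eq_mul]
        ring

end Mixture

/-- Young's inequality `‖f * g‖_p ≤ ‖f‖₁ ‖g‖_p`. -/
theorem eLpNorm_convolution_le {p : ℝ} (hp : 1 < p) {f g : E → ℂ}
    (hf : AEStronglyMeasurable f) (hg : Continuous g) :
    eLpNorm (f ⋆[ContinuousLinearMap.mul ℝ ℂ, volume] g) (ENNReal.ofReal p) volume ≤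
      eLpNorm f 1 volume * eLpNorm g (ENNReal.ofReal p) volume := by
  have hp0 : 0 < p := by linarith
  have hpq := Real.HolderConjugate.conjExponent hp
  set q := p.conjExponent
  have hfm : AEMeasurable (fun y => ‖f y‖ₑ) := hf.enorm
  have hgm : Measurable fun y => ‖g y‖ₑ := hg.enorm.measurable
  have key : ∀ x, ‖(f ⋆[ContinuousLinearMap.mul ℝ ℂ, volume] g) x‖ₑ ^ p ≤
      (∫⁻ y, ‖f y‖ₑ) ^ (p - 1) * ∫⁻ y, ‖f y‖ₑ * ‖g (x - y)‖ₑ ^ p := by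
    intro x
    have h1 : ‖(f ⋆[ContinuousLinearMap.mul ℝ ℂ, volume] g) x‖ₑ ≤
        ∫⁻ y, ‖f y‖ₑ * ‖g (x - y)‖ₑ := by
      rw [convolution_def]
      refine (enorm_integral_le_lintegral_enorm _).trans (le_of_eq ?_)
      simp [enorm_mul]
    -- Hölder after splitting `|f| = |f|^{1/p} |f|^{1/q}`, that is, with `|f|` as the weight.
    have h2 : ∫⁻ y, ‖f y‖ₑ * ‖g (x - y)‖ₑ ≤
        (∫⁻ y, ‖f y‖ₑ * ‖g (x - y)‖ₑ ^ p) ^ (1 / p) * (∫⁻ y, ‖f y‖ₑ) ^ (1 / q) := by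
      have := ENNReal.lintegral_mul_le_Lp_mul_Lq volume hpq
        (f := fun y => ‖f y‖ₑ ^ (1 / p) * ‖g (x - y)‖ₑ) (g := fun y => ‖f y‖ₑ ^ (1 / q))
        ((hfm.pow_const _).mul (hgm.comp (by fun_prop)).aemeasurable) (hfm.pow_const _)
      refine le_trans (le_of_eq ?_) (this.trans (le_of_eq ?_))
      · refine lintegral_congr fun y => ?_
        simp only [Pi.mul_apply]
        rw [mul_right_comm, ← ENNReal.rpow_add_of_nonneg _ _ (by positivity)
          (by have := hpq.symm.pos; positivity)]
        have : 1 / p + 1 / q = 1 := by simpa using hpq.inv_add_inv_eq_one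
        rw [this, ENNReal.rpow_one]
      · congr 2
        · refine lintegral_congr fun y => ?_
          rw [ENNReal.mul_rpow_of_nonneg _ _ hp0.le, ← ENNReal.rpow_mul,
            one_div_mul_cancel hp0.ne', ENNReal.rpow_one]
        · refine lintegral_congr fun y => ?_
          rw [← ENNReal.rpow_mul, one_div_mul_cancel hpq.symm.pos.ne', ENNReal.rpow_one]
    calc _ ≤ ((∫⁻ y, ‖f y‖ₑ * ‖g (x - y)‖ₑ ^ p) ^ (1 / p) * (∫⁻ y, ‖f y‖ₑ) ^ (1 / q)) ^ p :=
          ENNReal.rpow_le_rpow (h1.trans h2) hp0.le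
      _ = _ := by
          rw [ENNReal.mul_rpow_of_nonneg _ _ hp0.le, ← ENNReal.rpow_mul, ← ENNReal.rpow_mul,
            one_div_mul_cancel hp0.ne', ENNReal.rpow_one, mul_comm]
          congr 2
          have := hpq.sub_one_mul_conj
          have := hpq.symm.pos.ne'
          field_simp
          linarith
  have hp1 : ENNReal.ofReal p ≠ 0 := by simpa using hp0
  rw [eLpNorm_eq_lintegral_rpow_enorm_toReal hp1 ENNReal.ofReal_ne_top,
    eLpNorm_eq_lintegral_rpow_enorm_toReal hp1 ENNReal.ofReal_ne_top,
    ENNReal.toReal_ofReal hp0.le, eLpNorm_one_eq_lintegral_enorm]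
  have hswap : ∫⁻ x, ∫⁻ y, ‖f y‖ₑ * ‖g (x - y)‖ₑ ^ p =
      (∫⁻ y, ‖f y‖ₑ) * ∫⁻ x, ‖g x‖ₑ ^ p := by
    rw [lintegral_lintegral_swap]
    · rw [← lintegral_mul_const'' _ hfm]
      refine lintegral_congr fun y => ?_
      have hgy : Measurable fun x => ‖g (x - y)‖ₑ ^ p :=
        (hgm.comp (measurable_id.sub_const y)).pow_const p
      rw [lintegral_const_mul _ hgy, lintegral_sub_right_eq_self (fun x => ‖g x‖ₑ ^ p) y]
    · exact (hfm.comp_snd).mul (((hgm.comp (measurable_fst.sub measurable_snd)).pow_const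
        _).aemeasurable)
  have hm2 : AEMeasurable fun x => ∫⁻ y, ‖f y‖ₑ * ‖g (x - y)‖ₑ ^ p :=
    AEMeasurable.lintegral_prod_right' (f := fun z : E × E => ‖f z.2‖ₑ * ‖g (z.1 - z.2)‖ₑ ^ p)
      ((hfm.comp_snd).mul (((hgm.comp (measurable_fst.sub measurable_snd)).pow_const
        _).aemeasurable))
  calc _ ≤ ((∫⁻ y, ‖f y‖ₑ) ^ (p - 1) * ((∫⁻ y, ‖f y‖ₑ) * ∫⁻ x, ‖g x‖ₑ ^ p)) ^ (1 / p) := by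
        refine ENNReal.rpow_le_rpow ?_ (by positivity)
        rw [← hswap, ← lintegral_const_mul'' _ hm2]
        exact lintegral_mono key
    _ = _ := by
        have h3 : (∫⁻ y, ‖f y‖ₑ) ^ (p - 1) * (∫⁻ y, ‖f y‖ₑ) = (∫⁻ y, ‖f y‖ₑ) ^ p := by
          nth_rewrite 2 [← ENNReal.rpow_one (∫⁻ y, ‖f y‖ₑ)]
          rw [← ENNReal.rpow_add_of_nonneg _ _ (by linarith) zero_le_one]
          congr 1
          ring
        rw [← mul_assoc, h3, ENNReal.mul_rpow_of_nonneg _ _ (by positivity), ← ENNReal.rpow_mul,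
          mul_one_div_cancel hp0.ne', ENNReal.rpow_one]

theorem integrable_convolution {f g : E → ℂ} (hf : Integrable f) (hg : Integrable g) :
    Integrable (f ⋆[ContinuousLinearMap.mul ℝ ℂ, volume] g) :=
  hf.integrable_convolution _ hg

theorem fourier_convolution {f g : E → ℂ} (hf : Integrable f) (hg : Integrable g) (ξ : E) :
    𝓕 (f ⋆[ContinuousLinearMap.mul ℝ ℂ, volume] g) ξ = 𝓕 f ξ * 𝓕 g ξ :=
  Real.fourier_mul_convolution_eq hf hg ξ

end FourierTools
end FracDiffusion

namespace FracDiffusion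

/-! ### Moving a line of integration inside a horizontal strip. -/

section Contour

open Complex Filter Topology

theorem integrable_of_exp_bounds {f : ℝ → ℂ} {a b C R : ℝ} (ha : 0 < a) (hb : 0 < b)
    (hf : Continuous f) (hbot : ∀ u ≤ -R, ‖f u‖ ≤ C * Real.exp (a * u))
    (htop : ∀ u, R ≤ u → ‖f u‖ ≤ C * Real.exp (-b * u)) : Integrable f := by
  have h1 : IntegrableOn f (Iic (-R)) := by
    refine Integrable.mono' ((integrableOn_exp_mul_Iic ha (-R)).const_mul C)
      hf.aestronglyMeasurable ?_
    filter_upwards [ae_restrict_mem measurableSet_Iic] with u hu using hbot u hu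
  have h2 : IntegrableOn f (Ioi R) := by
    refine Integrable.mono' ((integrableOn_exp_mul_Ioi (neg_lt_zero.2 hb) R).const_mul C)
      hf.aestronglyMeasurable ?_
    filter_upwards [ae_restrict_mem measurableSet_Ioi] with u hu using htop u (le_of_lt hu)
  have h3 : IntegrableOn f (Icc (-R) R) := hf.continuousOn.integrableOn_Icc
  rw [← integrableOn_univ]
  refine ((h1.union h3).union h2).mono_set fun u _ => ?_
  simp only [mem_union, mem_Iic, mem_Icc, mem_Ioi]
  grind

/-- Shifting the line of integration inside a strip in which the integrand is holomorphic and
decays exponentially. -/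
theorem integral_shift_line {H : ℂ → ℂ} {θ a b C R : ℝ} (hθ : 0 ≤ θ) (ha : 0 < a) (hb : 0 < b)
    (hH : DifferentiableOn ℂ H {w | w.im ∈ Icc 0 θ})
    (hbot : ∀ u y : ℝ, u ≤ -R → y ∈ Icc 0 θ → ‖H (u + y * I)‖ ≤ C * Real.exp (a * u))
    (htop : ∀ u y : ℝ, R ≤ u → y ∈ Icc 0 θ → ‖H (u + y * I)‖ ≤ C * Real.exp (-b * u)) :
    ∫ u : ℝ, H u = ∫ u : ℝ, H (u + θ * I) := by
  have hcont : ∀ y ∈ Icc 0 θ, Continuous fun u : ℝ => H (u + y * I) := by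
    intro y hy
    refine hH.continuousOn.comp_continuous (by fun_prop) fun u => ?_
    simpa using hy
  have hint : ∀ y ∈ Icc 0 θ, Integrable fun u : ℝ => H (u + y * I) := fun y hy =>
    integrable_of_exp_bounds ha hb (hcont y hy) (fun u hu => hbot u y hu hy)
      fun u hu => htop u y hu hy
  have h0 : (0 : ℝ) ∈ Icc 0 θ := ⟨le_rfl, hθ⟩
  have hθ' : θ ∈ Icc 0 θ := ⟨hθ, le_rfl⟩
  have t0 := intervalIntegral_tendsto_integral (hint 0 h0) tendsto_neg_atTop_atBot tendsto_id
  have tθ := intervalIntegral_tendsto_integral (hint θ hθ') tendsto_neg_atTop_atBot tendsto_id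
  have hexp : ∀ c : ℝ, 0 < c → Tendsto (fun r : ℝ => C * Real.exp (-c * r) * |θ - 0|) atTop
      (𝓝 0) := by
    intro c hc
    have : Tendsto (fun r : ℝ => Real.exp (-c * r)) atTop (𝓝 0) :=
      Real.tendsto_exp_atBot.comp (tendsto_id.const_mul_atTop_of_neg (neg_lt_zero.2 hc))
    simpa using (this.const_mul C).mul_const |θ - 0|
  have v1 : Tendsto (fun r : ℝ => ∫ y : ℝ in (0 : ℝ)..θ, H (r + y * I)) atTop (𝓝 0) := by
    refine squeeze_zero_norm' ?_ (hexp b hb)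
    filter_upwards [eventually_ge_atTop R] with r hr
    refine intervalIntegral.norm_integral_le_of_norm_le_const fun y hy => ?_
    rw [uIoc_of_le hθ] at hy
    exact htop r y hr ⟨hy.1.le, hy.2⟩
  have v2 : Tendsto (fun r : ℝ => ∫ y : ℝ in (0 : ℝ)..θ, H ((-r : ℝ) + y * I)) atTop (𝓝 0) := by
    refine squeeze_zero_norm' ?_ (hexp a ha)
    filter_upwards [eventually_ge_atTop R] with r hr
    refine intervalIntegral.norm_integral_le_of_norm_le_const fun y hy => ?_
    rw [uIoc_of_le hθ] at hy
    have := hbot (-r) y (by linarith) ⟨hy.1.le, hy.2⟩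
    rwa [mul_neg, ← neg_mul] at this
  have key : ∀ r : ℝ, (∫ u in -r..r, H (u + (0 : ℝ) * I)) - (∫ u in -r..r, H (u + θ * I)) =
      I • (∫ y : ℝ in (0 : ℝ)..θ, H ((-r : ℝ) + y * I)) -
        I • (∫ y : ℝ in (0 : ℝ)..θ, H (r + y * I)) := by
    intro r
    have := integral_boundary_rect_eq_zero_of_differentiableOn H ((-r : ℝ) : ℂ) (r + θ * I)
      (hH.mono fun w hw => by
        have := (mem_reProdIm.1 hw).2
        simpa [uIcc_of_le hθ] using this)
    simp only [ofReal_re, ofReal_im, add_re, add_im, mul_re, mul_im, I_re, I_im, mul_zero,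
      mul_one, zero_add, add_zero, sub_self] at this
    linear_combination this
  have lim := (t0.sub tθ).congr fun r => key r
  have lim' := (v2.const_smul I).sub (v1.const_smul I)
  have := tendsto_nhds_unique lim lim'
  simp only [ofReal_zero, zero_mul, add_zero, smul_zero, sub_zero] at this
  exact sub_eq_zero.1 this

end Contour

/-! ### Injectivity of the Laplace transform. -/

section Laplace

open Complex Filter Topology

/-- A function whose Laplace transform vanishes on the positive half-line is zero. -/
theorem ae_eq_zero_of_laplace_eq_zero {q : ℝ → ℝ}
    (hint : ∀ z : ℝ, 0 < z → IntegrableOn (fun t => Real.exp (-(z * t)) * q t) (Ioi 0))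
    (hzero : ∀ z : ℝ, 0 < z → ∫ t in Ioi (0 : ℝ), Real.exp (-(z * t)) * q t = 0) :
    q =ᵐ[volume.restrict (Ioi 0)] 0 := by
  have hqm : AEStronglyMeasurable q (volume.restrict (Ioi 0)) := by
    have h1 := (hint 1 one_pos).aestronglyMeasurable
    have h2 : AEStronglyMeasurable (fun t : ℝ => Real.exp (1 * t)) (volume.restrict (Ioi 0)) :=
      (by fun_prop : Continuous fun t : ℝ => Real.exp (1 * t)).aestronglyMeasurable
    refine (h2.mul h1).congr (Eventually.of_forall fun t => ?_)
    simp [← mul_assoc, ← Real.exp_add]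
  let G : ℂ → ℂ := fun ζ => ∫ t in Ioi (0 : ℝ), cexp (-(ζ * t)) * q t
  have hnorm : ∀ (ζ : ℂ) (t : ℝ), ‖cexp (-(ζ * t)) * q t‖ = ‖Real.exp (-(ζ.re * t)) * q t‖ := by
    intro ζ t
    rw [norm_mul, norm_mul, Complex.norm_exp, Complex.norm_real, Real.norm_of_nonneg
      (Real.exp_pos _).le]
    simp
  have hmeas : ∀ ζ : ℂ, AEStronglyMeasurable (fun t : ℝ => cexp (-(ζ * t)) * q t)
      (volume.restrict (Ioi 0)) := fun ζ =>
    (by fun_prop : Continuous fun t : ℝ => cexp (-(ζ * t))).aestronglyMeasurable.mul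
      (continuous_ofReal.comp_aestronglyMeasurable hqm)
  have hintc : ∀ ζ : ℂ, 0 < ζ.re → IntegrableOn (fun t : ℝ => cexp (-(ζ * t)) * q t) (Ioi 0) :=
    fun ζ hζ => (hint ζ.re hζ).congr' (hmeas ζ)
      (Eventually.of_forall fun t => (hnorm ζ t).symm)
  have hU : IsOpen {ζ : ℂ | 0 < ζ.re} := isOpen_lt continuous_const continuous_re
  -- Differentiation under the integral on `Re ζ' > r/2`: half of the exponential decay absorbs the
  -- factor `t`, through `t e^{-rt/4} ≤ 4/r`.
  have hdiff : DifferentiableOn ℂ G {ζ | 0 < ζ.re} := by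
    intro ζ hζ
    have hζ : 0 < ζ.re := hζ
    set r := ζ.re with hr
    have hs : {ζ' : ℂ | r / 2 < ζ'.re} ∈ 𝓝 ζ :=
      (isOpen_lt continuous_const continuous_re).mem_nhds (show r / 2 < ζ.re by linarith)
    have := hasDerivAt_integral_of_dominated_loc_of_deriv_le (μ := volume.restrict (Ioi (0 : ℝ)))
      (F := fun (ζ' : ℂ) (t : ℝ) => cexp (-(ζ' * t)) * q t)
      (F' := fun (ζ' : ℂ) (t : ℝ) => (cexp (-(ζ' * t)) * (-(1 * t))) * q t)
      (bound := fun t => 4 / r * ‖Real.exp (-(r / 4 * t)) * q t‖)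
      hs (Eventually.of_forall hmeas) (hintc ζ hζ)
      ((by fun_prop : Continuous fun t : ℝ => cexp (-(ζ * t)) *
        (-(1 * t))).aestronglyMeasurable.mul (continuous_ofReal.comp_aestronglyMeasurable hqm))
      ?_ ((hint (r / 4) (by positivity)).norm.const_mul _) ?_
    · exact this.2.differentiableAt.differentiableWithinAt
    · filter_upwards [ae_restrict_mem measurableSet_Ioi] with t ht ζ' hζ'
      have ht : 0 < t := ht
      have hζ' : r / 2 < ζ'.re := hζ'
      rw [mul_right_comm, norm_mul, hnorm, norm_mul, norm_mul, Real.norm_of_nonneg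
        (Real.exp_pos _).le, Real.norm_of_nonneg (Real.exp_pos _).le, norm_neg, one_mul,
        norm_real, Real.norm_of_nonneg ht.le]
      have e1 : Real.exp (-(ζ'.re * t)) ≤ Real.exp (-(r / 4 * t)) * Real.exp (-(r / 4 * t)) := by
        rw [← Real.exp_add]
        refine Real.exp_le_exp.2 ?_
        nlinarith
      have e2 : Real.exp (-(r / 4 * t)) * t ≤ 4 / r := by
        have := Real.add_one_le_exp (r / 4 * t)
        rw [Real.exp_neg, inv_mul_le_iff₀ (Real.exp_pos _), ← div_le_iff₀ (by positivity),
          div_div_eq_mul_div]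
        linarith
      calc Real.exp (-(ζ'.re * t)) * ‖q t‖ * t
          ≤ Real.exp (-(r / 4 * t)) * Real.exp (-(r / 4 * t)) * ‖q t‖ * t := by gcongr
        _ = (Real.exp (-(r / 4 * t)) * t) * (Real.exp (-(r / 4 * t)) * ‖q t‖) := by ring
        _ ≤ _ := by gcongr
    · refine Eventually.of_forall fun t ζ' _ => ?_
      exact ((((hasDerivAt_id ζ').mul_const (t : ℂ)).neg).cexp).mul_const _
  have hG : EqOn G 0 {ζ | 0 < ζ.re} := by
    refine (hdiff.analyticOnNhd hU).eqOn_zero_of_preconnected_of_frequently_eq_zero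
      (convex_halfSpace_re_gt 0).isPreconnected (z₀ := 1) (by simp) ?_
    -- The zeros `1 + 1/(n+1)` accumulate at `1`, so the identity theorem applies on the half-plane.
    have hseq : Tendsto (fun n : ℕ => ((1 + 1 / ((n : ℝ) + 1) : ℝ) : ℂ)) atTop (𝓝[≠] 1) := by
      refine tendsto_nhdsWithin_iff.2 ⟨?_, Eventually.of_forall fun n => ?_⟩
      · have := (continuous_ofReal.tendsto _).comp
          ((tendsto_one_div_add_atTop_nhds_zero_nat (𝕜 := ℝ)).const_add 1)
        rw [add_zero] at this
        exact_mod_cast this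
      · have : (0 : ℝ) < 1 / ((n : ℝ) + 1) := by positivity
        intro h
        have h' : (1 + 1 / ((n : ℝ) + 1) : ℝ) = 1 := by
          exact_mod_cast mem_singleton_iff.1 h
        linarith
    refine hseq.frequently (Eventually.of_forall fun n => ?_).frequently
    set z : ℝ := 1 + 1 / ((n : ℝ) + 1) with hz
    have hzp : 0 < z := by positivity
    have : G z = ((∫ t in Ioi (0 : ℝ), Real.exp (-(z * t)) * q t : ℝ) : ℂ) := by
      rw [← integral_complex_ofReal]
      simp [G]
    rw [this, hzero z hzp, ofReal_zero]
  -- The values of `G` on the line `Re ζ = 1` are the Fourier transform of `e^{-t} q(t)` on `t > 0`.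
  let f : ℝ → ℂ := (Ioi (0 : ℝ)).indicator fun t => cexp (-(1 * t)) * q t
  have hf : Integrable f := (integrable_indicator_iff measurableSet_Ioi).2 (hintc 1 (by simp))
  have hFf : 𝓕 f = 0 := by
    ext η
    rw [Real.fourier_eq']
    have h1 : ∀ v : ℝ, cexp (↑(-2 * Real.pi * inner ℝ v η) * I) • f v =
        (Ioi (0 : ℝ)).indicator (fun t : ℝ => cexp (-((1 + 2 * Real.pi * η * I) * t)) * q t) v := by
      intro v
      by_cases hv : v ∈ Ioi (0 : ℝ)
      · simp only [f, indicator_of_mem hv, smul_eq_mul, ← mul_assoc, ← Complex.exp_add]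
        congr 2
        simp
        ring
      · simp [f, indicator_of_notMem hv]
    simp_rw [h1]
    rw [integral_indicator measurableSet_Ioi]
    exact hG (by simp : (0 : ℝ) < (1 + 2 * Real.pi * η * I : ℂ).re)
  have hf0 := ae_eq_zero_of_fourier_eq_zero hf (by rw [hFf])
  rw [Filter.EventuallyEq, ae_restrict_iff' measurableSet_Ioi]
  filter_upwards [hf0] with t ht hmem
  simpa [f, indicator_of_mem hmem] using ht

end Laplace
end FracDiffusion

namespace FracDiffusion

/-! ### Estimates for `s^α/(s^α+x)` in a sector, in the variable `s = e^w`. -/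

section MittagLeffler

open Complex Filter Topology

/-- The direction `θ` of a ray along which `e^{s t}` decays while `s^α` stays away from the negative
half-line. -/
structure IsRayAngle (α θ : ℝ) : Prop where
  one_lt : 1 < α
  half_pi_lt : Real.pi / 2 < θ
  mul_lt_pi : α * θ < Real.pi

namespace IsRayAngle

variable {α θ : ℝ}

theorem pos (h : IsRayAngle α θ) : 0 < θ := by
  have := Real.pi_pos
  linarith [h.half_pi_lt]

theorem lt_pi (h : IsRayAngle α θ) : θ < Real.pi := by
  nlinarith [h.one_lt, h.pos, h.mul_lt_pi]

theorem cos_neg (h : IsRayAngle α θ) : 0 < -Real.cos θ := by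
  have := Real.cos_neg_of_pi_div_two_lt_of_lt h.half_pi_lt (by linarith [h.lt_pi, Real.pi_pos])
  linarith

theorem sin_pos (h : IsRayAngle α θ) : 0 < Real.sin θ :=
  Real.sin_pos_of_pos_of_lt_pi h.pos h.lt_pi

theorem cos_half_pos (h : IsRayAngle α θ) : 0 < Real.cos (α * θ / 2) := by
  have h1 := h.one_lt
  have h2 := h.pos
  have h3 := h.mul_lt_pi
  have : 0 < α * θ := by positivity
  exact Real.cos_pos_of_mem_Ioo ⟨by linarith [Real.pi_pos], by linarith⟩

end IsRayAngle

/-- The ratio `s^α / (s^α + x)` in the logarithmic variable `s = e^w`. -/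
def resolventRatio (α x : ℝ) (w : ℂ) : ℂ := cexp (α * w) / (cexp (α * w) + x)

/-- Multiplication by `e^{-iα Im w/2}` gives the two summands the opposite arguments `±α Im w/2`.
Both real parts then carry the same cosine, so no cancellation is possible. -/
theorem exp_add_norm_ge (α x : ℝ) (w : ℂ) :
    Real.cos (α * w.im / 2) * (Real.exp (α * w.re) + x) ≤ ‖cexp (α * w) + x‖ := by
  have h1 : ‖cexp (-(α * w.im / 2 : ℝ) * I)‖ = 1 := by
    rw [← ofReal_neg, Complex.norm_exp_ofReal_mul_I]
  rw [← one_mul ‖cexp (α * w) + x‖, ← h1, ← norm_mul]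
  refine le_trans (le_of_eq ?_) (Complex.re_le_norm _)
  have h2 : cexp (-(α * w.im / 2 : ℝ) * I) * (cexp (α * w) + x) =
      (Real.exp (α * w.re) : ℝ) * cexp ((α * w.im / 2 : ℝ) * I) +
        (x : ℝ) * cexp ((-(α * w.im / 2) : ℝ) * I) := by
    rw [mul_add, ← Complex.exp_add, ofReal_exp, ← Complex.exp_add]
    congr 1
    · congr 1
      nth_rewrite 2 [← Complex.re_add_im w]
      push_cast
      ring
    · rw [mul_comm, ofReal_neg]
  rw [h2, Complex.add_re, Complex.re_ofReal_mul, Complex.re_ofReal_mul,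
    Complex.exp_ofReal_mul_I_re, Complex.exp_ofReal_mul_I_re, Real.cos_neg]
  ring

variable {α θ x : ℝ}

theorem IsRayAngle.le_norm (h : IsRayAngle α θ) (hx : 0 ≤ x) {w : ℂ} (hw : |w.im| ≤ θ) :
    Real.cos (α * θ / 2) * (Real.exp (α * w.re) + x) ≤ ‖cexp (α * w) + x‖ := by
  refine le_trans ?_ (exp_add_norm_ge α x w)
  have h1 := h.one_lt
  refine mul_le_mul_of_nonneg_right ?_ (by positivity)
  rw [← Real.cos_abs (α * w.im / 2), abs_div, abs_mul, abs_two, abs_of_pos (by linarith : 0 < α)]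
  refine Real.cos_le_cos_of_nonneg_of_le_pi (by positivity) ?_ (by gcongr)
  linarith [h.mul_lt_pi, Real.pi_pos]

theorem IsRayAngle.norm_ratio_le (h : IsRayAngle α θ) (hx : 0 < x) {w : ℂ} (hw : |w.im| ≤ θ) :
    ‖resolventRatio α x w‖ ≤
      (Real.cos (α * θ / 2))⁻¹ * (Real.exp (α * w.re) / (Real.exp (α * w.re) + x)) := by
  have hκ := h.cos_half_pos
  have h1 := h.le_norm hx.le hw
  have hpos : 0 < Real.exp (α * w.re) + x := by positivity
  rw [resolventRatio, norm_div, Complex.norm_exp]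
  have : (α * w : ℂ).re = α * w.re := by simp
  rw [this, ← div_eq_inv_mul, div_div, mul_comm _ (Real.cos _)]
  exact div_le_div_of_nonneg_left (Real.exp_pos _).le (by positivity) h1

theorem IsRayAngle.norm_ratio_le_const (h : IsRayAngle α θ) (hx : 0 < x) {w : ℂ}
    (hw : |w.im| ≤ θ) : ‖resolventRatio α x w‖ ≤ (Real.cos (α * θ / 2))⁻¹ := by
  have hκ := h.cos_half_pos
  refine (h.norm_ratio_le hx hw).trans (mul_le_of_le_one_right (by positivity) ?_)
  rw [div_le_one (by positivity)]
  linarith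

theorem IsRayAngle.norm_ratio_le_exp (h : IsRayAngle α θ) (hx : 0 < x) {w : ℂ}
    (hw : |w.im| ≤ θ) :
    ‖resolventRatio α x w‖ ≤ (Real.cos (α * θ / 2))⁻¹ * x⁻¹ * Real.exp (α * w.re) := by
  have hκ := h.cos_half_pos
  refine (h.norm_ratio_le hx hw).trans ?_
  rw [mul_assoc, mul_comm x⁻¹, ← div_eq_mul_inv]
  gcongr
  linarith [Real.exp_pos (α * w.re)]

theorem exp_add_ne_zero (hx : 0 < x) {w : ℂ} (hw : |α * w.im| < Real.pi) :
    cexp (α * w) + x ≠ 0 := by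
  rw [← norm_pos_iff]
  refine lt_of_lt_of_le ?_ (exp_add_norm_ge α x w)
  have := abs_lt.1 hw
  have : 0 < Real.cos (α * w.im / 2) := Real.cos_pos_of_mem_Ioo ⟨by linarith, by linarith⟩
  positivity

theorem differentiableAt_resolventRatio (hx : 0 < x) {w : ℂ} (hw : |α * w.im| < Real.pi) :
    DifferentiableAt ℂ (resolventRatio α x) w := by
  unfold resolventRatio
  exact DifferentiableAt.div (by fun_prop) (by fun_prop) (exp_add_ne_zero hx hw)

theorem IsRayAngle.abs_mul_lt (h : IsRayAngle α θ) {y : ℝ} (hy : |y| ≤ θ) :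
    |α * y| < Real.pi := by
  rw [abs_mul, abs_of_pos (by linarith [h.one_lt])]
  refine lt_of_le_of_lt ?_ h.mul_lt_pi
  gcongr
  linarith [h.one_lt]

theorem IsRayAngle.continuous_ratio (h : IsRayAngle α θ) (hx : 0 < x) :
    Continuous fun u : ℝ => resolventRatio α x (u + θ * I) := by
  refine continuous_iff_continuousAt.2 fun u => ?_
  have : ContinuousAt (resolventRatio α x) (u + θ * I) :=
    (differentiableAt_resolventRatio hx (h.abs_mul_lt (by simp [abs_of_pos h.pos]))).continuousAt
  exact ContinuousAt.comp (f := fun u : ℝ => (u + θ * I : ℂ)) this (by fun_prop)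

theorem resolventRatio_ofReal (u : ℝ) :
    resolventRatio α x u = ((Real.exp (α * u) / (Real.exp (α * u) + x) : ℝ) : ℂ) := by
  simp [resolventRatio]

theorem IsRayAngle.im_line (h : IsRayAngle α θ) (u : ℝ) : |(u + θ * I : ℂ).im| ≤ θ := by
  simp [abs_of_pos h.pos]

/-- The real part of `e^w` on the ray. -/
theorem exp_line_re (u θ : ℝ) : (cexp (u + θ * I)).re = Real.exp u * Real.cos θ := by
  rw [Complex.exp_re]; simp

theorem exp_line_im (u θ : ℝ) : (cexp (u + θ * I)).im = Real.exp u * Real.sin θ := by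
  rw [Complex.exp_im]; simp

/-- `∫ e^{-w} s^α/(s^α+x) dw` along the ray is real. -/
theorem IsRayAngle.im_integral_exp_neg_mul_ratio (h : IsRayAngle α θ) (hx : 0 < x) :
    (∫ u : ℝ, cexp (-(u + θ * I)) * resolventRatio α x (u + θ * I)).im = 0 := by
  have hκ := h.cos_half_pos
  set κ := Real.cos (α * θ / 2)
  -- There is no pole in the strip, so the line moves down to the real axis, where the integrand is
  -- real. Convergence as `u → -∞` uses `α > 1`.
  have := integral_shift_line (H := fun w => cexp (-w) * resolventRatio α x w) (θ := θ)
    (a := α - 1) (b := 1) (C := κ⁻¹ * x⁻¹ + κ⁻¹) (R := 0) h.pos.le (by linarith [h.one_lt])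
    one_pos ?_ ?_ ?_
  · rw [← this]
    have : ∀ u : ℝ, cexp (-u) * resolventRatio α x u =
        ((Real.exp (-u) * (Real.exp (α * u) / (Real.exp (α * u) + x)) : ℝ) : ℂ) := by
      intro u
      rw [resolventRatio_ofReal]
      push_cast
      rfl
    simp_rw [this]
    rw [integral_complex_ofReal, ofReal_im]
  · intro w hw
    have hw : w.im ∈ Icc 0 θ := hw
    refine (DifferentiableAt.mul (by fun_prop) (differentiableAt_resolventRatio hx
      (h.abs_mul_lt ?_))).differentiableWithinAt
    rw [abs_of_nonneg hw.1]
    exact hw.2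
  · intro u y _ hy
    have hy' : |(u + y * I : ℂ).im| ≤ θ := by simpa [abs_of_nonneg hy.1] using hy.2
    have h1 := h.norm_ratio_le_exp hx hy'
    simp only [add_re, ofReal_re, mul_re, I_re, mul_zero, ofReal_im, I_im, mul_one, sub_self,
      add_zero] at h1
    rw [norm_mul, Complex.norm_exp]
    have : (-(u + y * I : ℂ)).re = -u := by simp
    rw [this]
    calc Real.exp (-u) * ‖resolventRatio α x (u + y * I)‖
        ≤ Real.exp (-u) * (κ⁻¹ * x⁻¹ * Real.exp (α * u)) := by gcongr
      _ = κ⁻¹ * x⁻¹ * Real.exp ((α - 1) * u) := by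
          rw [mul_left_comm, ← Real.exp_add]; congr 2; ring
      _ ≤ _ := by gcongr; linarith [inv_pos.2 hκ]
  · intro u y _ hy
    have hy' : |(u + y * I : ℂ).im| ≤ θ := by simpa [abs_of_nonneg hy.1] using hy.2
    have h1 := h.norm_ratio_le_const hx hy'
    rw [norm_mul, Complex.norm_exp]
    have : (-(u + y * I : ℂ)).re = -1 * u := by simp
    rw [this, mul_comm]
    gcongr
    have : 0 < κ⁻¹ * x⁻¹ := by positivity
    linarith

theorem IsRayAngle.slit_mem (h : IsRayAngle α θ) (z u : ℝ) :
    (z - cexp (u + θ * I)) ∈ slitPlane := by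
  refine Or.inr ?_
  have := mul_pos (Real.exp_pos u) h.sin_pos
  simp only [sub_im, ofReal_im, exp_line_im]
  linarith

theorem IsRayAngle.slit_mem_one_add (h : IsRayAngle α θ) (u : ℝ) :
    (1 + cexp (u + θ * I)) ∈ slitPlane := by
  refine Or.inr ?_
  have := mul_pos (Real.exp_pos u) h.sin_pos
  simp only [add_im, one_im, exp_line_im]
  linarith

/-- `|z - e^w| ≥ z + c e^u` on the ray. -/
theorem le_norm_sub (z u θ : ℝ) :
    z + -Real.cos θ * Real.exp u ≤ ‖(z : ℂ) - cexp (u + θ * I)‖ := by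
  refine le_trans (le_of_eq ?_) (Complex.re_le_norm _)
  rw [sub_re, exp_line_re, ofReal_re]
  ring

theorem le_norm_one_add (u θ : ℝ) :
    Real.cos (θ / 2) * (Real.exp u + 1) ≤ ‖1 + cexp (u + θ * I)‖ := by
  have := exp_add_norm_ge 1 1 (u + θ * I)
  simpa [add_comm] using this

theorem IsRayAngle.cos_half_pos' (h : IsRayAngle α θ) : 0 < Real.cos (θ / 2) :=
  Real.cos_pos_of_mem_Ioo ⟨by linarith [Real.pi_pos, h.pos], by linarith [h.lt_pi]⟩

theorem IsRayAngle.integrable_kernel (h : IsRayAngle α θ) {z : ℝ} (hz : 0 < z) :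
    Integrable fun u : ℝ => (1 + z) * cexp (u + θ * I) /
      ((1 + cexp (u + θ * I)) * (z - cexp (u + θ * I))) := by
  have hc := h.cos_neg
  have hκ := h.cos_half_pos'
  set c := -Real.cos θ
  set κ := Real.cos (θ / 2)
  have hcont : Continuous fun u : ℝ => (1 + z) * cexp (u + θ * I) /
      ((1 + cexp (u + θ * I)) * (z - cexp (u + θ * I))) := by
    refine Continuous.div (by fun_prop) (by fun_prop) fun u => mul_ne_zero ?_ ?_
    · exact slitPlane_ne_zero (h.slit_mem_one_add u)
    · exact slitPlane_ne_zero (h.slit_mem z u)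
  have hb : ∀ u : ℝ, ‖(1 + z) * cexp (u + θ * I) /
      ((1 + cexp (u + θ * I)) * (z - cexp (u + θ * I)))‖ ≤
        (1 + z) * Real.exp u / ((κ * (Real.exp u + 1)) * (z + c * Real.exp u)) := by
    intro u
    have e1 : ‖(1 + z : ℂ)‖ = 1 + z := by
      rw [← ofReal_one, ← ofReal_add, norm_real, Real.norm_of_nonneg (by positivity)]
    rw [norm_div, norm_mul, norm_mul, e1, Complex.norm_exp]
    have e2 : (u + θ * I : ℂ).re = u := by simp
    rw [e2]
    have := le_norm_one_add u θ
    have := le_norm_sub z u θ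
    gcongr
  refine integrable_of_exp_bounds (a := 1) (b := 1) (R := 0)
    (C := (1 + z) / (κ * z) + (1 + z) / (κ * c)) one_pos one_pos hcont ?_ ?_
  · intro u _
    refine (hb u).trans ?_
    calc _ ≤ (1 + z) * Real.exp u / ((κ * 1) * z) := by
          gcongr
          · linarith [Real.exp_pos u]
          · linarith [mul_pos hc (Real.exp_pos u)]
      _ = (1 + z) / (κ * z) * Real.exp (1 * u) := by rw [one_mul]; ring
      _ ≤ _ := by gcongr; linarith [show 0 < (1 + z) / (κ * c) by positivity]
  · intro u _
    refine (hb u).trans ?_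
    calc _ ≤ (1 + z) * Real.exp u / ((κ * Real.exp u) * (c * Real.exp u)) := by
          gcongr
          · linarith
          · linarith
      _ = (1 + z) / (κ * c) * Real.exp (-1 * u) := by
          rw [neg_one_mul, Real.exp_neg]
          field_simp
      _ ≤ _ := by gcongr; linarith [show 0 < (1 + z) / (κ * z) by positivity]

/-- The comparison integral for Cauchy's formula: its primitive is `log(1+s) - log(z-s)`. On the ray
`1+s` lies in the upper and `z-s` in the lower half-plane, so principal logarithms suffice. The
limit at `-∞` is real, and at `+∞` it is `iθ - i(θ-π) = iπ`. -/
theorem IsRayAngle.integral_kernel (h : IsRayAngle α θ) {z : ℝ} (hz : 0 < z) :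
    (∫ u : ℝ, (1 + z) * cexp (u + θ * I) /
      ((1 + cexp (u + θ * I)) * (z - cexp (u + θ * I)))).im = Real.pi := by
  let A : ℝ → ℂ := fun u => log (1 + cexp (u + θ * I)) - log (z - cexp (u + θ * I))
  have hderiv : ∀ u : ℝ, HasDerivAt A ((1 + z) * cexp (u + θ * I) /
      ((1 + cexp (u + θ * I)) * (z - cexp (u + θ * I)))) u := by
    intro u
    have e : HasDerivAt (fun u : ℝ => cexp (u + θ * I)) (cexp (u + θ * I)) u := by
      have := ((hasDerivAt_id (u : ℂ)).add_const (θ * I)).cexp.comp_ofReal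
      simpa using this
    have h1 := (e.const_add 1).clog_real (h.slit_mem_one_add u)
    have h2 := (e.const_sub (z : ℂ)).clog_real (h.slit_mem z u)
    refine (h1.sub h2).congr_deriv ?_
    have := slitPlane_ne_zero (h.slit_mem_one_add u)
    have := slitPlane_ne_zero (h.slit_mem z u)
    field_simp
    ring
  have hbot : Tendsto A atBot (𝓝 (log 1 - log z)) := by
    have e : Tendsto (fun u : ℝ => cexp (u + θ * I)) atBot (𝓝 0) := by
      rw [tendsto_zero_iff_norm_tendsto_zero]
      simp only [Complex.norm_exp, add_re, ofReal_re, mul_re, I_re, mul_zero, ofReal_im, I_im,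
        mul_one, sub_self, add_zero]
      exact Real.tendsto_exp_atBot
    refine Tendsto.sub ?_ ?_
    · refine Tendsto.clog (by simpa using e.const_add 1) (by simp)
    · refine Tendsto.clog (by simpa using e.const_sub (z : ℂ)) (by simpa using hz)
  have htop : Tendsto A atTop (𝓝 (log (cexp (θ * I)) - log (-cexp (θ * I)))) := by
    have e : Tendsto (fun u : ℝ => ((Real.exp (-u) : ℝ) : ℂ)) atTop (𝓝 0) := by
      have := (continuous_ofReal.tendsto 0).comp
        (Real.tendsto_exp_atBot.comp tendsto_neg_atTop_atBot)
      rwa [ofReal_zero] at this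
    have him : (cexp (θ * I)).im = Real.sin θ := Complex.exp_ofReal_mul_I_im θ
    have hs := h.sin_pos
    have hlim : Tendsto (fun u : ℝ => log ((Real.exp (-u) : ℝ) + cexp (θ * I)) -
        log ((Real.exp (-u) : ℝ) * z - cexp (θ * I))) atTop
        (𝓝 (log (cexp (θ * I)) - log (-cexp (θ * I)))) := by
      refine Tendsto.sub ?_ ?_
      · refine Tendsto.clog (by simpa using e.add_const (cexp (θ * I))) (Or.inr ?_)
        rw [him]; exact hs.ne'
      · refine Tendsto.clog (by simpa using (e.mul_const (z : ℂ)).sub_const (cexp (θ * I)))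
          (Or.inr ?_)
        rw [neg_im, him]; linarith
    -- Both logarithms contain the same growing term `u`, which cancels in the difference.
    refine hlim.congr fun u => ?_
    have e1 : (1 + cexp (u + θ * I)) =
        (Real.exp u : ℝ) * ((Real.exp (-u) : ℝ) + cexp (θ * I)) := by
      rw [mul_add, ← ofReal_mul, ← Real.exp_add, add_neg_cancel, Real.exp_zero, Complex.exp_add,
        ofReal_one, ofReal_exp]
    have e2 : (z - cexp (u + θ * I)) =
        (Real.exp u : ℝ) * ((Real.exp (-u) : ℝ) * z - cexp (θ * I)) := by
      rw [mul_sub, ← mul_assoc, ← ofReal_mul, ← Real.exp_add, add_neg_cancel, Real.exp_zero,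
        Complex.exp_add, ofReal_one, ofReal_exp, one_mul]
    simp only [A]
    rw [e1, e2, log_ofReal_mul (Real.exp_pos u), log_ofReal_mul (Real.exp_pos u)]
    · ring
    · intro h0
      have := congrArg Complex.im h0
      rw [sub_im, him, ← ofReal_mul, ofReal_im, zero_im] at this
      linarith
    · intro h0
      have := congrArg Complex.im h0
      rw [add_im, him, ofReal_im, zero_im] at this
      linarith
  rw [integral_of_hasDerivAt_of_tendsto hderiv (h.integrable_kernel hz) hbot htop]
  have e1 : log (cexp (θ * I)) = θ * I :=
    Complex.log_exp (by simp; linarith [h.pos, Real.pi_pos]) (by simpa using h.lt_pi.le)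
  have e2 : log (-cexp (θ * I)) = (θ - Real.pi : ℝ) * I := by
    have : -cexp (θ * I) = cexp ((θ - Real.pi : ℝ) * I) := by
      rw [ofReal_sub, sub_mul, Complex.exp_sub, Complex.exp_pi_mul_I, div_neg, div_one]
    rw [this]
    exact Complex.log_exp (by simp; linarith [h.pos]) (by simp; linarith [h.lt_pi, Real.pi_pos])
  rw [e1, e2, ← ofReal_log hz.le]
  simp

end MittagLeffler
end FracDiffusion

namespace FracDiffusion

/-! ### Cauchy's formula with the pole on the edge of the strip. -/

section MittagLeffler

open Complex Filter Topology

variable {α θ x : ℝ}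

theorem IsRayAngle.integrable_ratio_div (h : IsRayAngle α θ) (hx : 0 < x) {z : ℝ} (hz : 0 < z) :
    Integrable fun u : ℝ => resolventRatio α x (u + θ * I) / (z - cexp (u + θ * I)) := by
  have hc := h.cos_neg
  have hκ := h.cos_half_pos
  set c := -Real.cos θ with hcdef
  set κ := Real.cos (α * θ / 2)
  refine integrable_of_exp_bounds (a := α) (b := 1) (R := 0)
    (C := κ⁻¹ * x⁻¹ / z + κ⁻¹ / c) (by linarith [h.one_lt]) one_pos
    ((h.continuous_ratio hx).div (by fun_prop) fun u => slitPlane_ne_zero (h.slit_mem z u)) ?_ ?_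
  · intro u _
    have h1 := h.norm_ratio_le_exp hx (h.im_line u)
    have h2 := le_norm_sub z u θ
    simp only [add_re, ofReal_re, mul_re, I_re, mul_zero, ofReal_im, I_im, mul_one, sub_self,
      add_zero] at h1
    rw [norm_div]
    calc _ ≤ (κ⁻¹ * x⁻¹ * Real.exp (α * u)) / z := by
          gcongr
          linarith [mul_pos hc (Real.exp_pos u)]
      _ = κ⁻¹ * x⁻¹ / z * Real.exp (α * u) := by ring
      _ ≤ _ := by gcongr; linarith [show 0 < κ⁻¹ / c by positivity]
  · intro u _
    have h1 := h.norm_ratio_le_const hx (h.im_line u)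
    have h2 := le_norm_sub z u θ
    rw [norm_div]
    calc _ ≤ κ⁻¹ / (c * Real.exp u) := by
          gcongr
          linarith
      _ = κ⁻¹ / c * Real.exp (-1 * u) := by
          rw [neg_one_mul, Real.exp_neg]; field_simp
      _ ≤ _ := by gcongr; linarith [show 0 < κ⁻¹ * x⁻¹ / z by positivity]

theorem one_add_exp_ne_zero {w : ℂ} (hw : |w.im| < Real.pi) : 1 + cexp w ≠ 0 := by
  have := exp_add_ne_zero (α := 1) (x := 1) one_pos (w := w) (by simpa using hw)
  simpa [add_comm] using this

theorem abs_sub_exp_le {z : ℝ} (hz : 0 < z) (w : ℂ) :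
    |z - Real.exp w.re| ≤ ‖(z : ℂ) - cexp w‖ := by
  have := abs_norm_sub_norm_le (z : ℂ) (cexp w)
  rwa [Complex.norm_exp, norm_real, Real.norm_of_nonneg hz.le] at this

theorem le_norm_one_add_exp (hθ : θ < Real.pi) {w : ℂ} (hw : |w.im| ≤ θ) :
    Real.cos (θ / 2) * (Real.exp w.re + 1) ≤ ‖1 + cexp w‖ := by
  have h1 := exp_add_norm_ge 1 1 w
  rw [ofReal_one, one_mul, one_mul, one_mul, add_comm (cexp w)] at h1
  refine le_trans ?_ h1
  refine mul_le_mul_of_nonneg_right ?_ (by positivity)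
  rw [← Real.cos_abs (w.im / 2), abs_div, abs_two]
  exact Real.cos_le_cos_of_nonneg_of_le_pi (by positivity)
    (by linarith [Real.pi_pos]) (by gcongr)

/-- Cauchy's formula for `s^{α-1}/(s^α+x)` on the boundary of a sector. -/
theorem IsRayAngle.im_integral_ratio_div (h : IsRayAngle α θ) (hx : 0 < x) {z : ℝ} (hz : 0 < z) :
    (∫ u : ℝ, resolventRatio α x (u + θ * I) / (z - cexp (u + θ * I))).im =
      Real.pi * (z ^ (α - 1) / (z ^ α + x)) := by
  have hα := h.one_lt
  have hκ := h.cos_half_pos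
  have hκ' := h.cos_half_pos'
  set ℓ : ℂ := (Real.log z : ℂ) with hℓ
  have hexpℓ : cexp ℓ = z := by rw [hℓ, ← ofReal_exp, Real.exp_log hz]
  set g₀ : ℝ := z ^ α / (z ^ α + x) with hg₀
  have hgℓ : resolventRatio α x ℓ = g₀ := by
    rw [hℓ, resolventRatio_ofReal, mul_comm α, ← Real.rpow_def_of_pos hz]
  -- The pole `w = log z` lies on the real edge of the strip. It is removed by subtracting a
  -- multiple of the integrand of `integral_kernel`: the subtracted term equals `g₀` at `s = z`, its
  -- factor `s` gives decay at `-∞`, and the denominator `1+s` keeps it bounded at `+∞`.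
  let N : ℂ → ℂ := fun w => resolventRatio α x w - g₀ / z * ((1 + z) * cexp w / (1 + cexp w))
  let D : ℂ → ℂ := fun w => z - cexp w
  have hz' : (z : ℂ) ≠ 0 := ofReal_ne_zero.2 hz.ne'
  have hz1 : (1 + z : ℂ) ≠ 0 := by
    rw [← ofReal_one, ← ofReal_add]; exact ofReal_ne_zero.2 (by positivity)
  have hNℓ : N ℓ = 0 := by
    simp only [N, hgℓ, hexpℓ]
    field_simp
    ring
  have hDℓ : D ℓ = 0 := by simp [D, hexpℓ]
  let U : Set ℂ := {w | |α * w.im| < Real.pi}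
  have hUo : IsOpen U := isOpen_lt (by fun_prop) continuous_const
  have hUℓ : ℓ ∈ U := by
    show |α * ℓ.im| < Real.pi
    simp [hℓ, Real.pi_pos]
  have hUim : ∀ w ∈ U, |w.im| < Real.pi := by
    intro w hw
    have hw : |α * w.im| < Real.pi := hw
    rw [abs_mul, abs_of_pos (by linarith)] at hw
    nlinarith [abs_nonneg w.im]
  have hNd : DifferentiableOn ℂ N U := by
    intro w hw
    refine (DifferentiableAt.sub (differentiableAt_resolventRatio hx hw)
      (DifferentiableAt.const_mul (DifferentiableAt.div (c := fun w => (1 + z : ℂ) * cexp w)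
        (d := fun w => 1 + cexp w) (by fun_prop) (by fun_prop)
        (one_add_exp_ne_zero (hUim w hw))) _)).differentiableWithinAt
  have hDd : DifferentiableOn ℂ D U := by
    refine Differentiable.differentiableOn ?_
    simp only [D]; fun_prop
  have hUn : U ∈ 𝓝 ℓ := hUo.mem_nhds hUℓ
  have hDne : ∀ w ∈ U, w ≠ ℓ → D w ≠ 0 := by
    intro w hw hne h0
    have h1 : cexp w = cexp ℓ := by
      rw [hexpℓ]; exact (sub_eq_zero.1 h0).symm
    obtain ⟨n, hn⟩ := Complex.exp_eq_exp_iff_exists_int.1 h1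
    have h2 := hUim w hw
    have h3 : w.im = n * (2 * Real.pi) := by
      rw [hn]; simp [hℓ]
    rw [h3, abs_mul, abs_of_pos (by positivity : 0 < 2 * Real.pi)] at h2
    have h4 : |(n : ℝ)| < 1 := by nlinarith [Real.pi_pos, abs_nonneg (n : ℝ)]
    have h5 : n = 0 := by
      have : |n| < 1 := by exact_mod_cast h4
      exact Int.abs_lt_one_iff.1 this
    refine hne ?_
    rw [hn, h5]; simp
  -- The holomorphic extension of `N/D` across the common zero `ℓ`; the quotient of divided slopes
  -- supplies the right value there.
  let H : ℂ → ℂ := fun w => dslope N ℓ w / dslope D ℓ w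
  have hHeq : ∀ w, w ≠ ℓ → H w = N w / D w := by
    intro w hw
    simp only [H]
    rw [dslope_of_ne _ hw, dslope_of_ne _ hw, slope_def_field, slope_def_field, hNℓ, hDℓ, sub_zero,
      sub_zero, div_div_div_cancel_right₀ (sub_ne_zero.2 hw)]
  have hHd : DifferentiableOn ℂ H U := by
    refine DifferentiableOn.div ((Complex.differentiableOn_dslope hUn).2 hNd)
      ((Complex.differentiableOn_dslope hUn).2 hDd) fun w hw => ?_
    by_cases hwℓ : w = ℓ
    · have : HasDerivAt D (-cexp ℓ) ℓ := (Complex.hasDerivAt_exp ℓ).const_sub (z : ℂ)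
      rw [hwℓ, dslope_same, this.deriv, hexpℓ]
      exact neg_ne_zero.2 hz'
    · rw [dslope_of_ne _ hwℓ, slope_def_field, hDℓ, sub_zero]
      exact div_ne_zero (hDne w hw hwℓ) (sub_ne_zero.2 hwℓ)
  set κ := Real.cos (α * θ / 2)
  set κ' := Real.cos (θ / 2)
  have hg₀p : 0 ≤ g₀ := by positivity
  have hg₀1 : g₀ ≤ 1 := by
    rw [hg₀, div_le_one (by positivity)]
    linarith
  have hre : ∀ u y : ℝ, (u + y * I : ℂ).re = u := by simp
  have him : ∀ {u y : ℝ}, y ∈ Icc 0 θ → |(u + y * I : ℂ).im| ≤ θ := by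
    intro u y hy
    simpa [abs_of_nonneg hy.1] using hy.2
  have hfrac : ∀ u y : ℝ, y ∈ Icc 0 θ →
      ‖(g₀ / z : ℂ) * ((1 + z) * cexp (u + y * I) / (1 + cexp (u + y * I)))‖ ≤
        1 / z * ((1 + z) * Real.exp u / (κ' * (Real.exp u + 1))) := by
    intro u y hy
    have h1 := le_norm_one_add_exp h.lt_pi (him (u := u) hy)
    rw [hre] at h1
    have e1 : ‖(1 + z : ℂ)‖ = 1 + z := by
      rw [← ofReal_one, ← ofReal_add, norm_real, Real.norm_of_nonneg (by positivity)]
    rw [norm_mul, norm_div, norm_div, norm_mul, e1, Complex.norm_exp, hre, norm_real, norm_real,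
      Real.norm_of_nonneg hg₀p, Real.norm_of_nonneg hz.le]
    gcongr
  have hNtop : ∀ u y : ℝ, y ∈ Icc 0 θ → ‖N (u + y * I)‖ ≤ κ⁻¹ + (1 + z) / (z * κ') := by
    intro u y hy
    refine (norm_sub_le _ _).trans (add_le_add (h.norm_ratio_le_const hx (him hy))
      ((hfrac u y hy).trans ?_))
    calc _ ≤ 1 / z * ((1 + z) * Real.exp u / (κ' * Real.exp u)) := by gcongr; linarith
      _ = _ := by have := Real.exp_pos u; field_simp
  have hNbot : ∀ u y : ℝ, u ≤ 0 → y ∈ Icc 0 θ →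
      ‖N (u + y * I)‖ ≤ (κ⁻¹ * x⁻¹ + (1 + z) / (z * κ')) * Real.exp u := by
    intro u y hu hy
    rw [add_mul]
    refine (norm_sub_le _ _).trans (add_le_add ((h.norm_ratio_le_exp hx (him hy)).trans ?_)
      ((hfrac u y hy).trans ?_))
    · rw [hre]
      gcongr
      nlinarith
    · calc _ ≤ 1 / z * ((1 + z) * Real.exp u / (κ' * 1)) := by
            gcongr; linarith [Real.exp_pos u]
        _ = _ := by field_simp
  set R := |Real.log z| + 1 with hR
  have hexp1 : (2 : ℝ) ≤ Real.exp 1 := by linarith [Real.add_one_le_exp (1 : ℝ)]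
  have hRtop : ∀ u, R ≤ u → 2 * z ≤ Real.exp u := by
    intro u hu
    calc 2 * z ≤ Real.exp 1 * Real.exp (Real.log z) := by rw [Real.exp_log hz]; gcongr
      _ ≤ _ := by
        rw [← Real.exp_add]
        exact Real.exp_le_exp.2 (by linarith [le_abs_self (Real.log z)])
  have hRbot : ∀ u, u ≤ -R → 2 * Real.exp u ≤ z := by
    intro u hu
    calc 2 * Real.exp u ≤ Real.exp 1 * Real.exp u := by gcongr
      _ ≤ Real.exp (Real.log z) := by
        rw [← Real.exp_add]
        exact Real.exp_le_exp.2 (by linarith [neg_abs_le (Real.log z)])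
      _ = z := Real.exp_log hz
  have hneℓ : ∀ u y : ℝ, u ≠ Real.log z → (u + y * I : ℂ) ≠ ℓ := by
    intro u y hu h0
    have := congrArg Complex.re h0
    rw [hre, hℓ, ofReal_re] at this
    exact hu this
  have hshift := integral_shift_line (H := H) (θ := θ) (a := 1) (b := 1) (R := R)
    (C := (κ⁻¹ * x⁻¹ + (1 + z) / (z * κ')) / (z / 2) + (κ⁻¹ + (1 + z) / (z * κ')) * 2)
    h.pos.le one_pos one_pos ?_ ?_ ?_
  rotate_left
  · refine hHd.mono fun w hw => h.abs_mul_lt ?_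
    have hw : w.im ∈ Icc 0 θ := hw
    rw [abs_of_nonneg hw.1]
    exact hw.2
  · intro u y hu hy
    have hu0 : u ≤ 0 := by linarith [abs_nonneg (Real.log z)]
    rw [hHeq _ (hneℓ u y (by linarith [neg_abs_le (Real.log z)])), norm_div]
    have hD : z / 2 ≤ ‖D (u + y * I)‖ := by
      refine le_trans ?_ (abs_sub_exp_le hz _)
      rw [hre]
      exact le_trans (by linarith [hRbot u hu]) (le_abs_self _)
    calc _ ≤ (κ⁻¹ * x⁻¹ + (1 + z) / (z * κ')) * Real.exp u / (z / 2) := by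
          gcongr
          exact hNbot u y hu0 hy
      _ = (κ⁻¹ * x⁻¹ + (1 + z) / (z * κ')) / (z / 2) * Real.exp (1 * u) := by rw [one_mul]; ring
      _ ≤ _ := by
          gcongr
          have : 0 < (κ⁻¹ + (1 + z) / (z * κ')) * 2 := by positivity
          linarith
  · intro u y hu hy
    rw [hHeq _ (hneℓ u y (by linarith [le_abs_self (Real.log z)])), norm_div]
    have hD : Real.exp u / 2 ≤ ‖D (u + y * I)‖ := by
      refine le_trans ?_ (abs_sub_exp_le hz _)
      rw [hre]
      exact le_trans (by linarith [hRtop u hu]) (neg_le_abs _)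
    calc _ ≤ (κ⁻¹ + (1 + z) / (z * κ')) / (Real.exp u / 2) := by
          gcongr
          exact hNtop u y hy
      _ = (κ⁻¹ + (1 + z) / (z * κ')) * 2 * Real.exp (-1 * u) := by
          rw [neg_one_mul, Real.exp_neg]; field_simp
      _ ≤ _ := by
          gcongr
          have : 0 < (κ⁻¹ * x⁻¹ + (1 + z) / (z * κ')) / (z / 2) := by positivity
          linarith
  -- On the real axis `H` is real, so on the ray the imaginary part of the desired integral equals
  -- `g₀/z` times that of the comparison integral, which is `π`.
  have hreal : (∫ u : ℝ, H u).im = 0 := by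
    have : (fun u : ℝ => H u) =ᵐ[volume] fun u : ℝ =>
        (((Real.exp (α * u) / (Real.exp (α * u) + x) -
          g₀ / z * ((1 + z) * Real.exp u / (1 + Real.exp u))) / (z - Real.exp u) : ℝ) : ℂ) := by
      filter_upwards [Measure.ae_ne volume (Real.log z)] with u hu
      have hu' : (u : ℂ) ≠ ℓ := fun h0 => hu (ofReal_injective h0)
      rw [hHeq _ hu']
      simp only [N, D, resolventRatio_ofReal]
      push_cast
      rfl
    rw [integral_congr_ae this, integral_complex_ofReal, ofReal_im]
  have hray : ∀ u : ℝ, H (u + θ * I) =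
      resolventRatio α x (u + θ * I) / (z - cexp (u + θ * I)) -
        (g₀ / z : ℝ) * ((1 + z) * cexp (u + θ * I) /
          ((1 + cexp (u + θ * I)) * (z - cexp (u + θ * I)))) := by
    intro u
    have hne : (u + θ * I : ℂ) ≠ ℓ := by
      intro h0
      have := congrArg Complex.im h0
      simp [hℓ] at this
      exact h.pos.ne' this
    rw [hHeq _ hne]
    simp only [N, D]
    rw [sub_div, ofReal_div g₀ z]
    congr 1
    rw [mul_div_assoc, div_div]
  rw [hshift] at hreal
  simp_rw [hray] at hreal
  rw [integral_sub (h.integrable_ratio_div hx hz) ((h.integrable_kernel hz).const_mul _),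
    integral_const_mul, sub_im, Complex.im_ofReal_mul, h.integral_kernel hz, sub_eq_zero] at hreal
  rw [hreal, hg₀, Real.rpow_sub_one hz.ne']
  field_simp

end MittagLeffler
end FracDiffusion

namespace FracDiffusion

/-! ### The Mittag-Leffler function: Laplace transform, scaling, primitive. -/

section MittagLeffler

open Complex Filter Topology

variable {α θ x : ℝ}

/-- `π⁻¹ Im ∫ e^{s t} s^α / (s^α + x) ds/s` along the ray of direction `θ`. This is the
Mittag-Leffler function `E_α(-x t^α)`. -/
def mittagLeffler (α θ t x : ℝ) : ℝ :=
  Real.pi⁻¹ * (∫ u : ℝ, cexp (t * cexp (u + θ * I)) * resolventRatio α x (u + θ * I)).im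

theorem norm_exp_exp_line (t u θ : ℝ) :
    ‖cexp (t * cexp (u + θ * I))‖ = Real.exp (-(-Real.cos θ * t * Real.exp u)) := by
  rw [Complex.norm_exp, Complex.re_ofReal_mul, exp_line_re]
  congr 1
  ring

theorem IsRayAngle.integrable_exp_neg_mul_ratio (h : IsRayAngle α θ) (hx : 0 < x) :
    Integrable fun u : ℝ => cexp (-(u + θ * I)) * resolventRatio α x (u + θ * I) := by
  have hκ := h.cos_half_pos
  set κ := Real.cos (α * θ / 2)
  have hre : ∀ u : ℝ, (u + θ * I : ℂ).re = u := by simp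
  have hre' : ∀ u : ℝ, (-(u + θ * I : ℂ)).re = -u := by simp
  refine integrable_of_exp_bounds (a := α - 1) (b := 1) (R := 0) (C := κ⁻¹ * x⁻¹ + κ⁻¹)
    (by linarith [h.one_lt]) one_pos (Continuous.mul (by fun_prop) (h.continuous_ratio hx)) ?_ ?_
  · intro u _
    have h1 := h.norm_ratio_le_exp hx (h.im_line u)
    rw [norm_mul, Complex.norm_exp, hre']
    rw [hre] at h1
    calc Real.exp (-u) * ‖resolventRatio α x (u + θ * I)‖
        ≤ Real.exp (-u) * (κ⁻¹ * x⁻¹ * Real.exp (α * u)) := by gcongr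
      _ = κ⁻¹ * x⁻¹ * Real.exp ((α - 1) * u) := by
          rw [mul_left_comm, ← Real.exp_add]; congr 2; ring
      _ ≤ _ := by gcongr; linarith [inv_pos.2 hκ]
  · intro u _
    have h1 := h.norm_ratio_le_const hx (h.im_line u)
    rw [norm_mul, Complex.norm_exp, hre', mul_comm, neg_one_mul]
    gcongr
    have : 0 < κ⁻¹ * x⁻¹ := by positivity
    linarith

theorem IsRayAngle.integrable_exp_mul_ratio (h : IsRayAngle α θ) (hx : 0 < x) {t : ℝ}
    (ht : 0 < t) :
    Integrable fun u : ℝ => cexp (t * cexp (u + θ * I)) * resolventRatio α x (u + θ * I) := by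
  have hc := h.cos_neg
  -- From `e^{-y} ≤ 1/y` with `y = -cos θ · t e^u`, the double exponential is dominated by a
  -- multiple of `e^{-u}`.
  refine ((h.integrable_exp_neg_mul_ratio hx).norm.const_mul (-Real.cos θ * t)⁻¹).mono'
    ((by fun_prop : Continuous fun u : ℝ => cexp (t * cexp (u + θ * I))).mul
      (h.continuous_ratio hx)).aestronglyMeasurable (Eventually.of_forall fun u => ?_)
  rw [norm_mul, norm_mul, norm_exp_exp_line, Complex.norm_exp, ← mul_assoc]
  gcongr
  have hre' : (-(u + θ * I : ℂ)).re = -u := by simp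
  rw [hre', Real.exp_neg u, ← mul_inv, Real.exp_neg]
  have := Real.add_one_le_exp (-Real.cos θ * t * Real.exp u)
  gcongr
  linarith

theorem IsRayAngle.integrable_laplace_prod (h : IsRayAngle α θ) (hx : 0 < x) {z : ℝ}
    (hz : 0 < z) :
    Integrable (fun v : ℝ × ℝ =>
      cexp ((cexp (v.1 + θ * I) - z) * v.2) * resolventRatio α x (v.1 + θ * I))
      (volume.prod (volume.restrict (Ioi (0 : ℝ)))) := by
  have hc := h.cos_neg
  have hre : ∀ u : ℝ, (cexp (u + θ * I) - z).re = -(z + -Real.cos θ * Real.exp u) := by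
    intro u
    rw [sub_re, exp_line_re, ofReal_re]
    ring
  have hneg : ∀ u : ℝ, (cexp (u + θ * I) - z).re < 0 := by
    intro u
    rw [hre]
    have := mul_pos hc (Real.exp_pos u)
    linarith
  have hcont : Continuous fun v : ℝ × ℝ =>
      cexp ((cexp (v.1 + θ * I) - z) * v.2) * resolventRatio α x (v.1 + θ * I) :=
    Continuous.mul (by fun_prop) ((h.continuous_ratio hx).comp continuous_fst)
  rw [integrable_prod_iff hcont.aestronglyMeasurable]
  have hint : ∀ u : ℝ, IntegrableOn (fun t : ℝ => cexp ((cexp (u + θ * I) - z) * t) *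
      resolventRatio α x (u + θ * I)) (Ioi 0) :=
    fun u => (integrableOn_exp_mul_complex_Ioi (hneg u) 0).mul_const _
  refine ⟨Eventually.of_forall hint, ?_⟩
  have heq : ∀ u : ℝ, ∫ t in Ioi (0 : ℝ), ‖cexp ((cexp (u + θ * I) - z) * t) *
      resolventRatio α x (u + θ * I)‖ =
        (z + -Real.cos θ * Real.exp u)⁻¹ * ‖resolventRatio α x (u + θ * I)‖ := by
    intro u
    simp only [norm_mul, Complex.norm_exp, Complex.re_mul_ofReal]
    rw [integral_mul_const, integral_exp_mul_Ioi (hneg u), hre]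
    congr 1
    rw [mul_zero, Real.exp_zero, neg_div_neg_eq, one_div]
  suffices hs : Integrable fun u : ℝ =>
      (z + -Real.cos θ * Real.exp u)⁻¹ * ‖resolventRatio α x (u + θ * I)‖ from
    hs.congr (Eventually.of_forall fun u => (heq u).symm)
  refine ((h.integrable_ratio_div hx hz).norm.const_mul (-Real.cos θ)⁻¹).mono' ?_
    (Eventually.of_forall fun u => ?_)
  · refine Continuous.aestronglyMeasurable (Continuous.mul (Continuous.inv₀ (by fun_prop)
      fun u => ?_) (h.continuous_ratio hx).norm)
    have := mul_pos hc (Real.exp_pos u)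
    positivity
  · have := mul_pos hc (Real.exp_pos u)
    rw [norm_mul, norm_norm, Real.norm_of_nonneg (by positivity), norm_div, div_eq_inv_mul,
      ← mul_assoc, ← mul_inv]
    gcongr
    · have := slitPlane_ne_zero (h.slit_mem z u)
      positivity
    · have h1 : ‖(z : ℂ) - cexp (u + θ * I)‖ ≤ z + Real.exp u := by
        refine (norm_sub_le _ _).trans (le_of_eq ?_)
        rw [Complex.norm_exp, norm_real, Real.norm_of_nonneg hz.le]
        simp
      -- Because `-cos θ ≤ 1`, the quantities `z - cos θ · e^u` and `|z - s|` are comparable, and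
      -- integrability is inherited from the complex integrand.
      calc _ ≤ -Real.cos θ * (z + Real.exp u) := by gcongr
        _ ≤ _ := by
          have := Real.neg_one_le_cos θ
          nlinarith

theorem mittagLeffler_eq_laplace (t z : ℝ) : Real.exp (-(z * t)) * mittagLeffler α θ t x =
    Real.pi⁻¹ * (∫ u : ℝ, cexp ((cexp (u + θ * I) - z) * t) *
      resolventRatio α x (u + θ * I)).im := by
  have : ∀ u : ℝ, cexp ((cexp (u + θ * I) - z) * t) * resolventRatio α x (u + θ * I) =
      (Real.exp (-(z * t)) : ℝ) *
        (cexp (t * cexp (u + θ * I)) * resolventRatio α x (u + θ * I)) := by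
    intro u
    rw [← mul_assoc, ofReal_exp, ← Complex.exp_add]
    congr 2
    push_cast
    ring
  simp_rw [this]
  rw [integral_const_mul, Complex.im_ofReal_mul, mittagLeffler]
  ring

theorem IsRayAngle.integrableOn_laplace (h : IsRayAngle α θ) (hx : 0 < x) {z : ℝ} (hz : 0 < z) :
    IntegrableOn (fun t => Real.exp (-(z * t)) * mittagLeffler α θ t x) (Ioi 0) := by
  simp only [mittagLeffler_eq_laplace]
  exact ((h.integrable_laplace_prod hx hz).integral_prod_right).im.const_mul _

/-- By Fubini the time integral of `e^{(s-z)t}` is `1/(z-s)`, and what remains is Cauchy's formula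
`im_integral_ratio_div`. -/
theorem IsRayAngle.laplace_mittagLeffler (h : IsRayAngle α θ) (hx : 0 < x) {z : ℝ} (hz : 0 < z) :
    ∫ t in Ioi (0 : ℝ), Real.exp (-(z * t)) * mittagLeffler α θ t x =
      z ^ (α - 1) / (z ^ α + x) := by
  have hi := h.integrable_laplace_prod hx hz
  simp only [mittagLeffler_eq_laplace]
  have h1 := Complex.imCLM.integral_comp_comm hi.integral_prod_right
  simp only [imCLM_apply] at h1
  rw [integral_const_mul, h1]
  rw [← integral_integral_swap (f := fun u t : ℝ => cexp ((cexp (u + θ * I) - z) * t) *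
    resolventRatio α x (u + θ * I)) hi]
  have h3 : ∀ u : ℝ, ∫ t in Ioi (0 : ℝ), cexp ((cexp (u + θ * I) - z) * t) *
      resolventRatio α x (u + θ * I) = resolventRatio α x (u + θ * I) / (z - cexp (u + θ * I)) := by
    intro u
    rw [integral_mul_const, integral_exp_mul_complex_Ioi]
    · rw [ofReal_zero, mul_zero, Complex.exp_zero, neg_div, ← div_neg, neg_sub]
      ring
    · rw [sub_re, exp_line_re, ofReal_re]
      have := mul_pos h.cos_neg (Real.exp_pos u)
      linarith
  simp_rw [h3]
  rw [h.im_integral_ratio_div hx hz, ← mul_assoc, inv_mul_cancel₀ Real.pi_ne_zero, one_mul]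

theorem IsRayAngle.continuousOn_mittagLeffler (h : IsRayAngle α θ) (hx : 0 < x) :
    ContinuousOn (fun t => mittagLeffler α θ t x) (Ioi 0) := by
  intro t ht
  have ht : 0 < t := ht
  have hc := h.cos_neg
  refine ContinuousAt.continuousWithinAt ?_
  refine ContinuousAt.mul continuousAt_const (continuous_im.continuousAt.comp ?_)
  refine continuousAt_of_dominated
    (bound := fun u : ℝ => ‖cexp ((t / 2 : ℝ) * cexp (u + θ * I)) *
      resolventRatio α x (u + θ * I)‖) ?_ ?_
    (h.integrable_exp_mul_ratio hx (by positivity)).norm ?_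
  · exact Eventually.of_forall fun s => ((by fun_prop : Continuous fun u : ℝ =>
      cexp (s * cexp (u + θ * I))).mul (h.continuous_ratio hx)).aestronglyMeasurable
  · filter_upwards [lt_mem_nhds (half_lt_self ht)] with s hs
    refine Eventually.of_forall fun u => ?_
    rw [norm_mul, norm_mul, norm_exp_exp_line, norm_exp_exp_line]
    gcongr
  · refine Eventually.of_forall fun u => ?_
    fun_prop

/-- The substitution `s ↦ ts` along the ray is the translation of `u` by `log t`. -/
theorem mittagLeffler_scaling {t : ℝ} (ht : 0 < t) :
    mittagLeffler α θ t x = mittagLeffler α θ 1 (t ^ α * x) := by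
  unfold mittagLeffler
  rw [← integral_add_right_eq_self (fun u : ℝ => cexp ((1 : ℝ) * cexp (u + θ * I)) *
    resolventRatio α (t ^ α * x) (u + θ * I)) (Real.log t)]
  congr 3
  ext u
  have e1 : cexp ((u + Real.log t : ℝ) + θ * I) = t * cexp (u + θ * I) := by
    rw [ofReal_add, add_right_comm, Complex.exp_add, ← ofReal_exp, Real.exp_log ht, mul_comm]
  have e2 : cexp (α * ((u + Real.log t : ℝ) + θ * I)) = (t ^ α : ℝ) * cexp (α * (u + θ * I)) := by
    rw [Real.rpow_def_of_pos ht, ofReal_exp, ← Complex.exp_add]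
    congr 1
    push_cast
    ring
  have ht' : ((t ^ α : ℝ) : ℂ) ≠ 0 := ofReal_ne_zero.2 (by positivity)
  rw [e1, ofReal_one, one_mul, resolventRatio, resolventRatio, e2, ofReal_mul, ← mul_add,
    mul_div_mul_left _ _ ht']

/-- The primitive of the Mittag-Leffler function as an integral along the ray. -/
theorem IsRayAngle.integral_mittagLeffler (h : IsRayAngle α θ) (hx : 0 < x) {t : ℝ}
    (ht : 0 < t) :
    ∫ s in (0 : ℝ)..t, mittagLeffler α θ s x =
      Real.pi⁻¹ * (∫ u : ℝ, cexp (t * cexp (u + θ * I)) *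
        (cexp (-(u + θ * I)) * resolventRatio α x (u + θ * I))).im := by
  have hc := h.cos_neg
  have hcont : Continuous fun v : ℝ × ℝ =>
      cexp (v.2 * cexp (v.1 + θ * I)) * resolventRatio α x (v.1 + θ * I) :=
    Continuous.mul (by fun_prop) ((h.continuous_ratio hx).comp continuous_fst)
  have hi : Integrable (fun v : ℝ × ℝ =>
      cexp (v.2 * cexp (v.1 + θ * I)) * resolventRatio α x (v.1 + θ * I))
      (volume.prod (volume.restrict (Ioc (0 : ℝ) t))) := by
    -- On `(0, t]` the integrand is at most `e^t` times the Laplace integrand at `z = 1`.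
    have h1 := ((h.integrable_laplace_prod hx one_pos).mono_measure
      (Measure.prod_mono (le_refl (volume : Measure ℝ)) (Measure.restrict_mono
        (Ioc_subset_Ioi_self : Ioc (0 : ℝ) t ⊆ Ioi 0) (le_refl volume))))
    refine (h1.norm.const_mul (Real.exp t)).mono' hcont.aestronglyMeasurable ?_
    have hmem : ∀ᵐ v : ℝ × ℝ ∂(volume.prod (volume.restrict (Ioc (0 : ℝ) t))), v.2 ∈ Ioc 0 t :=
      Measure.quasiMeasurePreserving_snd.ae (ae_restrict_mem measurableSet_Ioc)
    filter_upwards [hmem] with v hv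
    rw [norm_mul, norm_mul, ← mul_assoc]
    gcongr
    rw [Complex.norm_exp, Complex.norm_exp, ← Real.exp_add]
    refine Real.exp_le_exp.2 ?_
    rw [Complex.re_ofReal_mul, Complex.re_mul_ofReal, sub_re, ofReal_one, one_re]
    nlinarith [hv.2]
  rw [intervalIntegral.integral_of_le ht.le]
  simp only [mittagLeffler]
  have h1 := Complex.imCLM.integral_comp_comm hi.integral_prod_right
  simp only [imCLM_apply] at h1
  rw [integral_const_mul, h1]
  rw [← integral_integral_swap (f := fun u s : ℝ => cexp (s * cexp (u + θ * I)) *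
    resolventRatio α x (u + θ * I)) hi]
  have h3 : ∀ u : ℝ, ∫ s in Ioc (0 : ℝ) t, cexp (s * cexp (u + θ * I)) *
      resolventRatio α x (u + θ * I) = cexp (t * cexp (u + θ * I)) *
        (cexp (-(u + θ * I)) * resolventRatio α x (u + θ * I)) -
          cexp (-(u + θ * I)) * resolventRatio α x (u + θ * I) := by
    intro u
    rw [integral_mul_const, ← intervalIntegral.integral_of_le ht.le]
    have := integral_exp_mul_complex (a := 0) (b := t) (c := cexp (u + θ * I))
      (Complex.exp_ne_zero _)
    simp_rw [mul_comm (cexp (u + θ * I))] at this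
    rw [this, Complex.exp_neg]
    simp only [ofReal_zero, zero_mul, Complex.exp_zero]
    ring
  have hj := h.integrable_exp_neg_mul_ratio hx
  have hj' : Integrable fun u : ℝ => cexp (t * cexp (u + θ * I)) *
        (cexp (-(u + θ * I)) * resolventRatio α x (u + θ * I)) := by
    refine hj.norm.mono' ((by fun_prop : Continuous fun u : ℝ =>
      cexp (t * cexp (u + θ * I))).aestronglyMeasurable.mul hj.aestronglyMeasurable)
      (Eventually.of_forall fun u => ?_)
    rw [norm_mul, norm_exp_exp_line]
    refine mul_le_of_le_one_left (norm_nonneg _) (Real.exp_le_one_iff.2 ?_)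
    have := Real.exp_pos u
    have : 0 < -Real.cos θ * t * Real.exp u := by positivity
    linarith
  -- The lower limit `s = 0` contributes `∫ e^{-w} s^α/(s^α+x) dw`, which is real and drops out of
  -- the imaginary part.
  simp_rw [h3]
  rw [integral_sub hj' hj, sub_im, h.im_integral_exp_neg_mul_ratio hx, sub_zero]

end MittagLeffler
end FracDiffusion

namespace FracDiffusion

/-! ### Fractional integrals and the Volterra equation. -/

section Volterra

open Filter Topology

theorem integrableOn_rpow_mul_exp {a z : ℝ} (ha : 0 < a) (hz : 0 < z) :
    IntegrableOn (fun r : ℝ => Real.exp (-(z * r)) * r ^ (a - 1)) (Ioi 0) := by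
  -- A non-integrable function has Bochner integral `0`, which contradicts the positive value
  -- `(1/z)^a Γ(a)`.
  by_contra hn
  have h1 := Real.integral_rpow_mul_exp_neg_mul_Ioi ha hz
  have h2 : ∫ t in Ioi (0 : ℝ), t ^ (a - 1) * Real.exp (-(z * t)) = 0 := by
    refine integral_undef fun h => hn ?_
    exact h.congr (Eventually.of_forall fun t => mul_comm _ _)
  rw [h2] at h1
  have := Real.Gamma_pos_of_pos ha
  have : 0 < (1 / z) ^ a * Real.Gamma a := by positivity
  linarith

theorem exp_mul_fracIntegral (a z t : ℝ) (φ : ℝ → ℝ) :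
    Real.exp (-(z * t)) * fracIntegral a φ t = (Real.Gamma a)⁻¹ *
      ∫ s in (0 : ℝ)..t, ContinuousLinearMap.mul ℝ ℝ (Real.exp (-(z * s)) * φ s)
        (Real.exp (-(z * (t - s))) * (t - s) ^ (a - 1)) := by
  rw [fracIntegral, mul_left_comm, ← intervalIntegral.integral_const_mul]
  congr 2
  ext s
  rw [ContinuousLinearMap.mul_apply']
  have : Real.exp (-(z * t)) = Real.exp (-(z * s)) * Real.exp (-(z * (t - s))) := by
    rw [← Real.exp_add]; congr 1; ring
  rw [this]
  ring

theorem integrableOn_exp_mul_fracIntegral {a z : ℝ} {φ : ℝ → ℝ} (ha : 0 < a) (hz : 0 < z)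
    (hφ : IntegrableOn (fun t => Real.exp (-(z * t)) * φ t) (Ioi 0)) :
    IntegrableOn (fun t => Real.exp (-(z * t)) * fracIntegral a φ t) (Ioi 0) := by
  have h := integrable_posConvolution hφ (integrableOn_rpow_mul_exp ha hz)
    (ContinuousLinearMap.mul ℝ ℝ)
  unfold posConvolution at h
  rw [integrable_indicator_iff measurableSet_Ioi] at h
  simp only [exp_mul_fracIntegral]
  exact h.const_mul _

/-- The Laplace transform of the fractional integral. -/
theorem laplace_fracIntegral {a z : ℝ} {φ : ℝ → ℝ} (ha : 0 < a) (hz : 0 < z)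
    (hφ : IntegrableOn (fun t => Real.exp (-(z * t)) * φ t) (Ioi 0)) :
    ∫ t in Ioi (0 : ℝ), Real.exp (-(z * t)) * fracIntegral a φ t =
      (1 / z) ^ a * ∫ t in Ioi (0 : ℝ), Real.exp (-(z * t)) * φ t := by
  simp only [exp_mul_fracIntegral]
  rw [integral_const_mul, integral_posConvolution hφ (integrableOn_rpow_mul_exp ha hz)
    (ContinuousLinearMap.mul ℝ ℝ), ContinuousLinearMap.mul_apply']
  have h1 := Real.integral_rpow_mul_exp_neg_mul_Ioi ha hz
  simp_rw [mul_comm _ (Real.exp _)] at h1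
  rw [h1]
  have := Real.Gamma_pos_of_pos ha
  field_simp

theorem continuousOn_fracIntegral {a : ℝ} {φ : ℝ → ℝ} (ha : 1 < a)
    (hφ : ∀ T, 0 < T → IntegrableOn φ (Ioc 0 T)) :
    ContinuousOn (fracIntegral a φ) (Ioi 0) := by
  intro t ht
  have ht : 0 < t := ht
  refine ContinuousAt.continuousWithinAt ?_
  set T := t + 1 with hT
  -- Replacing `r - s` by its positive part fixes the domain of integration; since `a > 1`, the
  -- extended kernel vanishes for `s > r` and is continuous.
  have heq : fracIntegral a φ =ᶠ[𝓝 t] fun r => (Real.Gamma a)⁻¹ *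
      ∫ s in Ioc 0 T, max (r - s) 0 ^ (a - 1) * φ s := by
    filter_upwards [Ioo_mem_nhds ht (lt_add_one t)] with r hr
    rw [fracIntegral, intervalIntegral.integral_of_le hr.1.le]
    congr 1
    have hsub : Ioc 0 r ⊆ Ioc 0 T := Ioc_subset_Ioc_right hr.2.le
    rw [← integral_indicator measurableSet_Ioc, ← integral_indicator measurableSet_Ioc]
    congr 1
    ext s
    by_cases hs : s ∈ Ioc 0 r
    · rw [indicator_of_mem hs, indicator_of_mem (hsub hs), max_eq_left (by linarith [hs.2])]
    · rw [indicator_of_notMem hs]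
      by_cases hs' : s ∈ Ioc 0 T
      · have : r < s := by
          by_contra hcon
          exact hs ⟨hs'.1, not_lt.1 hcon⟩
        rw [indicator_of_mem hs', max_eq_right (by linarith), Real.zero_rpow (by linarith),
          zero_mul]
      · rw [indicator_of_notMem hs']
  refine ContinuousAt.congr ?_ heq.symm
  have hcont : ∀ s, Continuous fun r : ℝ => max (r - s) 0 ^ (a - 1) := fun s =>
    Continuous.rpow_const (by fun_prop) fun r => Or.inr (by linarith)
  refine ContinuousAt.mul continuousAt_const (continuousAt_of_dominated
    (bound := fun s => T ^ (a - 1) * ‖φ s‖) ?_ ?_ ((hφ T (by linarith)).norm.const_mul _) ?_)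
  · refine Eventually.of_forall fun r => AEStronglyMeasurable.mul ?_
      (hφ T (by linarith)).aestronglyMeasurable
    have : Continuous fun s : ℝ => max (r - s) 0 ^ (a - 1) :=
      Continuous.rpow_const (by fun_prop) fun s => Or.inr (by linarith)
    exact this.aestronglyMeasurable
  · filter_upwards [Ioo_mem_nhds ht (lt_add_one t)] with r hr
    filter_upwards [ae_restrict_mem measurableSet_Ioc] with s hs
    rw [norm_mul, Real.norm_of_nonneg (by positivity)]
    have hmax : max (r - s) 0 ≤ T := max_le (by linarith [hr.2, hs.1]) (by linarith)
    exact mul_le_mul_of_nonneg_right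
      (Real.rpow_le_rpow (le_max_right _ _) hmax (by linarith)) (norm_nonneg _)
  · exact Eventually.of_forall fun s => (hcont s).continuousAt.mul continuousAt_const

variable {α θ x : ℝ}

theorem IsRayAngle.integrableOn_mittagLeffler (h : IsRayAngle α θ) (hx : 0 < x) (T : ℝ) :
    IntegrableOn (fun t => mittagLeffler α θ t x) (Ioc 0 T) := by
  have h1 := (h.integrableOn_laplace hx one_pos).mono_set (Ioc_subset_Ioi_self : Ioc 0 T ⊆ Ioi 0)
  have h2 := IntegrableOn.continuousOn_mul_of_subset (g := fun t : ℝ => Real.exp t)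
    (by fun_prop) h1 isCompact_Icc measurableSet_Ioc Ioc_subset_Icc_self
  refine h2.congr_fun (fun t _ => ?_) measurableSet_Ioc
  simp only
  rw [← mul_assoc, ← Real.exp_add]
  simp

/-- The Volterra equation characterising the Mittag-Leffler function. -/
theorem IsRayAngle.mittagLeffler_eq (h : IsRayAngle α θ) (hx : 0 < x) {t : ℝ} (ht : 0 < t) :
    mittagLeffler α θ t x = 1 - x * fracIntegral α (fun s => mittagLeffler α θ s x) t := by
  have hα : 0 < α := by linarith [h.one_lt]
  have i1 : ∀ z : ℝ, 0 < z → IntegrableOn (fun t : ℝ => Real.exp (-(z * t))) (Ioi 0) := by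
    intro z hz
    simpa [neg_mul] using exp_neg_integrableOn_Ioi 0 hz
  have e1 : ∀ z : ℝ, 0 < z → ∫ t in Ioi (0 : ℝ), Real.exp (-(z * t)) = z⁻¹ := by
    intro z hz
    have := integral_exp_mul_Ioi (neg_lt_zero.2 hz) 0
    simp only [neg_mul, mul_zero, Real.exp_zero, neg_div_neg_eq, one_div] at this
    exact this
  have i2 : ∀ z : ℝ, 0 < z → _ := fun z hz =>
    integrableOn_exp_mul_fracIntegral hα hz (h.integrableOn_laplace hx hz)
  -- Both sides have the same Laplace transform, as `I^α` becomes multiplication by `z^{-α}`;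
  -- continuity on `t > 0` then removes the null set.
  have key := ae_eq_zero_of_laplace_eq_zero (q := fun t => mittagLeffler α θ t x -
    (1 - x * fracIntegral α (fun s => mittagLeffler α θ s x) t)) ?_ ?_
  · have heq := Measure.eqOn_open_of_ae_eq (f := fun t => mittagLeffler α θ t x -
      (1 - x * fracIntegral α (fun s => mittagLeffler α θ s x) t)) (g := 0) key isOpen_Ioi
      ((h.continuousOn_mittagLeffler hx).sub (continuousOn_const.sub (continuousOn_const.mul
        (continuousOn_fracIntegral h.one_lt fun T _ => h.integrableOn_mittagLeffler hx T))))
      continuousOn_const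
    exact sub_eq_zero.1 (heq ht)
  · intro z hz
    refine ((h.integrableOn_laplace hx hz).sub ((i1 z hz).sub ((i2 z hz).const_mul x))).congr
      (Eventually.of_forall fun t => ?_)
    simp only [Pi.sub_apply]
    ring
  · intro z hz
    have : ∀ t, Real.exp (-(z * t)) * (mittagLeffler α θ t x -
        (1 - x * fracIntegral α (fun s => mittagLeffler α θ s x) t)) =
        Real.exp (-(z * t)) * mittagLeffler α θ t x - (Real.exp (-(z * t)) -
          x * (Real.exp (-(z * t)) * fracIntegral α (fun s => mittagLeffler α θ s x) t)) := by
      intro t; ring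
    have i3 : IntegrableOn (fun t => Real.exp (-(z * t)) - x * (Real.exp (-(z * t)) *
        fracIntegral α (fun s => mittagLeffler α θ s x) t)) (Ioi 0) :=
      (i1 z hz).sub ((i2 z hz).const_mul x)
    simp_rw [this]
    rw [integral_sub (h.integrableOn_laplace hx hz) i3,
      integral_sub (i1 z hz) ((i2 z hz).const_mul x), integral_const_mul,
      laplace_fracIntegral hα hz (h.integrableOn_laplace hx hz), h.laplace_mittagLeffler hx hz,
      e1 z hz, Real.rpow_sub_one hz.ne', Real.div_rpow zero_le_one hz.le, Real.one_rpow]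
    have := Real.rpow_pos_of_pos hz α
    field_simp
    ring

end Volterra
end FracDiffusion

namespace FracDiffusion

/-! ### Integrable kernels: resolvents, their mixtures along the ray, and the remainder of the time
primitive. -/

section Kernels

open Complex Filter Topology

variable {E : Type*} [NormedAddCommGroup E] [InnerProductSpace ℝ E] [FiniteDimensional ℝ E]
  [MeasurableSpace E] [BorelSpace E]

/-- The symbol `|2πξ|²` of `-Δ`. -/
def laplaceSymbol {E : Type*} [NormedAddCommGroup E] (ξ : E) : ℝ := (2 * Real.pi * ‖ξ‖) ^ 2

section

variable {E : Type*} [NormedAddCommGroup E]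

theorem laplaceSymbol_nonneg (ξ : E) : 0 ≤ laplaceSymbol ξ := sq_nonneg _

theorem laplaceSymbol_pos {ξ : E} (hξ : ξ ≠ 0) : 0 < laplaceSymbol ξ := by
  have := Real.pi_pos
  have := norm_pos_iff.2 hξ
  unfold laplaceSymbol
  positivity

theorem laplaceSymbol_neg (ξ : E) : laplaceSymbol (-ξ) = laplaceSymbol ξ := by
  simp [laplaceSymbol]

theorem laplaceSymbol_smul [NormedSpace ℝ E] (c : ℝ) (ξ : E) :
    laplaceSymbol (c • ξ) = c ^ 2 * laplaceSymbol ξ := by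
  rw [laplaceSymbol, laplaceSymbol, norm_smul, Real.norm_eq_abs, ← sq_abs c]
  ring

end

theorem exists_gaussian {τ : ℂ} (hτ : 0 < τ.re) :
    ∃ G : E → ℂ, Continuous G ∧ Integrable G ∧ ∀ ξ, 𝓕 G ξ = cexp (-τ * laplaceSymbol ξ) := by
  have hτ0 : τ ≠ 0 := by
    intro h
    simp [h] at hτ
  -- The Gaussian `e^{-b|v|²}` has transform `A e^{-π²|ξ|²/b}`; this `b` turns the exponent into
  -- `-τ|2πξ|²`, and `A` is divided out.
  set b : ℂ := (4 * τ)⁻¹ with hb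
  have hbre : 0 < b.re := by
    rw [hb, inv_re]
    have : (4 * τ).re = 4 * τ.re := by simp
    rw [this]
    have : 0 < normSq (4 * τ) := normSq_pos.2 (by simpa using hτ0)
    positivity
  have hb0 : b ≠ 0 := by
    intro h
    simp [h] at hbre
  set A : ℂ := (Real.pi / b) ^ (Module.finrank ℝ E / 2 : ℂ) with hA
  have hA0 : A ≠ 0 := by
    rw [hA, Complex.cpow_def_of_ne_zero]
    · exact Complex.exp_ne_zero _
    · exact div_ne_zero (ofReal_ne_zero.2 Real.pi_ne_zero) hb0
  have hint : Integrable fun v : E => cexp (-b * ‖v‖ ^ 2) := by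
    have := GaussianFourier.integrable_cexp_neg_mul_sq_norm_add hbre 0 (0 : E)
    simpa using this
  refine ⟨fun v => A⁻¹ * cexp (-b * ‖v‖ ^ 2), by fun_prop, hint.const_mul _, fun ξ => ?_⟩
  have h1 := fourier_gaussian_innerProductSpace hbre ξ
  rw [Real.fourier_eq] at h1 ⊢
  have h2 : ∀ v : E, Real.fourierChar (-inner ℝ v ξ) • (A⁻¹ * cexp (-b * ‖v‖ ^ 2)) =
      A⁻¹ * (Real.fourierChar (-inner ℝ v ξ) • cexp (-b * ‖v‖ ^ 2)) := by
    intro v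
    simp only [Circle.smul_def, smul_eq_mul]
    ring
  simp_rw [h2]
  rw [integral_const_mul, h1, ← mul_assoc, inv_mul_cancel₀ hA0, one_mul]
  congr 1
  rw [hb, laplaceSymbol]
  push_cast
  field_simp
  ring

/-- The resolvent `(s - Δ)⁻¹` has an integrable kernel when `s` can be rotated into the right
half-plane together with the time variable of the heat semigroup. -/
theorem exists_resolvent {s τ : ℂ} (hτ : 0 < τ.re) (hs : 0 < (τ * s).re) :
    ∃ Q : E → ℂ, StronglyMeasurable Q ∧ Integrable Q ∧
      ∀ ξ, 𝓕 Q ξ = (s + laplaceSymbol ξ)⁻¹ := by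
  obtain ⟨G, hGc, hGi, hG⟩ := exists_gaussian (E := E) hτ
  have hτ0 : τ ≠ 0 := by
    intro h
    simp [h] at hτ
  -- The resolvent is the Laplace transform of the heat semigroup, taken along the complex ray of
  -- times `τρ`. Time `ρ` corresponds to dilation by `ρ^{-1/2}`.
  set m : ℝ → ℂ := fun ρ => τ * cexp (-(τ * s) * ρ)
  have hm : Integrable m (volume.restrict (Ioi 0)) :=
    (integrableOn_exp_mul_complex_Ioi (a := -(τ * s)) (by simpa using hs) 0).const_mul τ
  set δ : ℝ → ℝ := fun ρ => (√ρ)⁻¹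
  have hδm : Measurable δ := by fun_prop
  have hδ : ∀ᵐ ρ ∂(volume.restrict (Ioi (0 : ℝ))), 0 < δ ρ := by
    filter_upwards [ae_restrict_mem measurableSet_Ioi] with ρ hρ
    exact inv_pos.2 (Real.sqrt_pos.2 hρ)
  have hi := integrable_mixture hm hδm hδ hGc.stronglyMeasurable hGi
  refine ⟨hi.aestronglyMeasurable.mk _, hi.aestronglyMeasurable.stronglyMeasurable_mk,
    hi.congr hi.aestronglyMeasurable.ae_eq_mk, fun ξ => ?_⟩
  rw [← Real.fourier_congr_ae hi.aestronglyMeasurable.ae_eq_mk,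
    fourier_mixture hm hδm hδ hGc.stronglyMeasurable hGi]
  have hre : 0 < (τ * (s + laplaceSymbol ξ)).re := by
    rw [mul_add, add_re, Complex.re_mul_ofReal]
    have := laplaceSymbol_nonneg ξ
    positivity
  have h1 : ∀ ρ ∈ Ioi (0 : ℝ), m ρ * 𝓕 G ((δ ρ)⁻¹ • ξ) =
      τ * cexp (-(τ * (s + laplaceSymbol ξ)) * ρ) := by
    intro ρ hρ
    have hρ : 0 < ρ := hρ
    rw [hG, laplaceSymbol_smul, inv_inv, Real.sq_sqrt hρ.le, mul_assoc, ← Complex.exp_add]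
    congr 2
    push_cast
    ring
  rw [setIntegral_congr_fun measurableSet_Ioi h1, integral_const_mul,
    integral_exp_mul_complex_Ioi (by simpa using hre)]
  have h0 : s + laplaceSymbol ξ ≠ 0 := by
    intro h
    simp [h] at hre
  rw [ofReal_zero, mul_zero, Complex.exp_zero]
  field_simp

variable {α θ : ℝ}

theorem IsRayAngle.exists_ray_resolvent (h : IsRayAngle α θ) :
    ∃ Q : E → ℂ, StronglyMeasurable Q ∧ Integrable Q ∧
      ∀ ξ, 𝓕 Q ξ = (cexp (α * θ * I) + laplaceSymbol ξ)⁻¹ := by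
  -- Bisecting the angle: both `τ` and `τ e^{iαθ}` have argument of modulus `αθ/2 < π/2`.
  refine exists_resolvent (τ := cexp ((-(α * θ / 2) : ℝ) * I)) ?_ ?_
  · rw [Complex.exp_ofReal_mul_I_re, Real.cos_neg]
    exact h.cos_half_pos
  · rw [← Complex.exp_add]
    have : ((-(α * θ / 2) : ℝ) * I + α * θ * I) = ((α * θ / 2 : ℝ) : ℂ) * I := by
      push_cast; ring
    rw [this, Complex.exp_ofReal_mul_I_re]
    exact h.cos_half_pos

/-- A mixture along the ray of the resolvent kernels. -/
theorem IsRayAngle.exists_ray_mixture (h : IsRayAngle α θ) : ∃ B : ℝ, 0 ≤ B ∧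
    ∀ m : ℝ → ℂ, Integrable m → ∃ K : E → ℂ, Integrable K ∧ ∫ x, ‖K x‖ ≤ B * ∫ u, ‖m u‖ ∧
      ∀ ξ, 𝓕 K ξ = ∫ u : ℝ, m u * resolventRatio α (laplaceSymbol ξ) (u + θ * I) := by
  obtain ⟨Q, hQm, hQi, hQ⟩ := h.exists_ray_resolvent (E := E)
  refine ⟨∫ x, ‖Q x‖, by positivity, fun m hm => ?_⟩
  set e : ℂ := cexp (α * θ * I) with he
  have hm' : Integrable fun u => m u * e := hm.mul_const e
  have hδm : Measurable fun u : ℝ => Real.exp (α * u / 2) := by fun_prop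
  have hδ : ∀ᵐ u : ℝ, 0 < Real.exp (α * u / 2) := Eventually.of_forall fun u => Real.exp_pos _
  -- On the ray `s^α = e^{αu} e`, so `s^α/(s^α+x) = e/(e + e^{-αu} x)`: the symbol of `e Q` dilated
  -- by `e^{αu/2}`.
  refine ⟨mixture volume (fun u => m u * e) (fun u => Real.exp (α * u / 2)) Q,
    integrable_mixture hm' hδm hδ hQm hQi, ?_, fun ξ => ?_⟩
  · refine (integral_norm_mixture_le hm' hδm hδ hQm hQi).trans (le_of_eq ?_)
    have : ‖e‖ = 1 := by
      rw [he, ← ofReal_mul, Complex.norm_exp_ofReal_mul_I]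
    simp [this, mul_comm]
  · rw [fourier_mixture hm' hδm hδ hQm hQi]
    congr 1
    ext u
    rw [hQ, laplaceSymbol_smul, mul_assoc]
    congr 1
    have e1 : cexp (α * (u + θ * I)) = (Real.exp (α * u) : ℝ) * e := by
      rw [he, ofReal_exp, ← Complex.exp_add]
      congr 1
      push_cast
      ring
    have e2 : (Real.exp (α * u / 2))⁻¹ ^ 2 = (Real.exp (α * u))⁻¹ := by
      rw [inv_pow, ← Real.exp_nat_mul]
      congr 2
      push_cast
      ring
    have e3 : ((Real.exp (α * u) : ℝ) : ℂ) ≠ 0 := ofReal_ne_zero.2 (Real.exp_pos _).ne'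
    rw [resolventRatio, e1, e2, ofReal_mul, ofReal_inv, ← div_eq_mul_inv,
      ← mul_div_mul_left e _ e3, mul_add, ← mul_assoc _ _ (laplaceSymbol ξ : ℂ),
      mul_inv_cancel₀ e3, one_mul]

/-- The weight `e^s` tends to `1` as `s → 0` and is not integrable against `du`. Subtracting
`(1-s)⁻¹`, which has the same limit, leaves `O(|s|)` near zero and `O(1/|s|)` at infinity; the
subtracted part is evaluated by Cauchy's formula at `z = 1`. -/
theorem IsRayAngle.integrable_regularized (h : IsRayAngle α θ) :
    Integrable fun u : ℝ => cexp (cexp (u + θ * I)) - (1 - cexp (u + θ * I))⁻¹ := by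
  have hc := h.cos_neg
  set c := -Real.cos θ
  have hnorm : ∀ u : ℝ, ‖cexp (u + θ * I)‖ = Real.exp u := by
    intro u
    rw [Complex.norm_exp]
    simp
  have hlow : ∀ u : ℝ, 1 + c * Real.exp u ≤ ‖1 - cexp (u + θ * I)‖ := by
    intro u
    have := le_norm_sub 1 u θ
    rwa [ofReal_one] at this
  have hpos : ∀ u : ℝ, 0 < c * Real.exp u := fun u => mul_pos hc (Real.exp_pos u)
  have hne : ∀ u : ℝ, 1 - cexp (u + θ * I) ≠ 0 := fun u =>
    norm_pos_iff.1 (by linarith [hlow u, hpos u])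
  refine integrable_of_exp_bounds (a := 1) (b := 1) (C := 3 + 2 / c) (R := 0) one_pos one_pos
    (Continuous.sub (by fun_prop) (Continuous.inv₀ (by fun_prop) hne)) ?_ ?_
  · intro u hu
    have hu : u ≤ 0 := by simpa using hu
    have hs1 : ‖cexp (u + θ * I)‖ ≤ 1 := by
      rw [hnorm]
      exact Real.exp_le_one_iff.2 hu
    have e1 := Complex.norm_exp_sub_one_le hs1
    have e2 : ‖1 - (1 - cexp (u + θ * I))⁻¹‖ ≤ Real.exp u := by
      have : 1 - (1 - cexp (u + θ * I))⁻¹ = -cexp (u + θ * I) / (1 - cexp (u + θ * I)) := by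
        have := hne u
        field_simp
        ring
      rw [this, norm_div, norm_neg, hnorm]
      exact div_le_self (Real.exp_pos u).le (by linarith [hlow u, hpos u])
    rw [hnorm] at e1
    calc _ = ‖(cexp (cexp (u + θ * I)) - 1) + (1 - (1 - cexp (u + θ * I))⁻¹)‖ := by ring_nf
      _ ≤ 2 * Real.exp u + Real.exp u := (norm_add_le _ _).trans (add_le_add e1 e2)
      _ = 3 * Real.exp (1 * u) := by rw [one_mul]; ring
      _ ≤ _ := by gcongr; linarith [show 0 < 2 / c by positivity]
  · intro u _
    have e1 : ‖cexp (cexp (u + θ * I))‖ ≤ (c * Real.exp u)⁻¹ := by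
      have := norm_exp_exp_line 1 u θ
      rw [ofReal_one, one_mul, mul_one] at this
      rw [this, Real.exp_neg]
      have := Real.add_one_le_exp (c * Real.exp u)
      have := hpos u
      gcongr
      linarith
    have e2 : ‖(1 - cexp (u + θ * I))⁻¹‖ ≤ (c * Real.exp u)⁻¹ := by
      rw [norm_inv]
      have := hpos u
      gcongr
      linarith [hlow u]
    calc _ ≤ (c * Real.exp u)⁻¹ + (c * Real.exp u)⁻¹ :=
          (norm_sub_le _ _).trans (add_le_add e1 e2)
      _ = 2 / c * Real.exp (-1 * u) := by
          rw [neg_one_mul, Real.exp_neg]; field_simp; norm_num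
      _ ≤ _ := by gcongr; linarith

/-- The fundamental solution at time `1`. -/
theorem IsRayAngle.exists_kernel (h : IsRayAngle α θ) :
    ∃ p₁ : E → ℝ, StronglyMeasurable p₁ ∧ Integrable p₁ ∧
      ∀ ξ : E, ξ ≠ 0 → 𝓕 (fun x => (p₁ x : ℂ)) ξ = mittagLeffler α θ 1 (laplaceSymbol ξ) := by
  obtain ⟨R, hRm, hRi, hR⟩ := exists_resolvent (E := E) (s := 1) (τ := 1) (by simp) (by simp)
  obtain ⟨B, -, hB⟩ := h.exists_ray_mixture (E := E)
  obtain ⟨K, hKi, -, hK⟩ := hB _ h.integrable_regularized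
  -- The term `(1-s)⁻¹` removed from the weight contributes `1/(1+x)`, the symbol of `(1-Δ)⁻¹`. The
  -- factor `i` restores it in the imaginary part.
  set L : E → ℂ := fun x => I * R x + (Real.pi : ℂ)⁻¹ * K x with hL
  have hLi : Integrable L := (hRi.const_mul I).add (hKi.const_mul _)
  have hLF : ∀ ξ, 𝓕 L ξ = I * 𝓕 R ξ + (Real.pi : ℂ)⁻¹ * 𝓕 K ξ := by
    intro ξ
    simp only [Real.fourier_eq]
    rw [← integral_const_mul, ← integral_const_mul, ← integral_add]
    · congr 1
      ext x
      simp only [hL, Circle.smul_def, smul_eq_mul]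
      ring
    · exact ((Real.fourierIntegral_convergent_iff ξ).2 hRi).const_mul _
    · exact ((Real.fourierIntegral_convergent_iff ξ).2 hKi).const_mul _
  have hpi : Integrable fun x => (L x).im := hLi.im
  refine ⟨hpi.aestronglyMeasurable.mk _, hpi.aestronglyMeasurable.stronglyMeasurable_mk,
    hpi.congr hpi.aestronglyMeasurable.ae_eq_mk, fun ξ hξ => ?_⟩
  have hae : (fun x => ((hpi.aestronglyMeasurable.mk _ x : ℝ) : ℂ)) =ᵐ[volume]
      fun x => ((L x).im : ℂ) := by
    filter_upwards [hpi.aestronglyMeasurable.ae_eq_mk] with x hx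
    rw [hx]
  have hX := laplaceSymbol_pos hξ
  rw [Real.fourier_congr_ae hae, fourier_im hLi]
  · rw [hLF, hR, hK, mittagLeffler]
    congr 1
    have h1 : ∀ u : ℝ, (cexp (cexp (u + θ * I)) - (1 - cexp (u + θ * I))⁻¹) *
        resolventRatio α (laplaceSymbol ξ) (u + θ * I) =
        cexp ((1 : ℝ) * cexp (u + θ * I)) * resolventRatio α (laplaceSymbol ξ) (u + θ * I) -
          resolventRatio α (laplaceSymbol ξ) (u + θ * I) / ((1 : ℝ) - cexp (u + θ * I)) := by
      intro u
      rw [ofReal_one, one_mul, sub_mul, div_eq_inv_mul]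
    simp_rw [h1]
    rw [integral_sub (h.integrable_exp_mul_ratio hX one_pos) (h.integrable_ratio_div hX one_pos),
      ← ofReal_inv, add_im, Complex.im_ofReal_mul, sub_im,
      h.im_integral_ratio_div hX one_pos, mul_sub, ← mul_assoc _ Real.pi,
      inv_mul_cancel₀ Real.pi_ne_zero, Real.one_rpow, Real.one_rpow]
    have h2 : (I * (1 + (laplaceSymbol ξ : ℂ))⁻¹).im = 1 / (1 + laplaceSymbol ξ) := by
      rw [← ofReal_one, ← ofReal_add, ← ofReal_inv, Complex.im_mul_ofReal]
      simp
    rw [h2]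
    ring
  · rw [hLF, hLF, hR, hR, hK, hK, laplaceSymbol_neg]

theorem IsRayAngle.lt_two (h : IsRayAngle α θ) : α < 2 := by
  nlinarith [h.one_lt, h.half_pi_lt, h.mul_lt_pi, Real.pi_pos]

theorem IsRayAngle.integrable_velocity_weight (h : IsRayAngle α θ) {t : ℝ} (ht : 0 < t) :
    Integrable fun u : ℝ => cexp (t * cexp (u + θ * I)) * cexp ((α - 1) * (u + θ * I)) := by
  have hc := h.cos_neg
  set c := -Real.cos θ
  have hre : ∀ u : ℝ, ((α - 1) * (u + θ * I) : ℂ).re = (α - 1) * u := by simp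
  refine integrable_of_exp_bounds (a := α - 1) (b := 3 - α) (C := 1 + 2 / (c * t) ^ 2) (R := 0)
    (by linarith [h.one_lt]) (by linarith [h.lt_two]) (by fun_prop) ?_ ?_
  · intro u _
    rw [norm_mul, norm_exp_exp_line, Complex.norm_exp, hre]
    gcongr
    have : 0 < c * t * Real.exp u := by positivity
    refine (Real.exp_le_one_iff.2 (by linarith)).trans ?_
    have : 0 < 2 / (c * t) ^ 2 := by positivity
    linarith
  · intro u _
    rw [norm_mul, norm_exp_exp_line, Complex.norm_exp, hre]
    have hp : 0 < c * t * Real.exp u := by positivity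
    have := Real.quadratic_le_exp_of_nonneg hp.le
    calc Real.exp (-(c * t * Real.exp u)) * Real.exp ((α - 1) * u)
        ≤ ((c * t * Real.exp u) ^ 2 / 2)⁻¹ * Real.exp ((α - 1) * u) := by
          rw [Real.exp_neg]
          gcongr
          linarith
      _ = 2 / (c * t) ^ 2 * Real.exp (-(3 - α) * u) := by
          have : Real.exp ((α - 1) * u) = Real.exp (-(3 - α) * u) * Real.exp u ^ 2 := by
            rw [← Real.exp_nat_mul, ← Real.exp_add]
            congr 1
            push_cast
            ring
          rw [this]
          field_simp
      _ ≤ _ := by gcongr; linarith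

/-- Translation by `log t` rescales `s` to `s/t`; the weight `s^{α-1}` yields the factor `t^{1-α}`.
-/
theorem integral_norm_velocity_weight {t : ℝ} (ht : 0 < t) :
    ∫ u : ℝ, ‖cexp (t * cexp (u + θ * I)) * cexp ((α - 1) * (u + θ * I))‖ =
      t ^ (1 - α) *
        ∫ u : ℝ, ‖cexp ((1 : ℝ) * cexp (u + θ * I)) * cexp ((α - 1) * (u + θ * I))‖ := by
  rw [← integral_const_mul, ← integral_add_right_eq_self (fun u : ℝ => t ^ (1 - α) *
    ‖cexp ((1 : ℝ) * cexp (u + θ * I)) * cexp ((α - 1) * (u + θ * I))‖) (Real.log t)]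
  congr 1
  ext u
  have hre : ∀ u : ℝ, ((α - 1) * (u + θ * I) : ℂ).re = (α - 1) * u := by simp
  rw [norm_mul, norm_mul, norm_exp_exp_line, norm_exp_exp_line, Complex.norm_exp,
    Complex.norm_exp, hre, hre, Real.exp_add u, Real.exp_log ht, Real.rpow_def_of_pos ht,
    ← Real.exp_add, ← Real.exp_add, ← Real.exp_add]
  congr 1
  ring

/-- The gain of two derivatives for the primitive in time of the fundamental solution. -/
theorem IsRayAngle.exists_velocity_remainder (h : IsRayAngle α θ) : ∃ C : ℝ, 0 ≤ C ∧
    ∀ t : ℝ, 0 < t → ∃ (c : ℂ) (S : E → ℂ), Integrable S ∧ ‖c‖ ≤ C * t ^ (1 - α) ∧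
      ∫ x, ‖S x‖ ≤ C * t ^ (1 - α) ∧ ∀ ξ : E, ξ ≠ 0 →
        (laplaceSymbol ξ : ℂ) * (∫ s in (0 : ℝ)..t, mittagLeffler α θ s (laplaceSymbol ξ) : ℝ) =
          c + 𝓕 S ξ := by
  obtain ⟨B, hB0, hB⟩ := h.exists_ray_mixture (E := E)
  set J : ℝ := ∫ u : ℝ, ‖cexp ((1 : ℝ) * cexp (u + θ * I)) * cexp ((α - 1) * (u + θ * I))‖
  have hJ : 0 ≤ J := by positivity
  have hπ := Real.pi_pos
  refine ⟨Real.pi⁻¹ * (1 + B) * J, by positivity, fun t ht => ?_⟩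
  have hw := h.integrable_velocity_weight ht
  obtain ⟨K, hKi, hKn, hK⟩ := hB _ hw
  rw [integral_norm_velocity_weight ht] at hKn
  have htp := Real.rpow_pos_of_pos ht (1 - α)
  refine ⟨(Real.pi⁻¹ * (∫ u : ℝ, cexp (t * cexp (u + θ * I)) *
    cexp ((α - 1) * (u + θ * I))).im : ℝ), fun x => -(Real.pi : ℂ)⁻¹ * ((K x).im : ℂ),
    hKi.im.ofReal.const_mul _, ?_, ?_, fun ξ hξ => ?_⟩
  · rw [norm_real, norm_mul, Real.norm_of_nonneg (by positivity)]
    have := (Complex.abs_im_le_norm _).trans ((norm_integral_le_integral_norm _).trans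
      (integral_norm_velocity_weight (α := α) (θ := θ) ht).le)
    calc _ ≤ Real.pi⁻¹ * (t ^ (1 - α) * J) := by gcongr; exact this
      _ = Real.pi⁻¹ * (1 + 0) * J * t ^ (1 - α) := by ring
      _ ≤ _ := by gcongr
  · have : ∀ x, ‖-(Real.pi : ℂ)⁻¹ * ((K x).im : ℂ)‖ = Real.pi⁻¹ * ‖(K x).im‖ := by
      intro x
      rw [norm_mul, norm_neg, norm_inv, norm_real, norm_real, Real.norm_of_nonneg hπ.le]
    simp_rw [this]
    rw [integral_const_mul]
    calc _ ≤ Real.pi⁻¹ * ∫ x, ‖K x‖ := by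
          gcongr
          · exact hKi.im.norm
          · exact hKi.norm
          · exact fun x => Complex.abs_im_le_norm _
      _ ≤ Real.pi⁻¹ * (B * (t ^ (1 - α) * J)) := by gcongr
      _ = Real.pi⁻¹ * (0 + B) * J * t ^ (1 - α) := by ring
      _ ≤ _ := by gcongr; exact zero_le_one
  · have hX := laplaceSymbol_pos hξ
    have hF : 𝓕 (fun x => -(Real.pi : ℂ)⁻¹ * ((K x).im : ℂ)) ξ =
        -(Real.pi : ℂ)⁻¹ * 𝓕 (fun x => ((K x).im : ℂ)) ξ := by
      rw [Real.fourier_eq, Real.fourier_eq, ← integral_const_mul]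
      congr 1
      ext x
      simp only [Circle.smul_def, smul_eq_mul]
      ring
    rw [hF, fourier_im hKi (by rw [hK, hK, laplaceSymbol_neg]), hK, h.integral_mittagLeffler hX ht]
    have hwr : Integrable fun u : ℝ => cexp (t * cexp (u + θ * I)) *
        cexp ((α - 1) * (u + θ * I)) * resolventRatio α (laplaceSymbol ξ) (u + θ * I) := by
      refine (hw.norm.mul_const (Real.cos (α * θ / 2))⁻¹).mono'
        (hw.aestronglyMeasurable.mul (h.continuous_ratio hX).aestronglyMeasurable)
        (Eventually.of_forall fun u => ?_)
      rw [norm_mul]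
      gcongr
      exact h.norm_ratio_le_const hX (h.im_line u)
    -- The identity `x s^{α-1}/(s^α+x) = s^{α-1} - s^{α-1} s^α/(s^α+x)`. The first term does not
    -- depend on `ξ` and gives the constant `c`; the second is a ray mixture and gives `S`.
    have hsub : (laplaceSymbol ξ : ℂ) * ∫ u : ℝ, cexp (t * cexp (u + θ * I)) *
        (cexp (-(u + θ * I)) * resolventRatio α (laplaceSymbol ξ) (u + θ * I)) =
        (∫ u : ℝ, cexp (t * cexp (u + θ * I)) * cexp ((α - 1) * (u + θ * I))) -
          ∫ u : ℝ, cexp (t * cexp (u + θ * I)) * cexp ((α - 1) * (u + θ * I)) *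
            resolventRatio α (laplaceSymbol ξ) (u + θ * I) := by
      rw [← integral_const_mul, ← integral_sub hw hwr]
      congr 1
      ext u
      have hne := exp_add_ne_zero hX (h.abs_mul_lt (h.im_line u))
      have e1 : cexp ((α - 1) * (u + θ * I)) =
          cexp (α * (u + θ * I)) * cexp (-(u + θ * I)) := by
        rw [← Complex.exp_add]; congr 1; ring
      rw [resolventRatio, e1]
      generalize cexp (α * (u + θ * I)) = A at hne
      field_simp
      ring
    have him := congrArg Complex.im hsub
    rw [Complex.im_ofReal_mul, sub_im] at him
    rw [← ofReal_inv, ← ofReal_mul, ← ofReal_neg, ← ofReal_mul, ← ofReal_add]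
    congr 1
    rw [mul_left_comm, him]
    ring

end Kernels
end FracDiffusion

namespace FracDiffusion

/-! ### Pairings with Schwartz functions and the Laplacian in frequency. -/

section Pairing

theorem laplacian_postcompCLM {E : Type*} [NormedAddCommGroup E] [InnerProductSpace ℝ E]
    [FiniteDimensional ℝ E] {F G : Type*} [NormedAddCommGroup F] [NormedSpace ℝ F]
    [NormedAddCommGroup G] [NormedSpace ℝ G] (L : F →L[ℝ] G) (φ : 𝓢(E, F)) (x : E) :
    (Δ (φ.postcompCLM L)) x = L ((Δ φ) x) := by
  rw [SchwartzMap.laplacian_apply, SchwartzMap.laplacian_apply]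
  exact ((φ.smooth 2).contDiffAt (x := x)).laplacian_CLM_comp_left (l := L)

variable {E : Type*} [NormedAddCommGroup E] [InnerProductSpace ℝ E] [FiniteDimensional ℝ E]
  [MeasurableSpace E] [BorelSpace E]

theorem ofReal_convolution (f g : E → ℝ) (x : E) :
    (((f ⋆[ContinuousLinearMap.mul ℝ ℝ, volume] g) x : ℝ) : ℂ) =
      ((fun y => (f y : ℂ)) ⋆[ContinuousLinearMap.mul ℝ ℂ, volume] fun y => (g y : ℂ)) x := by
  rw [convolution_def, convolution_def, ← integral_complex_ofReal]
  simp

theorem integral_norm_convolution_le {f g : E → ℝ} (hf : Integrable f) (hg : Integrable g) :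
    ∫ x, ‖(f ⋆[ContinuousLinearMap.mul ℝ ℝ, volume] g) x‖ ≤ (∫ x, ‖f x‖) * ∫ x, ‖g x‖ := by
  rw [← ContinuousLinearMap.mul_apply' ℝ ℝ (∫ x, ‖f x‖),
    ← integral_convolution (ContinuousLinearMap.mul ℝ ℝ) hf.norm hg.norm]
  refine integral_mono (hf.integrable_convolution _ hg).norm
    (hf.norm.integrable_convolution _ hg.norm) fun x => ?_
  refine (norm_integral_le_integral_norm _).trans (le_of_eq ?_)
  rw [convolution_def]
  simp

theorem fourier_laplacian (φ : 𝓢(E, ℂ)) (ξ : E) :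
    (𝓕 (Δ φ) : 𝓢(E, ℂ)) ξ = -(laplaceSymbol ξ : ℂ) * (𝓕 φ : 𝓢(E, ℂ)) ξ := by
  have hg : (fun x : E => ‖x‖ ^ 2).HasTemperateGrowth := by fun_prop
  rw [SchwartzMap.laplacian_eq_fourierMultiplierCLM, FourierTransform.fourier_smul,
    SchwartzMap.fourierMultiplierCLM_apply, FourierTransform.fourier_fourierInv_eq,
    _root_.smul_apply, SchwartzMap.smulLeftCLM_apply_apply hg, laplaceSymbol,
    Complex.real_smul, Complex.real_smul]
  push_cast
  ring

theorem fourierInv_laplacian (φ : 𝓢(E, ℂ)) (ξ : E) :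
    (𝓕⁻ (Δ φ) : 𝓢(E, ℂ)) ξ = -(laplaceSymbol ξ : ℂ) * (𝓕⁻ φ : 𝓢(E, ℂ)) ξ := by
  have key : ∀ ψ : 𝓢(E, ℂ), (𝓕⁻ ψ : 𝓢(E, ℂ)) ξ = (𝓕 ψ : 𝓢(E, ℂ)) (-ξ) := fun ψ => by
    rw [SchwartzMap.fourierInv_coe, SchwartzMap.fourier_coe, Real.fourierInv_eq_fourier_neg]
  rw [key, key, fourier_laplacian, laplaceSymbol_neg]

/-- Parseval's formula for an integrable function and a Schwartz function. -/
theorem integral_mul_schwartzMap {f : E → ℂ} (hf : Integrable f) (φ : 𝓢(E, ℂ)) :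
    ∫ x, f x * φ x = ∫ ξ, 𝓕 f ξ * (𝓕⁻ φ : 𝓢(E, ℂ)) ξ := by
  rw [integral_fourier_mul_eq hf (𝓕⁻ φ : 𝓢(E, ℂ)).integrable, ← SchwartzMap.fourier_coe,
    FourierTransform.fourier_fourierInv_eq]

theorem integrable_mul_schwartzMap {𝕜 : Type*} [RCLike 𝕜] {f : E → 𝕜} (hf : Integrable f)
    (φ : 𝓢(E, 𝕜)) : Integrable fun x => f x * φ x := by
  obtain ⟨C, hC⟩ := φ.decay 0 0
  refine hf.mul_bdd (c := C) φ.continuous.aestronglyMeasurable (Filter.Eventually.of_forall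
    fun x => ?_)
  simpa using hC.2 x

end Pairing

end FracDiffusion

namespace FracDiffusion

/-! ### The self-similar fundamental solution. -/

section Existence

open Filter

variable {E : Type*} [NormedAddCommGroup E] [InnerProductSpace ℝ E] [FiniteDimensional ℝ E]
  [MeasurableSpace E] [BorelSpace E] {α θ : ℝ} {q : E → ℝ}

/-- The self-similar kernel `t^{-αn/2} q(t^{-α/2} x)`. -/
def selfSimilarKernel (α : ℝ) (q : E → ℝ) (t : ℝ) : E → ℝ := dilate (t ^ (-(α / 2))) q

theorem ofReal_dilate {E : Type*} [NormedAddCommGroup E] [InnerProductSpace ℝ E] (δ : ℝ)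
    (q : E → ℝ) (x : E) :
    ((dilate δ q x : ℝ) : ℂ) = dilate δ (fun y => (q y : ℂ)) x := by
  simp [dilate]

theorem fourier_selfSimilarKernel {t : ℝ} (ht : 0 < t) (q : E → ℝ) (ξ : E) :
    𝓕 (fun x => (selfSimilarKernel α q t x : ℂ)) ξ =
      𝓕 (fun x => (q x : ℂ)) (t ^ (α / 2) • ξ) := by
  simp only [selfSimilarKernel, ofReal_dilate]
  rw [fourier_dilate (Real.rpow_pos_of_pos ht _), ← Real.rpow_neg ht.le, neg_neg]

theorem fourier_eq_mittagLeffler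
    (hq : ∀ ξ : E, ξ ≠ 0 → 𝓕 (fun x => (q x : ℂ)) ξ = mittagLeffler α θ 1 (laplaceSymbol ξ))
    {t : ℝ} (ht : 0 < t) {ξ : E} (hξ : ξ ≠ 0) :
    𝓕 (fun x => (q x : ℂ)) (t ^ (α / 2) • ξ) = mittagLeffler α θ t (laplaceSymbol ξ) := by
  rw [hq _ (smul_ne_zero (Real.rpow_pos_of_pos ht _).ne' hξ), laplaceSymbol_smul,
    mittagLeffler_scaling ht, ← Real.rpow_natCast, ← Real.rpow_mul ht.le]
  norm_num

theorem integrable_selfSimilarKernel (hqi : Integrable q) {t : ℝ} (ht : 0 < t) :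
    Integrable (selfSimilarKernel α q t) :=
  integrable_dilate (Real.rpow_pos_of_pos ht _) hqi

theorem integral_norm_selfSimilarKernel (q : E → ℝ) {t : ℝ} (ht : 0 < t) :
    ∫ x, ‖selfSimilarKernel α q t x‖ = ∫ x, ‖q x‖ :=
  integral_norm_dilate (Real.rpow_pos_of_pos ht _) q

theorem ae_restrict_Ioc_pos (T : ℝ) : ∀ᵐ t ∂(volume.restrict (Ioc 0 T)), 0 < t :=
  (ae_restrict_iff' measurableSet_Ioc).2 (Eventually.of_forall fun _ ht => ht.1)

theorem stronglyMeasurable_selfSimilarKernel (hqm : StronglyMeasurable q) :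
    StronglyMeasurable (Function.uncurry (selfSimilarKernel α q)) := by
  have hm : Measurable fun t : ℝ => t ^ (-(α / 2)) := by fun_prop
  unfold selfSimilarKernel dilate Function.uncurry
  exact (((hm.comp measurable_fst).pow_const _).stronglyMeasurable).smul
    (hqm.comp_measurable ((hm.comp measurable_fst).smul measurable_snd))

theorem integrable_prod_selfSimilarKernel (hqm : StronglyMeasurable q) (hqi : Integrable q)
    (T : ℝ) : Integrable (Function.uncurry (selfSimilarKernel α q))
      ((volume.restrict (Ioc 0 T)).prod volume) := by
  rw [integrable_prod_iff (stronglyMeasurable_selfSimilarKernel hqm).aestronglyMeasurable]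
  constructor
  · filter_upwards [ae_restrict_Ioc_pos T] with t ht using integrable_selfSimilarKernel hqi ht
  · refine (integrable_const (∫ x, ‖q x‖)).congr ?_
    filter_upwards [ae_restrict_Ioc_pos T] with t ht
    exact (integral_norm_selfSimilarKernel q ht).symm

theorem integrable_prod_selfSimilarKernel_convolution (hqm : StronglyMeasurable q)
    (hqi : Integrable q) {g : E → ℝ} (hgm : StronglyMeasurable g) (hg : Integrable g) (T : ℝ) :
    Integrable (Function.uncurry fun t =>
        selfSimilarKernel α q t ⋆[ContinuousLinearMap.mul ℝ ℝ, volume] g)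
      ((volume.restrict (Ioc 0 T)).prod volume) := by
  have hm : StronglyMeasurable (Function.uncurry fun t =>
      selfSimilarKernel α q t ⋆[ContinuousLinearMap.mul ℝ ℝ, volume] g) := by
    have h1 : StronglyMeasurable fun z : (ℝ × E) × E =>
        Function.uncurry (selfSimilarKernel α q) (z.1.1, z.2) * g (z.1.2 - z.2) := by
      refine ((stronglyMeasurable_selfSimilarKernel hqm).comp_measurable (by fun_prop)).mul
        (hgm.comp_measurable (by fun_prop))
    exact h1.integral_prod_right
  rw [integrable_prod_iff hm.aestronglyMeasurable]
  constructor
  · filter_upwards [ae_restrict_Ioc_pos T] with t ht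
    exact (integrable_selfSimilarKernel hqi ht).integrable_convolution _ hg
  · refine (integrable_const ((∫ x, ‖q x‖) * ∫ x, ‖g x‖)).mono'
      (hm.norm.integral_prod_right (ν := volume)).aestronglyMeasurable ?_
    filter_upwards [ae_restrict_Ioc_pos T] with t ht
    rw [Real.norm_of_nonneg (integral_nonneg fun x => norm_nonneg _)]
    refine (integral_norm_convolution_le (integrable_selfSimilarKernel hqi ht) hg).trans ?_
    rw [integral_norm_selfSimilarKernel q ht]

theorem integral_selfSimilarKernel_convolution_mul (hqi : Integrable q) {g : E → ℝ}
    (hg : Integrable g) {t : ℝ} (ht : 0 < t) (φ : 𝓢(E, ℝ)) :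
    ((∫ x, (selfSimilarKernel α q t ⋆[ContinuousLinearMap.mul ℝ ℝ, volume] g) x * φ x : ℝ) : ℂ) =
      ∫ ξ, 𝓕 (fun x => (q x : ℂ)) (t ^ (α / 2) • ξ) * (𝓕 (fun x => (g x : ℂ)) ξ *
        (𝓕⁻ (φ.postcompCLM Complex.ofRealCLM) : 𝓢(E, ℂ)) ξ) := by
  have hk : Integrable fun x => (selfSimilarKernel α q t x : ℂ) :=
    (integrable_selfSimilarKernel hqi ht).ofReal
  rw [← integral_complex_ofReal]
  simp only [Complex.ofReal_mul, ofReal_convolution]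
  have := integral_mul_schwartzMap (integrable_convolution hk hg.ofReal)
    (φ.postcompCLM Complex.ofRealCLM)
  simp only [SchwartzMap.postcompCLM_apply, Complex.ofRealCLM_apply] at this
  refine this.trans ?_
  congr 1
  ext ξ
  rw [fourier_convolution hk hg.ofReal, fourier_selfSimilarKernel ht, mul_assoc]
  rfl

/-- Parseval turns both sides into frequency integrals, and after Fubini the identity holds
frequency by frequency: it is the Volterra equation of the Mittag-Leffler function times the
transform of `g`. -/
theorem IsRayAngle.selfSimilarKernel_equation [Nontrivial E] (h : IsRayAngle α θ)
    (hqi : Integrable q)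
    (hq : ∀ ξ : E, ξ ≠ 0 → 𝓕 (fun x => (q x : ℂ)) ξ = mittagLeffler α θ 1 (laplaceSymbol ξ))
    {g : E → ℝ} (hg : Integrable g) {t : ℝ} (ht : 0 < t) (φ : 𝓢(E, ℝ)) :
    ∫ x, ((selfSimilarKernel α q t ⋆[ContinuousLinearMap.mul ℝ ℝ, volume] g) x - g x) * φ x =
      fracIntegral α (fun s => ∫ x,
        (selfSimilarKernel α q s ⋆[ContinuousLinearMap.mul ℝ ℝ, volume] g) x * (Δ φ) x) t := by
  have hα := h.one_lt
  set φc : 𝓢(E, ℂ) := φ.postcompCLM Complex.ofRealCLM with hφc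
  set Q : E → ℂ := 𝓕 (fun x => (q x : ℂ)) with hQ
  set gh : E → ℂ := 𝓕 (fun x => (g x : ℂ)) with hgh
  have hQc : Continuous Q := continuous_fourier hqi.ofReal
  have hgc : Continuous gh := continuous_fourier hg.ofReal
  have hQb : ∀ ξ, ‖Q ξ‖ ≤ ∫ x, ‖(q x : ℂ)‖ := norm_fourier_le _
  have hgi : ∀ ψ : 𝓢(E, ℂ), Integrable fun ξ => gh ξ * ψ ξ := fun ψ =>
    ψ.integrable.bdd_mul hgc.aestronglyMeasurable (Eventually.of_forall (norm_fourier_le _))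
  have hQi : ∀ (ψ : 𝓢(E, ℂ)) (s : ℝ), Integrable fun ξ => Q (s • ξ) * (gh ξ * ψ ξ) := fun ψ s =>
    (hgi ψ).bdd_mul (hQc.comp (continuous_const_smul s)).aestronglyMeasurable
      (Eventually.of_forall fun ξ => hQb _)
  have hlap : (Δ φ).postcompCLM Complex.ofRealCLM = Δ φc := by
    ext x
    rw [hφc, laplacian_postcompCLM, SchwartzMap.postcompCLM_apply]
  apply Complex.ofReal_injective
  have hL : ((∫ x, ((selfSimilarKernel α q t ⋆[ContinuousLinearMap.mul ℝ ℝ, volume] g) x - g x) *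
      φ x : ℝ) : ℂ) = ∫ ξ, (Q (t ^ (α / 2) • ξ) - 1) * (gh ξ * (𝓕⁻ φc : 𝓢(E, ℂ)) ξ) := by
    have h1 := integrable_mul_schwartzMap
      ((integrable_selfSimilarKernel (α := α) hqi ht).integrable_convolution
        (ContinuousLinearMap.mul ℝ ℝ) hg) φ
    have h2 := integrable_mul_schwartzMap hg φ
    have h3 : ((∫ x, g x * φ x : ℝ) : ℂ) = ∫ ξ, gh ξ * (𝓕⁻ φc : 𝓢(E, ℂ)) ξ := by
      refine Eq.trans ?_ (integral_mul_schwartzMap hg.ofReal φc)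
      rw [← integral_complex_ofReal]
      simp [hφc]
    simp only [sub_mul, one_mul]
    rw [integral_sub h1 h2, integral_sub (hQi _ _) (hgi _), Complex.ofReal_sub,
      integral_selfSimilarKernel_convolution_mul hqi hg ht, h3]
  have hR : ((fracIntegral α (fun s => ∫ x,
        (selfSimilarKernel α q s ⋆[ContinuousLinearMap.mul ℝ ℝ, volume] g) x * (Δ φ) x) t : ℝ) : ℂ) =
      ((Real.Gamma α)⁻¹ : ℝ) * ∫ s in Ioc 0 t, (∫ ξ, (((t - s) ^ (α - 1) : ℝ) : ℂ) *
        (Q (s ^ (α / 2) • ξ) * (gh ξ * (𝓕⁻ (Δ φc) : 𝓢(E, ℂ)) ξ))) := by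
    rw [fracIntegral, Complex.ofReal_mul, intervalIntegral.integral_of_le ht.le,
      ← integral_complex_ofReal]
    congr 1
    refine setIntegral_congr_fun measurableSet_Ioc fun s hs => ?_
    rw [Complex.ofReal_mul, integral_selfSimilarKernel_convolution_mul hqi hg hs.1, hlap,
      integral_const_mul]
  have hI : Integrable (fun z : ℝ × E => (((t - z.1) ^ (α - 1) : ℝ) : ℂ) *
      (Q (z.1 ^ (α / 2) • z.2) * (gh z.2 * (𝓕⁻ (Δ φc) : 𝓢(E, ℂ)) z.2)))
      ((volume.restrict (Ioc 0 t)).prod volume) := by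
    have c1 : Continuous fun s : ℝ => (((t - s) ^ (α - 1) : ℝ) : ℂ) :=
      Complex.continuous_ofReal.comp
        ((Real.continuous_rpow_const (by linarith)).comp (continuous_const.sub continuous_id))
    have i1 : Integrable (fun s : ℝ => (((t - s) ^ (α - 1) : ℝ) : ℂ)) (volume.restrict (Ioc 0 t)) :=
      (c1.integrableOn_Icc (a := 0) (b := t)).mono_set Ioc_subset_Icc_self
    have i2 := i1.mul_prod (hgi (𝓕⁻ (Δ φc)))
    have c2 : Continuous fun z : ℝ × E => Q (z.1 ^ (α / 2) • z.2) :=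
      hQc.comp (((Real.continuous_rpow_const (by linarith)).comp continuous_fst).smul
        continuous_snd)
    refine (i2.bdd_mul c2.aestronglyMeasurable (Eventually.of_forall fun z => hQb _)).congr
      (Eventually.of_forall fun z => ?_)
    simp only
    ring
  rw [hL, hR, integral_integral_swap (f := fun (s : ℝ) (ξ : E) => (((t - s) ^ (α - 1) : ℝ) : ℂ) *
        (Q (s ^ (α / 2) • ξ) * (gh ξ * (𝓕⁻ (Δ φc) : 𝓢(E, ℂ)) ξ))) hI, ← integral_const_mul]
  refine integral_congr_ae ?_
  -- The Volterra equation is available for `x > 0`; the origin is a null set because `E` is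
  -- nontrivial.
  have hne : ∀ᵐ ξ : E, ξ ≠ 0 := by
    simp [ae_iff]
  filter_upwards [hne] with ξ hξ
  have hX := laplaceSymbol_pos hξ
  have e1 : ∫ s in Ioc 0 t, (((t - s) ^ (α - 1) : ℝ) : ℂ) *
      (Q (s ^ (α / 2) • ξ) * (gh ξ * (𝓕⁻ (Δ φc) : 𝓢(E, ℂ)) ξ)) =
      ((∫ s in Ioc 0 t, (t - s) ^ (α - 1) * mittagLeffler α θ s (laplaceSymbol ξ) : ℝ) : ℂ) *
        (gh ξ * (𝓕⁻ (Δ φc) : 𝓢(E, ℂ)) ξ) := by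
    rw [← integral_complex_ofReal, ← integral_mul_const]
    refine setIntegral_congr_fun measurableSet_Ioc fun s hs => ?_
    rw [hQ, fourier_eq_mittagLeffler hq hs.1 hξ]
    push_cast
    ring
  have e2 := h.mittagLeffler_eq hX ht
  rw [fracIntegral, intervalIntegral.integral_of_le ht.le] at e2
  rw [e1, fourierInv_laplacian, hQ, fourier_eq_mittagLeffler hq ht hξ, e2]
  push_cast
  ring

/-- The fundamental solution together with the properties of its time primitive. -/
theorem IsRayAngle.exists_fundamentalSolution {d : ℕ} (hd : 0 < d) (h : IsRayAngle α θ) :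
    ∃ k : ℝ → EuclideanSpace ℝ (Fin d) → ℝ, IsFundamentalSolution α k ∧
      ∃ B : ℝ, ∀ t, 0 < t → Integrable (velocityKernel k t) ∧
        ∫ x, ‖velocityKernel k t x‖ ≤ B * t ∧ ∀ ξ ≠ 0,
          𝓕 (fun x => (velocityKernel k t x : ℂ)) ξ =
            ((∫ s in (0 : ℝ)..t, mittagLeffler α θ s (laplaceSymbol ξ) : ℝ) : ℂ) := by
  have : Nonempty (Fin d) := ⟨⟨0, hd⟩⟩
  obtain ⟨q, hqm, hqi, hq⟩ := h.exists_kernel (E := EuclideanSpace ℝ (Fin d))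
  refine ⟨selfSimilarKernel α q, ⟨fun T _ => ?_, fun u₀ hu hc => ⟨fun T _ => ?_, fun φ => ?_⟩⟩,
    ∫ x, ‖q x‖, fun t ht => ?_⟩
  · rw [IntegrableOn, Measure.volume_eq_prod, ← Measure.restrict_prod_eq_prod_univ]
    exact integrable_prod_selfSimilarKernel hqm hqi T
  · rw [IntegrableOn, Measure.volume_eq_prod, ← Measure.restrict_prod_eq_prod_univ]
    exact integrable_prod_selfSimilarKernel_convolution hqm hqi hu.continuous.stronglyMeasurable
      (hu.continuous.integrable_of_hasCompactSupport hc) T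
  · refine (ae_restrict_iff' measurableSet_Ioi).2 (Eventually.of_forall fun t ht => ?_)
    rw [← h.selfSimilarKernel_equation hqi hq (hu.continuous.integrable_of_hasCompactSupport hc) ht]
    simp
  -- The time primitive is a mixture of dilations of `q` with weight `1` on `(0, t]`, so its `L¹`
  -- bound and transform are those of `mixture`.
  · have hmix : ∀ x, (velocityKernel (selfSimilarKernel α q) t x : ℂ) =
        mixture (volume.restrict (Ioc 0 t)) 1 (fun s => s ^ (-(α / 2))) (fun y => (q y : ℂ)) x := by
      intro x
      rw [velocityKernel, intervalIntegral.integral_of_le ht.le, ← integral_complex_ofReal, mixture]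
      simp only [selfSimilarKernel, ofReal_dilate, Pi.one_apply, one_mul]
    have hm : Integrable (1 : ℝ → ℂ) (volume.restrict (Ioc 0 t)) := integrable_const 1
    have hδm : Measurable fun s : ℝ => s ^ (-(α / 2)) := by fun_prop
    have hδ : ∀ᵐ s ∂(volume.restrict (Ioc 0 t)), 0 < s ^ (-(α / 2)) := by
      filter_upwards [ae_restrict_Ioc_pos t] with s hs using Real.rpow_pos_of_pos hs _
    have hQm : StronglyMeasurable fun y => (q y : ℂ) :=
      Complex.continuous_ofReal.comp_stronglyMeasurable hqm
    have hQi : Integrable fun y => (q y : ℂ) := hqi.ofReal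
    refine ⟨?_, ?_, fun ξ hξ => ?_⟩
    · have := (integrable_mixture hm hδm hδ hQm hQi).re
      refine this.congr (Eventually.of_forall fun x => ?_)
      simp only [← hmix]
      simp
    · have := integral_norm_mixture_le hm hδm hδ hQm hQi
      simp only [← hmix] at this
      refine (le_of_eq ?_).trans (this.trans (le_of_eq ?_))
      · simp
      · simp [ht.le, mul_comm]
    · simp only [hmix]
      rw [fourier_mixture hm hδm hδ hQm hQi, intervalIntegral.integral_of_le ht.le,
        ← integral_complex_ofReal]
      refine setIntegral_congr_fun measurableSet_Ioc fun s hs => ?_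
      simp only [Pi.one_apply, one_mul]
      rw [← Real.rpow_neg hs.1.le, neg_neg, fourier_eq_mittagLeffler hq hs.1 hξ]

end Existence

end FracDiffusion

namespace FracDiffusion

/-! ### Vanishing of infinitely iterated fractional integrals. -/

section FractionalIntegral

open Filter

theorem integrableOn_sub_rpow_mul {a t : ℝ} {φ : ℝ → ℝ} (ha : 1 < a)
    (hφ : IntegrableOn φ (Ioc 0 t)) :
    IntegrableOn (fun s => (t - s) ^ (a - 1) * φ s) (Ioc 0 t) := by
  have hc : Continuous fun s : ℝ => (t - s) ^ (a - 1) :=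
    (Real.continuous_rpow_const (by linarith)).comp (continuous_const.sub continuous_id)
  exact IntegrableOn.continuousOn_mul_of_subset hc.continuousOn hφ isCompact_Icc
    measurableSet_Ioc Ioc_subset_Icc_self

theorem fracIntegral_congr {a t : ℝ} {φ ψ : ℝ → ℝ} (ht : 0 ≤ t)
    (h : ∀ᵐ s ∂(volume.restrict (Ioc 0 t)), φ s = ψ s) :
    fracIntegral a φ t = fracIntegral a ψ t := by
  rw [fracIntegral, fracIntegral, intervalIntegral.integral_of_le ht,
    intervalIntegral.integral_of_le ht]
  congr 1
  refine integral_congr_ae ?_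
  filter_upwards [h] with s hs
  rw [hs]

theorem fracIntegral_sub {a t : ℝ} {φ ψ : ℝ → ℝ} (ha : 1 < a) (ht : 0 ≤ t)
    (hφ : IntegrableOn φ (Ioc 0 t)) (hψ : IntegrableOn ψ (Ioc 0 t)) :
    fracIntegral a (fun s => φ s - ψ s) t = fracIntegral a φ t - fracIntegral a ψ t := by
  simp only [fracIntegral, intervalIntegral.integral_of_le ht, mul_sub]
  rw [integral_sub (integrableOn_sub_rpow_mul ha hφ) (integrableOn_sub_rpow_mul ha hψ), mul_sub]

theorem fracIntegral_nonneg {a t : ℝ} {φ : ℝ → ℝ} (ha : 0 < a) (ht : 0 ≤ t) (hφ : ∀ s, 0 ≤ φ s) :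
    0 ≤ fracIntegral a φ t := by
  have := Real.Gamma_pos_of_pos ha
  refine mul_nonneg (by positivity) (intervalIntegral.integral_nonneg ht fun s hs => ?_)
  exact mul_nonneg (Real.rpow_nonneg (by linarith [hs.2]) _) (hφ s)

theorem abs_fracIntegral_le {a t : ℝ} (φ : ℝ → ℝ) (ha : 0 < a) (ht : 0 ≤ t) :
    |fracIntegral a φ t| ≤ fracIntegral a (fun s => |φ s|) t := by
  have := Real.Gamma_pos_of_pos ha
  rw [fracIntegral, fracIntegral, abs_mul, abs_of_pos (inv_pos.2 this)]
  refine mul_le_mul_of_nonneg_left ?_ (by positivity)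
  rw [← Real.norm_eq_abs]
  refine (intervalIntegral.norm_integral_le_integral_norm ht).trans (le_of_eq ?_)
  refine intervalIntegral.integral_congr fun s hs => ?_
  rw [uIcc_of_le ht] at hs
  simp only [Real.norm_eq_abs, abs_mul]
  rw [abs_of_nonneg (Real.rpow_nonneg (by linarith [hs.2]) _)]

/-- A sequence of functions of at most geometric growth, each the fractional integral of the next
one, vanishes. -/
theorem ae_eq_zero_of_fracIntegral_succ {a T C R : ℝ} {A : ℕ → ℝ → ℝ} {g : ℝ → ℝ} (ha : 1 < a)
    (hR : 0 ≤ R) (hA : ∀ n, IntegrableOn (A n) (Ioc 0 T)) (hg : IntegrableOn g (Ioc 0 T))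
    (heq : ∀ n, ∀ᵐ t ∂(volume.restrict (Ioc 0 T)), A n t = fracIntegral a (A (n + 1)) t)
    (hb : ∀ n, ∀ᵐ t ∂(volume.restrict (Ioc 0 T)), |A n t| ≤ C * R ^ n * g t) :
    ∀ᵐ t ∂(volume.restrict (Ioc 0 T)), A 0 t = 0 := by
  have ha0 : 0 < a := by linarith
  -- In the weight `e^{-zt}` each fractional integration gains a factor `z^{-a}`. This `z` makes the
  -- gain at most half of the loss `R` per step.
  set z : ℝ := (2 * (R + 1)) ^ (1 / a) with hz
  have hzp : 0 < z := by positivity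
  have hza : (1 / z) ^ a = 1 / (2 * (R + 1)) := by
    rw [Real.div_rpow zero_le_one hzp.le, Real.one_rpow, hz, ← Real.rpow_mul (by positivity)]
    simp [ha0.ne']
  set c := (1 / z) ^ a with hc
  have hcp : 0 ≤ c := by rw [hza]; positivity
  have hcR : c * R ≤ 1 / 2 := by
    rw [hza, div_mul_eq_mul_div, div_le_div_iff₀ (by positivity) (by norm_num)]
    linarith
  have hcont : Continuous fun t : ℝ => Real.exp (-(z * t)) := by fun_prop
  have hmul : ∀ f : ℝ → ℝ, IntegrableOn f (Ioc 0 T) →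
      IntegrableOn (fun t => Real.exp (-(z * t)) * f t) (Ioc 0 T) := fun f hf =>
    IntegrableOn.continuousOn_mul_of_subset hcont.continuousOn hf isCompact_Icc
      measurableSet_Ioc Ioc_subset_Icc_self
  set J : ℕ → ℝ := fun n => ∫ t in Ioc 0 T, Real.exp (-(z * t)) * |A n t| with hJ
  have hstep : ∀ n, J n ≤ c * J (n + 1) := by
    intro n
    -- Cutting off after `T` leaves the fractional integral on `(0, T]` unchanged and makes the
    -- Laplace transform converge.
    set φ : ℝ → ℝ := (Ioc 0 T).indicator fun t => |A (n + 1) t| with hφ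
    have hφ0 : ∀ s, 0 ≤ φ s := fun s => indicator_nonneg (fun _ _ => abs_nonneg _) s
    have hind : (fun t => Real.exp (-(z * t)) * φ t) =
        (Ioc 0 T).indicator fun t => Real.exp (-(z * t)) * |A (n + 1) t| := by
      ext t
      rw [hφ, indicator_mul_right]
    have hφi : IntegrableOn (fun t => Real.exp (-(z * t)) * φ t) (Ioi 0) := by
      rw [hind]
      exact ((hmul _ (hA (n + 1)).abs).integrable_indicator measurableSet_Ioc).integrableOn
    have hlap := laplace_fracIntegral ha0 hzp hφi
    have hint := integrableOn_exp_mul_fracIntegral ha0 hzp hφi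
    have hval : ∫ t in Ioi (0 : ℝ), Real.exp (-(z * t)) * φ t = J (n + 1) := by
      rw [hind, setIntegral_indicator measurableSet_Ioc, inter_eq_right.2 Ioc_subset_Ioi_self]
    rw [hval] at hlap
    rw [hc, ← hlap]
    refine le_trans (setIntegral_mono_ae_restrict (hmul _ (hA n).abs)
      (hint.mono_set Ioc_subset_Ioi_self) ?_) (setIntegral_mono_set hint ?_ ?_)
    · filter_upwards [heq n, ae_restrict_mem measurableSet_Ioc] with t ht hm
      refine mul_le_mul_of_nonneg_left ?_ (Real.exp_pos _).le
      rw [ht]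
      refine (abs_fracIntegral_le _ ha0 hm.1.le).trans (le_of_eq ?_)
      refine fracIntegral_congr hm.1.le ?_
      filter_upwards [ae_restrict_mem measurableSet_Ioc] with s hs
      have : s ∈ Ioc 0 T := ⟨hs.1, hs.2.trans hm.2⟩
      rw [hφ, indicator_of_mem this]
    · filter_upwards [ae_restrict_mem measurableSet_Ioi] with t ht
      exact mul_nonneg (Real.exp_pos _).le (fracIntegral_nonneg ha0 (le_of_lt ht) hφ0)
    · exact Ioc_subset_Ioi_self.eventuallyLE
  have hiter : ∀ n, J 0 ≤ c ^ n * J n := by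
    intro n
    induction n with
    | zero => simp
    | succ n ih =>
      refine ih.trans ?_
      rw [pow_succ, mul_assoc]
      exact mul_le_mul_of_nonneg_left (hstep n) (by positivity)
  set D := ∫ t in Ioc 0 T, Real.exp (-(z * t)) * (C * g t) with hD
  have hbound : ∀ n, J 0 ≤ (c * R) ^ n * D := by
    intro n
    refine (hiter n).trans ?_
    rw [mul_pow, mul_assoc]
    refine mul_le_mul_of_nonneg_left ?_ (by positivity)
    rw [hD, ← integral_const_mul]
    refine setIntegral_mono_ae_restrict (hmul _ (hA n).abs)
      ((hmul _ (hg.const_mul C)).const_mul _) ?_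
    filter_upwards [hb n] with t ht
    calc _ ≤ Real.exp (-(z * t)) * (C * R ^ n * g t) :=
          mul_le_mul_of_nonneg_left ht (Real.exp_pos _).le
      _ = _ := by ring
  have hJ0 : J 0 ≤ 0 := by
    have hlim : Tendsto (fun n : ℕ => (c * R) ^ n * D) atTop (nhds (0 * D)) :=
      (tendsto_pow_atTop_nhds_zero_of_lt_one (by positivity) (by linarith)).mul_const D
    rw [zero_mul] at hlim
    exact ge_of_tendsto' hlim hbound
  have hJ0' : J 0 = 0 :=
    le_antisymm hJ0 (integral_nonneg fun t => mul_nonneg (Real.exp_pos _).le (abs_nonneg _))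
  have := (setIntegral_eq_zero_iff_of_nonneg_ae
    (Eventually.of_forall fun t => mul_nonneg (Real.exp_pos _).le (abs_nonneg _))
    (hmul _ (hA 0).abs)).1 hJ0'
  filter_upwards [this] with t ht
  simpa [(Real.exp_pos _).ne'] using ht

end FractionalIntegral

/-! ### Iterated Laplacians of band-limited functions. -/

section BandLimited

variable {E : Type*} [NormedAddCommGroup E] [InnerProductSpace ℝ E] [FiniteDimensional ℝ E]
  [MeasurableSpace E] [BorelSpace E]

theorem fourierInv_iterate_laplacian (φ : 𝓢(E, ℂ)) (n : ℕ) (ξ : E) :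
    (𝓕⁻ ((fun ψ : 𝓢(E, ℂ) => Δ ψ)^[n] φ) : 𝓢(E, ℂ)) ξ =
      (-(laplaceSymbol ξ : ℂ)) ^ n * (𝓕⁻ φ : 𝓢(E, ℂ)) ξ := by
  induction n with
  | zero => simp
  | succ n ih =>
    rw [Function.iterate_succ_apply', fourierInv_laplacian, ih, pow_succ]
    ring

/-- Bernstein's inequality for powers of the Laplacian. -/
theorem norm_iterate_laplacian_le {φ : 𝓢(E, ℂ)} {R : ℝ}
    (hR : ∀ ξ, (𝓕⁻ φ : 𝓢(E, ℂ)) ξ ≠ 0 → laplaceSymbol ξ ≤ R) (n : ℕ) (x : E) :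
    ‖((fun ψ : 𝓢(E, ℂ) => Δ ψ)^[n] φ) x‖ ≤ R ^ n * ∫ ξ, ‖(𝓕⁻ φ : 𝓢(E, ℂ)) ξ‖ := by
  set ψ := (fun ψ : 𝓢(E, ℂ) => Δ ψ)^[n] φ with hψ
  have h1 : ψ x = 𝓕 (⇑(𝓕⁻ ψ : 𝓢(E, ℂ))) x := by
    rw [← SchwartzMap.fourier_coe, FourierTransform.fourier_fourierInv_eq]
  rw [h1, ← integral_const_mul]
  refine (norm_fourier_le _ x).trans (integral_mono (𝓕⁻ ψ : 𝓢(E, ℂ)).integrable.norm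
    ((𝓕⁻ φ : 𝓢(E, ℂ)).integrable.norm.const_mul _) fun ξ => ?_)
  simp only [hψ, fourierInv_iterate_laplacian, norm_mul, norm_pow, norm_neg, Complex.norm_real,
    Real.norm_of_nonneg (laplaceSymbol_nonneg ξ)]
  by_cases h0 : (𝓕⁻ φ : 𝓢(E, ℂ)) ξ = 0
  · simp [h0]
  · gcongr
    · exact laplaceSymbol_nonneg ξ
    · exact hR ξ h0

end BandLimited

end FracDiffusion

namespace FracDiffusion

/-! ### Uniqueness of the time primitive. -/

section Uniqueness

open Filter

variable {E : Type*} [NormedAddCommGroup E] [InnerProductSpace ℝ E] [FiniteDimensional ℝ E]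
  [MeasurableSpace E] [BorelSpace E] {α T : ℝ} {w : ℝ → E → ℝ}

theorem integrable_prod_mul_schwartzMap {μ : Measure ℝ} [SFinite μ]
    (hw : Integrable (Function.uncurry w) (μ.prod volume)) (ψ : 𝓢(E, ℝ)) :
    Integrable (fun z : ℝ × E => w z.1 z.2 * ψ z.2) (μ.prod volume) := by
  obtain ⟨C, hC⟩ := ψ.decay 0 0
  refine hw.mul_bdd (c := C) (ψ.continuous.comp continuous_snd).aestronglyMeasurable
    (Eventually.of_forall fun z => ?_)
  simpa using hC.2 z.2

/-- Pairing with `Δⁿφ` gives a sequence in which each term is the fractional integral of the next,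
and Bernstein's inequality bounds its growth by `Rⁿ`. The functional `L` stands for the real or
imaginary part, as the equation is tested against real functions only. -/
theorem ae_integral_mul_bandLimited_eq_zero (hα : 1 < α)
    (hw : Integrable (Function.uncurry w) ((volume.restrict (Ioc 0 T)).prod volume))
    (heq : ∀ ψ : 𝓢(E, ℝ), ∀ᵐ t ∂(volume.restrict (Ioc 0 T)),
      ∫ x, w t x * ψ x = fracIntegral α (fun s => ∫ x, w s x * (Δ ψ) x) t)
    {φ : 𝓢(E, ℂ)} {R : ℝ} (hR0 : 0 ≤ R)
    (hR : ∀ ξ, (𝓕⁻ φ : 𝓢(E, ℂ)) ξ ≠ 0 → laplaceSymbol ξ ≤ R) (L : ℂ →L[ℝ] ℝ) :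
    ∀ᵐ t ∂(volume.restrict (Ioc 0 T)), ∫ x, w t x * L (φ x) = 0 := by
  set ψ : ℕ → 𝓢(E, ℝ) := fun n => ((fun χ : 𝓢(E, ℂ) => Δ χ)^[n] φ).postcompCLM L with hψ
  have hlap : ∀ n, Δ (ψ n) = ψ (n + 1) := by
    intro n
    ext x
    simp only [hψ]
    rw [laplacian_postcompCLM, SchwartzMap.postcompCLM_apply, Function.iterate_succ_apply']
  refine ae_eq_zero_of_fracIntegral_succ (a := α) (T := T) (R := R)
    (C := ‖L‖ * ∫ ξ, ‖(𝓕⁻ φ : 𝓢(E, ℂ)) ξ‖) (g := fun t => ∫ x, ‖w t x‖)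
    (A := fun n t => ∫ x, w t x * ψ n x) hα hR0 (fun n => ?_) hw.integral_norm_prod_left
    (fun n => ?_) (fun n => ?_)
  · exact (integrable_prod_mul_schwartzMap hw (ψ n)).integral_prod_left
  · filter_upwards [heq (ψ n)] with t ht
    rw [ht, hlap]
  · filter_upwards [hw.prod_right_ae] with t ht
    rw [← Real.norm_eq_abs, ← integral_const_mul]
    refine (norm_integral_le_integral_norm _).trans (integral_mono
      (integrable_mul_schwartzMap ht (ψ n)).norm (ht.norm.const_mul _) fun x => ?_)
    simp only [norm_mul, hψ, SchwartzMap.postcompCLM_apply]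
    rw [mul_comm]
    refine mul_le_mul_of_nonneg_right ?_ (norm_nonneg _)
    refine (L.le_opNorm _).trans ?_
    calc _ ≤ ‖L‖ * (R ^ n * ∫ ξ, ‖(𝓕⁻ φ : 𝓢(E, ℂ)) ξ‖) :=
          mul_le_mul_of_nonneg_left (norm_iterate_laplacian_le hR n x) (norm_nonneg _)
      _ = _ := by ring

theorem integral_setIntegral_mul_eq {μ : Measure ℝ} [SFinite μ]
    (hw : Integrable (Function.uncurry w) (μ.prod volume)) (ψ : 𝓢(E, ℝ)) :
    ∫ x, (∫ s, w s x ∂μ) * ψ x = ∫ s, (∫ x, w s x * ψ x) ∂μ := by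
  rw [integral_integral_swap (f := fun s x => w s x * ψ x) (integrable_prod_mul_schwartzMap hw ψ)]
  simp only [integral_mul_const]

/-- The exceptional set of times depends on the test function. Integrating in time first removes it,
and only the time primitive is needed later. -/
theorem ae_setIntegral_eq_zero (hα : 1 < α)
    (hw : Integrable (Function.uncurry w) ((volume.restrict (Ioc 0 T)).prod volume))
    (heq : ∀ ψ : 𝓢(E, ℝ), ∀ᵐ t ∂(volume.restrict (Ioc 0 T)),
      ∫ x, w t x * ψ x = fracIntegral α (fun s => ∫ x, w s x * (Δ ψ) x) t) :
    (fun x => ∫ s in Ioc 0 T, w s x) =ᵐ[volume] 0 := by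
  set W : E → ℝ := fun x => ∫ s in Ioc 0 T, w s x with hW
  have hWi : Integrable W := hw.integral_prod_right
  have hWc : Integrable fun x => (W x : ℂ) := hWi.ofReal
  -- By Parseval, testing `𝓕 W` against a compactly supported `G` is testing `W` against the
  -- band-limited function `𝓕 G`.
  have hF : 𝓕 (fun x => (W x : ℂ)) =ᵐ[volume] 0 := by
    refine ae_eq_zero_of_integral_contDiff_smul_eq_zero
      (continuous_fourier hWc).locallyIntegrable fun η hη hηc => ?_
    obtain ⟨G, hG⟩ := exists_schwartzMap_ofReal hη hηc
    obtain ⟨ρ, hρ⟩ := hηc.isBounded.exists_norm_le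
    have hsupp : ∀ ξ, (𝓕⁻ (𝓕 G : 𝓢(E, ℂ)) : 𝓢(E, ℂ)) ξ ≠ 0 →
        laplaceSymbol ξ ≤ (2 * Real.pi * ρ) ^ 2 := by
      intro ξ hξ
      rw [FourierTransform.fourierInv_fourier_eq, hG] at hξ
      have hm : ‖ξ‖ ≤ ρ := hρ ξ (subset_tsupport _ (by simpa using hξ))
      have := Real.pi_pos
      unfold laplaceSymbol
      gcongr
    have hL : ∀ L : ℂ →L[ℝ] ℝ, ∫ x, W x * L ((𝓕 G : 𝓢(E, ℂ)) x) = 0 := by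
      intro L
      have h1 := integral_setIntegral_mul_eq hw ((𝓕 G : 𝓢(E, ℂ)).postcompCLM L)
      simp only [SchwartzMap.postcompCLM_apply] at h1
      rw [h1]
      exact integral_eq_zero_of_ae
        (ae_integral_mul_bandLimited_eq_zero hα hw heq (sq_nonneg _) hsupp L)
    have hint := integrable_mul_schwartzMap hWc (𝓕 G)
    have hz : ∫ x, (W x : ℂ) * (𝓕 G : 𝓢(E, ℂ)) x = 0 := by
      have key : ∀ L : ℂ →L[ℝ] ℝ, L (∫ x, (W x : ℂ) * (𝓕 G : 𝓢(E, ℂ)) x) = 0 := by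
        intro L
        rw [← hL L, ← L.integral_comp_comm hint]
        congr 1
        ext x
        rw [← smul_eq_mul (W x), ← L.map_smul, Complex.real_smul]
      exact Complex.ext (key Complex.reCLM) (key Complex.imCLM)
    rw [integral_mul_schwartzMap hWc, FourierTransform.fourierInv_fourier_eq] at hz
    rw [← hz]
    congr 1
    ext ξ
    rw [hG, Complex.real_smul, mul_comm]
  filter_upwards [ae_eq_zero_of_fourier_eq_zero hWc hF] with x hx
  simpa using hx

theorem setIntegral_convolution {k : ℝ → E → ℝ} {μ : Measure ℝ} [SFinite μ]
    (hk : Integrable (Function.uncurry k) (μ.prod volume)) {g : E → ℝ} (hg : Continuous g)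
    (hgc : HasCompactSupport g) (x : E) :
    ∫ s, (k s ⋆[ContinuousLinearMap.mul ℝ ℝ, volume] g) x ∂μ =
      ((fun y => ∫ s, k s y ∂μ) ⋆[ContinuousLinearMap.mul ℝ ℝ, volume] g) x := by
  obtain ⟨C, hC⟩ := hg.bounded_above_of_compact_support hgc
  have hi : Integrable (fun z : ℝ × E => k z.1 z.2 * g (x - z.2)) (μ.prod volume) :=
    hk.mul_bdd (c := C) (hg.comp (continuous_const.sub continuous_snd)).aestronglyMeasurable
      (Eventually.of_forall fun z => hC _)
  simp only [convolution_def, ContinuousLinearMap.mul_apply']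
  rw [integral_integral_swap (f := fun s y => k s y * g (x - y)) hi]
  simp only [integral_mul_const]

theorem IsFundamentalSolution.integrable_prod {d : ℕ} {k : ℝ → EuclideanSpace ℝ (Fin d) → ℝ}
    (hk : IsFundamentalSolution α k) (hT : 0 < T) :
    Integrable (Function.uncurry k) ((volume.restrict (Ioc 0 T)).prod volume) := by
  have := hk.integrable T hT
  rwa [IntegrableOn, Measure.volume_eq_prod, ← Measure.restrict_prod_eq_prod_univ] at this

theorem IsDistribSolution.integrable_prod {d : ℕ} {u₀ v₀ : EuclideanSpace ℝ (Fin d) → ℝ}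
    {u : ℝ → EuclideanSpace ℝ (Fin d) → ℝ} (hu : IsDistribSolution α u₀ v₀ u) (hT : 0 < T) :
    Integrable (Function.uncurry u) ((volume.restrict (Ioc 0 T)).prod volume) := by
  have := hu.integrable T hT
  rwa [IntegrableOn, Measure.volume_eq_prod, ← Measure.restrict_prod_eq_prod_univ] at this

theorem IsDistribSolution.ae_setIntegral_eq {d : ℕ} (hα : 1 < α) (hT : 0 < T)
    {u₀ : EuclideanSpace ℝ (Fin d) → ℝ} (hu₀ : Integrable u₀)
    {u v : ℝ → EuclideanSpace ℝ (Fin d) → ℝ} (hu : IsDistribSolution α u₀ 0 u)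
    (hv : IsDistribSolution α u₀ 0 v) :
    (fun x => ∫ s in Ioc 0 T, u s x) =ᵐ[volume] fun x => ∫ s in Ioc 0 T, v s x := by
  have hui := hu.integrable_prod hT
  have hvi := hv.integrable_prod hT
  have hsub : Ioc 0 T ⊆ Ioi 0 := Ioc_subset_Ioi_self
  have hsplit : ∀ t, Integrable (u t) → Integrable (v t) →
      ∀ ψ : 𝓢(EuclideanSpace ℝ (Fin d), ℝ), ∫ x, (u t x - v t x) * ψ x =
        (∫ x, u t x * ψ x) - ∫ x, v t x * ψ x := by
    intro t h1 h2 ψ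
    simp only [sub_mul]
    exact integral_sub (integrable_mul_schwartzMap h1 ψ) (integrable_mul_schwartzMap h2 ψ)
  have h0 : (fun x => ∫ s in Ioc 0 T, (u s x - v s x)) =ᵐ[volume] 0 := by
    refine ae_setIntegral_eq_zero hα (hui.sub hvi) fun ψ => ?_
    filter_upwards [hui.prod_right_ae, hvi.prod_right_ae, ae_restrict_mem measurableSet_Ioc,
      ae_restrict_of_ae_restrict_of_subset hsub (hu.equation ψ),
      ae_restrict_of_ae_restrict_of_subset hsub (hv.equation ψ)] with t h1 h2 ht e1 e2
    have h1 : Integrable (u t) := h1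
    have h2 : Integrable (v t) := h2
    have hmono : ∀ {f : ℝ → ℝ}, IntegrableOn f (Ioc 0 T) → IntegrableOn f (Ioc 0 t) := fun hf =>
      hf.mono_set (Ioc_subset_Ioc_right ht.2)
    have e3 : fracIntegral α (fun s => ∫ x, (u s x - v s x) * (Δ ψ) x) t =
        fracIntegral α (fun s => (∫ x, u s x * (Δ ψ) x) - ∫ x, v s x * (Δ ψ) x) t := by
      refine fracIntegral_congr ht.1.le (ae_restrict_of_ae_restrict_of_subset
        (Ioc_subset_Ioc_right ht.2) ?_)
      filter_upwards [hui.prod_right_ae, hvi.prod_right_ae] with s h1 h2 using hsplit s h1 h2 _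
    rw [e3, fracIntegral_sub hα ht.1.le
      (hmono (integrable_prod_mul_schwartzMap hui (Δ ψ)).integral_prod_left)
      (hmono (integrable_prod_mul_schwartzMap hvi (Δ ψ)).integral_prod_left), ← e1, ← e2,
      hsplit t h1 h2]
    simp only [Pi.zero_apply, mul_zero, sub_zero, sub_mul]
    have i0 := integrable_mul_schwartzMap hu₀ ψ
    rw [integral_sub (integrable_mul_schwartzMap h1 ψ) i0,
      integral_sub (integrable_mul_schwartzMap h2 ψ) i0]
    ring
  filter_upwards [h0, hui.prod_left_ae, hvi.prod_left_ae] with x hx h1 h2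
  have hx : ∫ s in Ioc 0 T, (u s x - v s x) = 0 := hx
  have h1 : Integrable (fun s => u s x) (volume.restrict (Ioc 0 T)) := h1
  have h2 : Integrable (fun s => v s x) (volume.restrict (Ioc 0 T)) := h2
  rw [integral_sub h1 h2] at hx
  linarith

/-- The time primitives of two fundamental solutions act in the same way. -/
theorem IsFundamentalSolution.velocityKernel_convolution_ae_eq {d : ℕ} (hα : 1 < α)
    {k l : ℝ → EuclideanSpace ℝ (Fin d) → ℝ} (hk : IsFundamentalSolution α k)
    (hl : IsFundamentalSolution α l) {h : EuclideanSpace ℝ (Fin d) → ℝ} (hh : ContDiff ℝ ∞ h)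
    (hc : HasCompactSupport h) (hT : 0 < T) :
    (velocityKernel k T ⋆[ContinuousLinearMap.mul ℝ ℝ, volume] h) =ᵐ[volume]
      (velocityKernel l T ⋆[ContinuousLinearMap.mul ℝ ℝ, volume] h) := by
  have key := (hk.solves h hh hc).ae_setIntegral_eq hα hT
    (hh.continuous.integrable_of_hasCompactSupport hc) (hl.solves h hh hc)
  have hv : ∀ {m : ℝ → EuclideanSpace ℝ (Fin d) → ℝ},
      velocityKernel m T = fun y => ∫ s in Ioc 0 T, m s y := by
    intro m
    ext y
    rw [velocityKernel, intervalIntegral.integral_of_le hT.le]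
  filter_upwards [key] with x hx
  rw [setIntegral_convolution (hk.integrable_prod hT) hh.continuous hc,
    setIntegral_convolution (hl.integrable_prod hT) hh.continuous hc] at hx
  rw [hv, hv, hx]

end Uniqueness

end FracDiffusion

namespace FracDiffusion

/-! ### Schwartz multipliers and convolutions with integrable kernels. -/

section Multiplier

open Filter

/-- A Schwartz function whose Fourier transform inverts `-Δ` on the unit dyadic annulus. -/
theorem exists_annulus_inverse {E : Type*} [NormedAddCommGroup E] [InnerProductSpace ℝ E]
    [FiniteDimensional ℝ E] :
    ∃ G : 𝓢(E, ℂ), ∀ ξ : E, 1 / 2 ≤ 2 * Real.pi * ‖ξ‖ → 2 * Real.pi * ‖ξ‖ ≤ 2 →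
      (laplaceSymbol ξ : ℂ) * G ξ = 1 := by
  have hpi := Real.pi_pos
  -- The plateau is `[1/4, 4]`, the range of `|2πξ|²` on the annulus; the support `[1/8, 33/8]`
  -- avoids the singularity of `x⁻¹`.
  let β : ContDiffBump (17 / 8 : ℝ) := ⟨15 / 8, 2, by norm_num, by norm_num⟩
  set g : ℝ → ℝ := fun x => β x * x⁻¹ with hg
  have hβ0 : ∀ x : ℝ, x ≤ 1 / 8 → β x = 0 := fun x hx => β.zero_of_le_dist (by
    rw [Real.dist_eq, abs_of_nonpos (by linarith)]
    show (2 : ℝ) ≤ _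
    linarith)
  have hβ1 : ∀ x : ℝ, 5 ≤ x → β x = 0 := fun x hx => β.zero_of_le_dist (by
    rw [Real.dist_eq, abs_of_nonneg (by linarith)]
    show (2 : ℝ) ≤ _
    linarith)
  have hgs : ContDiff ℝ ∞ g := by
    refine contDiff_iff_contDiffAt.2 fun x => ?_
    by_cases hx : x = 0
    · refine (contDiffAt_const (c := (0 : ℝ))).congr_of_eventuallyEq ?_
      have : Iio (1 / 8 : ℝ) ∈ nhds x := by
        rw [hx]
        exact Iio_mem_nhds (by norm_num)
      filter_upwards [this] with y hy
      rw [hg]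
      simp only
      rw [hβ0 y (le_of_lt hy), zero_mul]
    · exact β.contDiff.contDiffAt.mul (contDiffAt_inv ℝ hx)
  have hXs : ContDiff ℝ ∞ (laplaceSymbol : E → ℝ) := by
    have : (laplaceSymbol : E → ℝ) = fun ξ => (2 * Real.pi) ^ 2 * ‖ξ‖ ^ 2 := by
      ext ξ
      rw [laplaceSymbol, mul_pow]
    rw [this]
    exact contDiff_const.mul (contDiff_norm_sq ℝ)
  have hc : HasCompactSupport (g ∘ (laplaceSymbol : E → ℝ)) := by
    refine HasCompactSupport.intro (isCompact_closedBall (0 : E) 1) fun ξ hξ => ?_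
    have h1 : 1 < ‖ξ‖ := by simpa using hξ
    have h2 : 5 ≤ laplaceSymbol ξ := by
      have h3 : 3 ≤ 2 * Real.pi * ‖ξ‖ := by nlinarith [Real.pi_gt_three]
      rw [laplaceSymbol]
      nlinarith
    rw [Function.comp_apply, hg]
    simp only
    rw [hβ1 _ h2, zero_mul]
  obtain ⟨G, hG⟩ := exists_schwartzMap_ofReal (hgs.comp hXs) hc
  refine ⟨G, fun ξ h1 h2 => ?_⟩
  have hX1 : 1 / 4 ≤ laplaceSymbol ξ := by
    rw [laplaceSymbol]
    nlinarith
  have hX2 : laplaceSymbol ξ ≤ 4 := by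
    rw [laplaceSymbol]
    nlinarith
  have hβ : β (laplaceSymbol ξ) = 1 := β.one_of_mem_closedBall (by
    rw [Metric.mem_closedBall, Real.dist_eq, abs_le]
    show -(15 / 8 : ℝ) ≤ _ ∧ _ ≤ (15 / 8 : ℝ)
    constructor <;> linarith)
  rw [hG, Function.comp_apply, hg]
  simp only
  rw [hβ, one_mul, ← Complex.ofReal_mul, mul_inv_cancel₀ (by linarith), Complex.ofReal_one]

variable {E : Type*} [NormedAddCommGroup E] [InnerProductSpace ℝ E] [FiniteDimensional ℝ E]
  [MeasurableSpace E] [BorelSpace E]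

/-- The product of a Schwartz symbol with the Fourier transform of a Schwartz function. -/
def multiplier (m f : 𝓢(E, ℂ)) : 𝓢(E, ℂ) :=
  𝓕⁻ (SchwartzMap.pairing (ContinuousLinearMap.mul ℝ ℂ) m (𝓕 f))

theorem fourier_multiplier (m f : 𝓢(E, ℂ)) (ξ : E) :
    𝓕 (⇑(multiplier m f)) ξ = m ξ * 𝓕 (⇑f) ξ := by
  rw [multiplier, ← SchwartzMap.fourier_coe, FourierTransform.fourier_fourierInv_eq,
    ← SchwartzMap.fourier_coe]
  simp

theorem convolution_ae_eq_multiplier {F : E → ℂ} (hF : Integrable F) {m : 𝓢(E, ℂ)}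
    (hm : ∀ ξ, 𝓕 F ξ = m ξ) (f : 𝓢(E, ℂ)) :
    (F ⋆[ContinuousLinearMap.mul ℝ ℂ, volume] ⇑f) =ᵐ[volume] ⇑(multiplier m f) := by
  refine ae_eq_of_fourier_eq (integrable_convolution hF f.integrable) (multiplier m f).integrable
    (Eventually.of_forall fun ξ => ?_)
  rw [fourier_convolution hF f.integrable, fourier_multiplier, hm]

theorem norm_schwartzMap_le (f : 𝓢(E, ℂ)) (x : E) : ‖f x‖ ≤ ∫ ξ, ‖𝓕 (⇑f) ξ‖ := by
  have h1 : f x = 𝓕⁻ (⇑(𝓕 f : 𝓢(E, ℂ))) x := by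
    rw [← SchwartzMap.fourierInv_coe, FourierTransform.fourierInv_fourier_eq]
  rw [h1, Real.fourierInv_eq_fourier_neg, ← SchwartzMap.fourier_coe]
  exact norm_fourier_le _ _

/-- Convergence in the Fourier algebra thus implies uniform convergence after convolution with an
integrable kernel. -/
theorem norm_convolution_schwartzMap_le {F : E → ℂ} (hF : Integrable F) (f : 𝓢(E, ℂ)) (x : E) :
    ‖(F ⋆[ContinuousLinearMap.mul ℝ ℂ, volume] ⇑f) x‖ ≤ (∫ y, ‖F y‖) * ∫ ξ, ‖𝓕 (⇑f) ξ‖ := by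
  rw [convolution_def, ← integral_mul_const]
  refine norm_integral_le_of_norm_le (hF.norm.mul_const _) (Eventually.of_forall fun y => ?_)
  rw [ContinuousLinearMap.mul_apply', norm_mul]
  exact mul_le_mul_of_nonneg_left (norm_schwartzMap_le f _) (norm_nonneg _)

theorem convolution_sub_right {F : E → ℂ} (hF : Integrable F) (f g : 𝓢(E, ℂ)) (x : E) :
    (F ⋆[ContinuousLinearMap.mul ℝ ℂ, volume] ⇑(f - g)) x =
      (F ⋆[ContinuousLinearMap.mul ℝ ℂ, volume] ⇑f) x -
        (F ⋆[ContinuousLinearMap.mul ℝ ℂ, volume] ⇑g) x := by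
  have hi : ∀ f : 𝓢(E, ℂ), Integrable fun y => F y * f (x - y) := fun f =>
    hF.mul_bdd (f.continuous.comp (continuous_const.sub continuous_id)).aestronglyMeasurable
      (Eventually.of_forall fun y => norm_schwartzMap_le f _)
  simp only [convolution_def, ContinuousLinearMap.mul_apply', _root_.sub_apply, mul_sub]
  exact integral_sub (hi f) (hi g)

theorem convolution_sum_right {ι : Type*} {F : E → ℂ} (hF : Integrable F) (s : Finset ι)
    (f : ι → 𝓢(E, ℂ)) (x : E) :
    (F ⋆[ContinuousLinearMap.mul ℝ ℂ, volume] ⇑(∑ i ∈ s, f i)) x =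
      ∑ i ∈ s, (F ⋆[ContinuousLinearMap.mul ℝ ℂ, volume] ⇑(f i)) x := by
  have hi : ∀ f : 𝓢(E, ℂ), Integrable fun y => F y * f (x - y) := fun f =>
    hF.mul_bdd (f.continuous.comp (continuous_const.sub continuous_id)).aestronglyMeasurable
      (Eventually.of_forall fun y => norm_schwartzMap_le f _)
  simp only [convolution_def, ContinuousLinearMap.mul_apply', _root_.sum_apply, Finset.mul_sum]
  exact integral_finsetSum s fun i _ => hi (f i)

theorem eLpNorm_one_eq_ofReal {F : E → ℂ} (hF : Integrable F) :
    eLpNorm F 1 volume = ENNReal.ofReal (∫ x, ‖F x‖) := by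
  rw [eLpNorm_one_eq_lintegral_enorm, ofReal_integral_norm_eq_lintegral_enorm hF]

theorem eLpNorm_convolution_schwartzMap_le {p : ℝ} (hp : 1 < p) {F : E → ℂ} (hF : Integrable F)
    (f : 𝓢(E, ℂ)) :
    eLpNorm (F ⋆[ContinuousLinearMap.mul ℝ ℂ, volume] ⇑f) (ENNReal.ofReal p) volume ≤
      ENNReal.ofReal (∫ x, ‖F x‖) * eLpNorm f (ENNReal.ofReal p) volume := by
  rw [← eLpNorm_one_eq_ofReal hF]
  exact eLpNorm_convolution_le hp hF.aestronglyMeasurable f.continuous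

end Multiplier

end FracDiffusion

namespace FracDiffusion

/-! ### The dyadic partition of unity. -/

section LittlewoodPaley

open Filter

variable {d : ℕ} {Ψ : 𝓢(EuclideanSpace ℝ (Fin d), ℂ)}

theorem contDiff_angularFourier (Ψ : 𝓢(EuclideanSpace ℝ (Fin d), ℂ)) :
    ContDiff ℝ ∞ (angularFourier Ψ) := by
  have : angularFourier Ψ = ⇑(𝓕 Ψ : 𝓢(EuclideanSpace ℝ (Fin d), ℂ)) ∘
      fun ξ => (2 * Real.pi)⁻¹ • ξ := by
    ext ξ
    rw [angularFourier, Function.comp_apply, SchwartzMap.fourier_coe]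
  rw [this]
  exact ((𝓕 Ψ : 𝓢(EuclideanSpace ℝ (Fin d), ℂ)).smooth ⊤).comp (contDiff_const_smul _)

theorem norm_dyadic_smul (j : ℕ) (ξ : EuclideanSpace ℝ (Fin d)) :
    ‖(2 : ℝ) ^ (-((j : ℤ) + 1)) • ξ‖ = ‖ξ‖ / 2 ^ (j + 1) := by
  rw [norm_smul, norm_zpow, Real.norm_two, zpow_neg, div_eq_inv_mul]
  norm_cast

theorem dyadicSymbol_succ (j : ℕ) (ξ : EuclideanSpace ℝ (Fin d)) :
    dyadicSymbol Ψ (j + 1) ξ = angularFourier Ψ ((2 : ℝ) ^ (-((j : ℤ) + 1)) • ξ) := rfl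

namespace IsLittlewoodPaley

theorem annulus_of_dyadicSymbol_ne_zero (hΨ : IsLittlewoodPaley Ψ) {j : ℕ}
    {ξ : EuclideanSpace ℝ (Fin d)} (h : dyadicSymbol Ψ (j + 1) ξ ≠ 0) :
    1 / 2 ≤ ‖ξ‖ / 2 ^ (j + 1) ∧ ‖ξ‖ / 2 ^ (j + 1) ≤ 2 := by
  rw [← norm_dyadic_smul]
  exact hΨ.support _ h

theorem dyadicSymbol_succ_eq_zero (hΨ : IsLittlewoodPaley Ψ) {n j : ℕ}
    {ξ : EuclideanSpace ℝ (Fin d)} (hξ : ‖ξ‖ < 2 ^ n) (hj : n ≤ j) :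
    dyadicSymbol Ψ (j + 1) ξ = 0 := by
  by_contra h
  have h1 := (hΨ.annulus_of_dyadicSymbol_ne_zero h).1
  have h2 : (2 : ℝ) ^ n ≤ 2 ^ j := pow_le_pow_right₀ one_le_two hj
  rw [le_div_iff₀ (by positivity), pow_succ] at h1
  linarith

theorem dyadicSymbol_zero_eq (hΨ : IsLittlewoodPaley Ψ) {n : ℕ}
    {ξ : EuclideanSpace ℝ (Fin d)} (hξ : ‖ξ‖ < 2 ^ n) :
    dyadicSymbol Ψ 0 ξ = 1 - ∑ j ∈ Finset.range n, dyadicSymbol Ψ (j + 1) ξ := by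
  have : dyadicSymbol Ψ 0 ξ = 1 - ∑' j : ℕ, dyadicSymbol Ψ (j + 1) ξ := rfl
  rw [this, tsum_eq_sum (s := Finset.range n) fun j hj =>
    hΨ.dyadicSymbol_succ_eq_zero hξ (by simpa using hj)]

/-- Telescoping: adding the first `n` annular symbols to `1 - ∑_{j≥1} Ψ̂_j` leaves `1 - ∑_{j>n}
Ψ̂_j`, which is the low-frequency symbol rescaled by `2^{-n}`. Near a given `ξ` all sums are finite.
-/
theorem sum_dyadicSymbol (hΨ : IsLittlewoodPaley Ψ) (n : ℕ) (ξ : EuclideanSpace ℝ (Fin d)) :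
    ∑ j ∈ Finset.range (n + 1), dyadicSymbol Ψ j ξ =
      dyadicSymbol Ψ 0 (((2 : ℝ) ^ n)⁻¹ • ξ) := by
  obtain ⟨N, hN⟩ := pow_unbounded_of_one_lt ‖ξ‖ one_lt_two
  have h2n : (1 : ℝ) ≤ 2 ^ n := one_le_pow₀ one_le_two
  have h1 : ‖ξ‖ < 2 ^ (n + N) := hN.trans_le (pow_le_pow_right₀ one_le_two (by omega))
  have h2 : ‖((2 : ℝ) ^ n)⁻¹ • ξ‖ < 2 ^ N := by
    rw [norm_smul, norm_inv, norm_pow, Real.norm_two]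
    refine lt_of_le_of_lt ?_ hN
    exact mul_le_of_le_one_left (norm_nonneg _) (inv_le_one_of_one_le₀ h2n)
  rw [Finset.sum_range_succ', hΨ.dyadicSymbol_zero_eq h1, hΨ.dyadicSymbol_zero_eq h2,
    Finset.sum_range_add]
  have h3 : ∀ i : ℕ, dyadicSymbol Ψ (n + i + 1) ξ =
      dyadicSymbol Ψ (i + 1) (((2 : ℝ) ^ n)⁻¹ • ξ) := by
    intro i
    rw [dyadicSymbol_succ, dyadicSymbol_succ, smul_smul]
    congr 2
    rw [← zpow_natCast, ← zpow_neg, ← zpow_add₀ two_ne_zero]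
    congr 1
    push_cast
    ring
  simp only [h3]
  ring

theorem contDiff_dyadicSymbol (hΨ : IsLittlewoodPaley Ψ) (j : ℕ) :
    ContDiff ℝ ∞ (dyadicSymbol Ψ j) := by
  have hsucc : ∀ j, ContDiff ℝ ∞ (dyadicSymbol Ψ (j + 1)) := fun j =>
    (contDiff_angularFourier Ψ).comp (contDiff_const_smul _)
  cases j with
  | succ j => exact hsucc j
  | zero =>
    refine contDiff_iff_contDiffAt.2 fun ξ => ?_
    obtain ⟨n, hn⟩ := pow_unbounded_of_one_lt ‖ξ‖ one_lt_two
    have hc : ContDiff ℝ ∞ fun ξ => 1 - ∑ j ∈ Finset.range n, dyadicSymbol Ψ (j + 1) ξ :=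
      contDiff_const.sub (ContDiff.sum fun j _ => hsucc j)
    refine hc.contDiffAt.congr_of_eventuallyEq ?_
    filter_upwards [continuous_norm.continuousAt.eventually (Iio_mem_nhds hn)] with η hη
    exact hΨ.dyadicSymbol_zero_eq hη

/-- For `|ξ| > 2` the terms with `j ≤ 0` of the full partition vanish, so those with `j ≥ 1` already
sum to `1`. -/
theorem dyadicSymbol_zero_eq_zero (hΨ : IsLittlewoodPaley Ψ) {ξ : EuclideanSpace ℝ (Fin d)}
    (hξ : 2 < ‖ξ‖) : dyadicSymbol Ψ 0 ξ = 0 := by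
  have h0 : ξ ≠ 0 := norm_pos_iff.1 (by linarith)
  have hinj : Function.Injective fun j : ℕ => (j : ℤ) + 1 := fun a b h => by simpa using h
  have hsum := (hinj.hasSum_iff (f := fun j : ℤ => angularFourier Ψ ((2 : ℝ) ^ (-j) • ξ))
    (a := 1) fun j hj => ?_).2 (hΨ.sum_eq_one ξ h0)
  · have : dyadicSymbol Ψ 0 ξ = 1 - ∑' j : ℕ,
      ((fun j : ℤ => angularFourier Ψ ((2 : ℝ) ^ (-j) • ξ)) ∘ fun j : ℕ => (j : ℤ) + 1) j := rfl
    rw [this, hsum.tsum_eq, sub_self]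
  · by_contra h
    have h1 := (hΨ.support _ h).2
    have hj0 : j ≤ 0 := by
      by_contra hj1
      exact hj ⟨(j - 1).toNat, by
        simp only
        omega⟩
    have h2 : (1 : ℝ) ≤ 2 ^ (-j) := one_le_zpow₀ one_le_two (by omega)
    rw [norm_smul, norm_zpow, Real.norm_two] at h1
    nlinarith

theorem hasCompactSupport_dyadicSymbol (hΨ : IsLittlewoodPaley Ψ) (j : ℕ) :
    HasCompactSupport (dyadicSymbol Ψ j) := by
  refine HasCompactSupport.intro
    (isCompact_closedBall (0 : EuclideanSpace ℝ (Fin d)) (2 * 2 ^ j)) fun ξ hξ => ?_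
  have h1 : 2 * 2 ^ j < ‖ξ‖ := by simpa using hξ
  cases j with
  | zero => exact hΨ.dyadicSymbol_zero_eq_zero (by simpa using h1)
  | succ j =>
    by_contra h
    have h2 := (hΨ.annulus_of_dyadicSymbol_ne_zero h).2
    rw [div_le_iff₀ (by positivity)] at h2
    linarith

theorem exists_symbol (hΨ : IsLittlewoodPaley Ψ) (j : ℕ) :
    ∃ B : 𝓢(EuclideanSpace ℝ (Fin d), ℂ), ∀ ξ, B ξ = dyadicSymbol Ψ j ((2 * Real.pi) • ξ) := by
  have hpi : (2 * Real.pi) ≠ 0 := by positivity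
  obtain ⟨B, hB⟩ := exists_schwartzMap
    ((hΨ.contDiff_dyadicSymbol j).comp (contDiff_const_smul (2 * Real.pi)))
    ((hΨ.hasCompactSupport_dyadicSymbol j).comp_homeomorph (Homeomorph.smulOfNeZero _ hpi))
  exact ⟨B, fun ξ => by rw [hB]; rfl⟩

theorem dyadicSymbol_zero_zero (hΨ : IsLittlewoodPaley Ψ) :
    dyadicSymbol Ψ 0 (0 : EuclideanSpace ℝ (Fin d)) = 1 := by
  rw [hΨ.dyadicSymbol_zero_eq (n := 0) (by simp)]
  simp

/-- Identifies the block with a Schwartz function; the factor `2π` converts angular frequency to the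
convention of `𝓕`. -/
theorem dyadicBlock_ae_eq {j : ℕ} {B : 𝓢(EuclideanSpace ℝ (Fin d), ℂ)}
    (hB : ∀ ξ, B ξ = dyadicSymbol Ψ j ((2 * Real.pi) • ξ)) {h : EuclideanSpace ℝ (Fin d) → ℝ}
    {H : 𝓢(EuclideanSpace ℝ (Fin d), ℂ)} (hH : ∀ x, H x = h x) :
    dyadicBlock Ψ j h =ᵐ[volume] ⇑(multiplier B H) := by
  have h1 : angularFourierInv (dyadicSymbol Ψ j) =
      ⇑(𝓕⁻ B : 𝓢(EuclideanSpace ℝ (Fin d), ℂ)) := by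
    rw [SchwartzMap.fourierInv_coe]
    ext x
    rw [angularFourierInv]
    simp only [← hB]
  have h2 : (fun x => (h x : ℂ)) = ⇑H := by
    ext x
    rw [hH]
  rw [dyadicBlock, h1, h2]
  refine convolution_ae_eq_multiplier (𝓕⁻ B : 𝓢(EuclideanSpace ℝ (Fin d), ℂ)).integrable
    (fun ξ => ?_) H
  rw [← SchwartzMap.fourier_coe, FourierTransform.fourier_fourierInv_eq]

/-- The partial sums of the Littlewood–Paley decomposition converge, in the Fourier algebra. -/
theorem tendsto_integral_norm_fourier_sub (hΨ : IsLittlewoodPaley Ψ)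
    {B : ℕ → 𝓢(EuclideanSpace ℝ (Fin d), ℂ)}
    (hB : ∀ j ξ, B j ξ = dyadicSymbol Ψ j ((2 * Real.pi) • ξ))
    (H : 𝓢(EuclideanSpace ℝ (Fin d), ℂ)) :
    Tendsto (fun n : ℕ => ∫ ξ, ‖𝓕 (⇑(H - ∑ j ∈ Finset.range (n + 1), multiplier (B j) H)) ξ‖)
      atTop (nhds 0) := by
  have hF : ∀ (n : ℕ) ξ, 𝓕 (⇑(H - ∑ j ∈ Finset.range (n + 1), multiplier (B j) H)) ξ =
      (1 - B 0 (((2 : ℝ) ^ n)⁻¹ • ξ)) * 𝓕 (⇑H) ξ := by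
    intro n ξ
    rw [← SchwartzMap.fourier_coe, sub_eq_add_neg, FourierTransform.fourier_add,
      FourierTransform.fourier_neg, FourierTransform.fourier_sum]
    simp only [_root_.add_apply, _root_.neg_apply, _root_.sum_apply, SchwartzMap.fourier_coe,
      fourier_multiplier]
    rw [← Finset.sum_mul, hB, smul_comm, ← hΨ.sum_dyadicSymbol]
    simp only [hB]
    ring
  have h0 : B 0 0 = 1 := by
    rw [hB, smul_zero, hΨ.dyadicSymbol_zero_zero]
  have hHi : Integrable (𝓕 (⇑H)) := by
    rw [← SchwartzMap.fourier_coe]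
    exact (𝓕 H : 𝓢(EuclideanSpace ℝ (Fin d), ℂ)).integrable
  obtain ⟨C, hC⟩ := (B 0).decay 0 0
  have hC : ∀ ξ, ‖B 0 ξ‖ ≤ C := fun ξ => by simpa using hC.2 ξ
  simp only [hF]
  have := tendsto_integral_of_dominated_convergence
    (F := fun (n : ℕ) ξ => ‖(1 - B 0 (((2 : ℝ) ^ n)⁻¹ • ξ)) * 𝓕 (⇑H) ξ‖) (f := fun _ => (0 : ℝ))
    (μ := volume) (fun ξ => (1 + C) * ‖𝓕 (⇑H) ξ‖) (fun n => ?_) (hHi.norm.const_mul _)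
    (fun n => ?_) ?_
  · simpa using this
  · exact ((aestronglyMeasurable_const.sub ((B 0).continuous.comp
      (continuous_const_smul _)).aestronglyMeasurable).mul hHi.aestronglyMeasurable).norm
  · refine Eventually.of_forall fun ξ => ?_
    rw [norm_norm, norm_mul]
    gcongr
    refine (norm_sub_le _ _).trans ?_
    rw [norm_one]
    gcongr
    exact hC _
  · refine Eventually.of_forall fun ξ => ?_
    have h1 : Tendsto (fun n : ℕ => ((2 : ℝ) ^ n)⁻¹ • ξ) atTop (nhds ((0 : ℝ) • ξ)) :=
      (tendsto_inv_atTop_zero.comp (tendsto_pow_atTop_atTop_of_one_lt one_lt_two)).smul_const ξ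
    rw [zero_smul] at h1
    have h2 := ((B 0).continuous.tendsto 0).comp h1
    rw [h0] at h2
    have h3 := ((tendsto_const_nhds (x := (1 : ℂ))).sub h2).mul_const (𝓕 (⇑H) ξ)
    have h4 := h3.norm
    simpa using h4

end IsLittlewoodPaley

end LittlewoodPaley

end FracDiffusion

namespace FracDiffusion

/-! ### The time primitive on a single dyadic block. -/

section BlockBounds

open Filter

variable {E : Type*} [NormedAddCommGroup E] [InnerProductSpace ℝ E] [FiniteDimensional ℝ E]
  [MeasurableSpace E] [BorelSpace E]

theorem exists_schwartzMap_comp_smul {E : Type*} [NormedAddCommGroup E] [NormedSpace ℝ E]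
    {c : ℝ} (hc : c ≠ 0) (G : 𝓢(E, ℂ)) : ∃ K : 𝓢(E, ℂ), ∀ x, K x = G (c • x) :=
  ⟨SchwartzMap.compCLMOfContinuousLinearEquiv ℝ
    (ContinuousLinearEquiv.smulLeft (R₁ := ℝ) (Units.mk0 c hc)) G, fun _ => rfl⟩

/-- A kernel with symbol `(c + Ŝ) / |2πξ|²` acts on functions with frequencies in the `j`-th
dyadic annulus with norm `O((|c| + ‖S‖₁) 4^{-j})`. -/
theorem eLpNorm_convolution_annulus_le [Nontrivial E] {p : ℝ} (hp : 1 < p) {P S : E → ℂ} {c : ℂ}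
    (hP : Integrable P) (hS : Integrable S)
    (hPS : ∀ ξ ≠ 0, (laplaceSymbol ξ : ℂ) * 𝓕 P ξ = c + 𝓕 S ξ) {G : 𝓢(E, ℂ)}
    (hG : ∀ ξ : E, 1 / 2 ≤ 2 * Real.pi * ‖ξ‖ → 2 * Real.pi * ‖ξ‖ ≤ 2 →
      (laplaceSymbol ξ : ℂ) * G ξ = 1) {j : ℕ} {f : 𝓢(E, ℂ)}
    (hf : ∀ ξ, 𝓕 (⇑f) ξ ≠ 0 → 1 / 2 ≤ 2 * Real.pi * ‖ξ‖ / 2 ^ j ∧ 2 * Real.pi * ‖ξ‖ / 2 ^ j ≤ 2) :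
    eLpNorm (P ⋆[ContinuousLinearMap.mul ℝ ℂ, volume] ⇑f) (ENNReal.ofReal p) volume ≤
      ENNReal.ofReal ((‖c‖ + ∫ x, ‖S x‖) *
        ((4 ^ j)⁻¹ * ∫ x, ‖(𝓕⁻ G : 𝓢(E, ℂ)) x‖)) * eLpNorm f (ENNReal.ofReal p) volume := by
  have h2 : (0 : ℝ) < 2 ^ j := by positivity
  obtain ⟨K, hK⟩ := exists_schwartzMap_comp_smul (inv_pos.2 h2).ne' G
  -- The rescaled symbol `4^{-j} G(2^{-j}ξ)` inverts `|2πξ|²` on the `j`-th annulus, and its kernel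
  -- has `L¹` norm `O(4^{-j})`. Thus `v` below is `(-Δ)⁻¹ f`, and `P * f = c v + S * v`.
  set m : 𝓢(E, ℂ) := ((4 ^ j)⁻¹ : ℝ) • K with hm
  set F : E → ℂ := ((4 ^ j)⁻¹ : ℝ) • dilate (2 ^ j) (⇑(𝓕⁻ G : 𝓢(E, ℂ))) with hF
  have hFd : Integrable (dilate (2 ^ j) (⇑(𝓕⁻ G : 𝓢(E, ℂ)))) :=
    integrable_dilate h2 (𝓕⁻ G : 𝓢(E, ℂ)).integrable
  have hFi : Integrable F := hFd.smul _
  have hFm : ∀ ξ, 𝓕 F ξ = m ξ := by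
    intro ξ
    have e1 : 𝓕 F ξ = ((4 ^ j)⁻¹ : ℝ) • 𝓕 (dilate (2 ^ j) (⇑(𝓕⁻ G : 𝓢(E, ℂ)))) ξ := by
      rw [Real.fourier_eq, Real.fourier_eq, ← integral_smul]
      congr 1
      ext x
      rw [hF, Pi.smul_apply, smul_comm]
    rw [e1, fourier_dilate h2, ← SchwartzMap.fourier_coe, FourierTransform.fourier_fourierInv_eq,
      hm, _root_.smul_apply, hK]
  have hFn : ∫ x, ‖F x‖ = (4 ^ j)⁻¹ * ∫ x, ‖(𝓕⁻ G : 𝓢(E, ℂ)) x‖ := by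
    simp only [hF, Pi.smul_apply, norm_smul]
    rw [integral_const_mul, integral_norm_dilate h2]
    simp
  set v := multiplier m f with hv
  have hvn : eLpNorm v (ENNReal.ofReal p) volume ≤
      ENNReal.ofReal ((4 ^ j)⁻¹ * ∫ x, ‖(𝓕⁻ G : 𝓢(E, ℂ)) x‖) *
        eLpNorm f (ENNReal.ofReal p) volume := by
    rw [← eLpNorm_congr_ae (convolution_ae_eq_multiplier hFi hFm f), ← hFn]
    exact eLpNorm_convolution_schwartzMap_le hp hFi f
  have hSv : Integrable (S ⋆[ContinuousLinearMap.mul ℝ ℂ, volume] ⇑v) :=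
    integrable_convolution hS v.integrable
  have hcv : Integrable (c • ⇑v) := v.integrable.smul c
  have hae : (P ⋆[ContinuousLinearMap.mul ℝ ℂ, volume] ⇑f) =ᵐ[volume]
      c • ⇑v + (S ⋆[ContinuousLinearMap.mul ℝ ℂ, volume] ⇑v) := by
    refine ae_eq_of_fourier_eq (integrable_convolution hP f.integrable) (hcv.add hSv) ?_
    have hne : ∀ᵐ ξ : E, ξ ≠ 0 := by
      simp [ae_iff]
    filter_upwards [hne] with ξ hξ
    have e1 : 𝓕 (c • ⇑v + (S ⋆[ContinuousLinearMap.mul ℝ ℂ, volume] ⇑v)) ξ =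
        c * 𝓕 (⇑v) ξ + 𝓕 (S ⋆[ContinuousLinearMap.mul ℝ ℂ, volume] ⇑v) ξ := by
      rw [Real.fourier_eq, Real.fourier_eq, Real.fourier_eq, ← integral_const_mul, ← integral_add]
      · congr 1
        ext x
        simp only [Pi.add_apply, Pi.smul_apply, smul_add, smul_eq_mul, Circle.smul_def]
        ring
      · exact ((Real.fourierIntegral_convergent_iff ξ).2 v.integrable).const_mul c
      · exact (Real.fourierIntegral_convergent_iff ξ).2 hSv
    rw [e1, fourier_convolution hS v.integrable, fourier_convolution hP f.integrable, ← add_mul,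
      ← hPS ξ hξ, hv, fourier_multiplier]
    by_cases h0 : 𝓕 (⇑f) ξ = 0
    · rw [h0]
      ring
    · obtain ⟨l1, l2⟩ := hf ξ h0
      have hn : 2 * Real.pi * ‖((2 : ℝ) ^ j)⁻¹ • ξ‖ = 2 * Real.pi * ‖ξ‖ / 2 ^ j := by
        rw [norm_smul, norm_inv, norm_pow, Real.norm_two]
        ring
      have e2 := hG (((2 : ℝ) ^ j)⁻¹ • ξ) (by rwa [hn]) (by rwa [hn])
      have e3 : (laplaceSymbol ξ : ℂ) * m ξ = 1 := by
        rw [← e2, laplaceSymbol_smul, hm, _root_.smul_apply, hK, Complex.real_smul]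
        have : (((2 : ℝ) ^ j)⁻¹) ^ 2 = ((4 : ℝ) ^ j)⁻¹ := by
          rw [inv_pow, ← pow_mul, mul_comm, pow_mul]
          norm_num
        rw [this]
        push_cast
        ring
      linear_combination (-(𝓕 P ξ * 𝓕 (⇑f) ξ)) * e3
  rw [eLpNorm_congr_ae hae]
  have hp1 : 1 ≤ ENNReal.ofReal p := by
    rw [ENNReal.one_le_ofReal]
    exact hp.le
  have hSn : 0 ≤ ∫ x, ‖S x‖ := integral_nonneg fun _ => norm_nonneg _
  refine (eLpNorm_add_le hcv.aestronglyMeasurable hSv.aestronglyMeasurable hp1).trans ?_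
  rw [eLpNorm_const_smul, ENNReal.ofReal_mul (by positivity),
    ENNReal.ofReal_add (norm_nonneg _) hSn, ofReal_norm, mul_assoc]
  refine (add_le_add le_rfl (eLpNorm_convolution_schwartzMap_le hp hS v)).trans ?_
  rw [← add_mul]
  gcongr

/-- The convolutions of `P` with the Littlewood–Paley partial sums converge uniformly, so Fatou's
lemma and the triangle inequality give the bound. -/
theorem eLpNorm_convolution_le_tsum {d : ℕ} {Ψ : 𝓢(EuclideanSpace ℝ (Fin d), ℂ)}
    (hΨ : IsLittlewoodPaley Ψ) {p : ℝ} (hp : 1 < p) {P : EuclideanSpace ℝ (Fin d) → ℂ}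
    (hP : Integrable P) {B : ℕ → 𝓢(EuclideanSpace ℝ (Fin d), ℂ)}
    (hB : ∀ j ξ, B j ξ = dyadicSymbol Ψ j ((2 * Real.pi) • ξ))
    (H : 𝓢(EuclideanSpace ℝ (Fin d), ℂ)) :
    eLpNorm (P ⋆[ContinuousLinearMap.mul ℝ ℂ, volume] ⇑H) (ENNReal.ofReal p) volume ≤
      ∑' j, eLpNorm (P ⋆[ContinuousLinearMap.mul ℝ ℂ, volume] ⇑(multiplier (B j) H))
        (ENNReal.ofReal p) volume := by
  have hp1 : 1 ≤ ENNReal.ofReal p := by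
    rw [ENNReal.one_le_ofReal]
    exact hp.le
  set F : ℕ → EuclideanSpace ℝ (Fin d) → ℂ := fun n => ∑ j ∈ Finset.range (n + 1),
    (P ⋆[ContinuousLinearMap.mul ℝ ℂ, volume] ⇑(multiplier (B j) H)) with hF
  have hm : ∀ j, AEStronglyMeasurable
      (P ⋆[ContinuousLinearMap.mul ℝ ℂ, volume] ⇑(multiplier (B j) H)) volume := fun j =>
    (integrable_convolution hP (multiplier (B j) H).integrable).aestronglyMeasurable
  have hFm : ∀ n, AEStronglyMeasurable (F n) volume := fun n =>
    Finset.aestronglyMeasurable_sum _ fun j _ => hm j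
  have hlim : ∀ x, Tendsto (fun n => F n x) atTop
      (nhds ((P ⋆[ContinuousLinearMap.mul ℝ ℂ, volume] ⇑H) x)) := by
    intro x
    rw [tendsto_iff_norm_sub_tendsto_zero]
    have h1 := (hΨ.tendsto_integral_norm_fourier_sub hB H).const_mul (∫ y, ‖P y‖)
    rw [mul_zero] at h1
    refine squeeze_zero (fun n => norm_nonneg _) (fun n => ?_) h1
    rw [norm_sub_rev]
    have h2 : F n x = (P ⋆[ContinuousLinearMap.mul ℝ ℂ, volume]
        ⇑(∑ j ∈ Finset.range (n + 1), multiplier (B j) H)) x := by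
      rw [convolution_sum_right hP]
      exact Finset.sum_apply _ _ _
    rw [h2, ← convolution_sub_right hP]
    exact norm_convolution_schwartzMap_le hP _ x
  refine (Lp.eLpNorm_lim_le_liminf_eLpNorm hFm _ (Eventually.of_forall hlim)).trans ?_
  refine liminf_le_of_frequently_le' (Frequently.of_forall fun n => ?_)
  refine (eLpNorm_sum_le (fun j _ => hm j) hp1).trans ?_
  exact ENNReal.sum_le_tsum _

/-- Bounds for the action of the time primitive of the fundamental solution on dyadic blocks. -/
theorem IsRayAngle.exists_eLpNorm_velocity_le {α θ : ℝ} (h : IsRayAngle α θ) {d : ℕ} (hd : 0 < d)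
    {Ψ : 𝓢(EuclideanSpace ℝ (Fin d), ℂ)} (hΨ : IsLittlewoodPaley Ψ) {p : ℝ} (hp : 1 < p)
    {k : ℝ → EuclideanSpace ℝ (Fin d) → ℝ} {B : ℝ}
    (hk : ∀ t, 0 < t → Integrable (velocityKernel k t) ∧
        ∫ x, ‖velocityKernel k t x‖ ≤ B * t ∧ ∀ ξ ≠ 0,
          𝓕 (fun x => (velocityKernel k t x : ℂ)) ξ =
            ((∫ s in (0 : ℝ)..t, mittagLeffler α θ s (laplaceSymbol ξ) : ℝ) : ℂ)) :
    ∃ C : ℝ, 0 ≤ C ∧ ∀ t, 0 < t → ∀ g : EuclideanSpace ℝ (Fin d) → ℝ, ContDiff ℝ ∞ g →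
      HasCompactSupport g →
      eLpNorm (velocityKernel k t ⋆[ContinuousLinearMap.mul ℝ ℝ, volume] g)
          (ENNReal.ofReal p) volume ≤
        ENNReal.ofReal (C * t) * eLpNorm (dyadicBlock Ψ 0 g) (ENNReal.ofReal p) volume +
          ∑' j : ℕ, ENNReal.ofReal (C * min t (t ^ (1 - α) * (4 ^ (j + 1))⁻¹)) *
            eLpNorm (dyadicBlock Ψ (j + 1) g) (ENNReal.ofReal p) volume := by
  have : Nonempty (Fin d) := ⟨⟨0, hd⟩⟩
  obtain ⟨A, hA0, hA⟩ := h.exists_velocity_remainder (E := EuclideanSpace ℝ (Fin d))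
  obtain ⟨G, hG⟩ := exists_annulus_inverse (E := EuclideanSpace ℝ (Fin d))
  choose D hD using hΨ.exists_symbol
  set N := ∫ x, ‖(𝓕⁻ G : 𝓢(EuclideanSpace ℝ (Fin d), ℂ)) x‖ with hN
  have hN0 : 0 ≤ N := integral_nonneg fun _ => norm_nonneg _
  refine ⟨max B (2 * A * N), le_max_of_le_right (by positivity), fun t ht g hg hgc => ?_⟩
  set C := max B (2 * A * N) with hC
  obtain ⟨H, hH⟩ := exists_schwartzMap_ofReal hg hgc
  obtain ⟨hPi, hPn, hPF⟩ := hk t ht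
  obtain ⟨c, S, hS, hc, hSn, hcS⟩ := hA t ht
  set P : EuclideanSpace ℝ (Fin d) → ℂ := fun x => (velocityKernel k t x : ℂ) with hP
  have hPc : Integrable P := hPi.ofReal
  have hPn' : ∫ x, ‖P x‖ ≤ B * t := by simpa [hP] using hPn
  have hconv : eLpNorm (velocityKernel k t ⋆[ContinuousLinearMap.mul ℝ ℝ, volume] g)
      (ENNReal.ofReal p) volume = eLpNorm (P ⋆[ContinuousLinearMap.mul ℝ ℂ, volume] ⇑H)
      (ENNReal.ofReal p) volume := by
    refine eLpNorm_congr_norm_ae (Eventually.of_forall fun x => ?_)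
    have hHg : ⇑H = fun x => (g x : ℂ) := funext hH
    rw [hHg, hP, ← ofReal_convolution, Complex.norm_real]
  have hblock : ∀ j, eLpNorm (dyadicBlock Ψ j g) (ENNReal.ofReal p) volume =
      eLpNorm (multiplier (D j) H) (ENNReal.ofReal p) volume := fun j =>
    eLpNorm_congr_ae (IsLittlewoodPaley.dyadicBlock_ae_eq (hD j) hH)
  have hlow : ∀ j, eLpNorm (P ⋆[ContinuousLinearMap.mul ℝ ℂ, volume] ⇑(multiplier (D j) H))
      (ENNReal.ofReal p) volume ≤ ENNReal.ofReal (C * t) *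
        eLpNorm (multiplier (D j) H) (ENNReal.ofReal p) volume := by
    intro j
    refine (eLpNorm_convolution_schwartzMap_le hp hPc _).trans ?_
    gcongr
    exact hPn'.trans (mul_le_mul_of_nonneg_right (le_max_left _ _) ht.le)
  have hhigh : ∀ j, eLpNorm (P ⋆[ContinuousLinearMap.mul ℝ ℂ, volume]
      ⇑(multiplier (D (j + 1)) H)) (ENNReal.ofReal p) volume ≤
        ENNReal.ofReal (C * (t ^ (1 - α) * (4 ^ (j + 1))⁻¹)) *
        eLpNorm (multiplier (D (j + 1)) H) (ENNReal.ofReal p) volume := by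
    intro j
    have hPS : ∀ ξ ≠ 0, (laplaceSymbol ξ : ℂ) * 𝓕 P ξ = c + 𝓕 S ξ := fun ξ hξ => by
      rw [hP, hPF ξ hξ, hcS ξ hξ]
    refine (eLpNorm_convolution_annulus_le hp hPc hS hPS hG (j := j + 1) fun ξ hξ => ?_).trans ?_
    · rw [fourier_multiplier, hD] at hξ
      have := hΨ.annulus_of_dyadicSymbol_ne_zero (left_ne_zero_of_mul hξ)
      rwa [norm_smul, Real.norm_of_nonneg (by positivity)] at this
    · refine mul_le_mul_left (ENNReal.ofReal_le_ofReal ?_) _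
      have htp : 0 < t ^ (1 - α) := Real.rpow_pos_of_pos ht _
      calc (‖c‖ + ∫ x, ‖S x‖) * (((4 : ℝ) ^ (j + 1))⁻¹ * N)
          ≤ (A * t ^ (1 - α) + A * t ^ (1 - α)) * (((4 : ℝ) ^ (j + 1))⁻¹ * N) := by gcongr
        _ = 2 * A * N * (t ^ (1 - α) * (4 ^ (j + 1))⁻¹) := by ring
        _ ≤ _ := mul_le_mul_of_nonneg_right (le_max_right _ _) (by positivity)
  rw [hconv]
  refine (eLpNorm_convolution_le_tsum hΨ hp hPc hD H).trans ?_
  rw [tsum_eq_zero_add' ENNReal.summable]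
  simp only [hblock]
  refine add_le_add (hlow 0) (ENNReal.tsum_le_tsum fun j => ?_)
  rcases min_choice t (t ^ (1 - α) * (4 ^ (j + 1))⁻¹) with h1 | h1
  · rw [h1]
    exact hlow _
  · rw [h1]
    exact hhigh j

end BlockBounds

end FracDiffusion

namespace FracDiffusion

/-! ### Schur's test in the dyadic index and time. -/

section Schur

open Filter

/-- The profile `min(z^σ, z^{σ-2})` of the dyadic kernel. -/
def dyadicProfile (σ z : ℝ) : ℝ := min (z ^ σ) (z ^ (σ - 2))

variable {σ : ℝ}

theorem dyadicProfile_nonneg {z : ℝ} (hz : 0 ≤ z) : 0 ≤ dyadicProfile σ z :=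
  le_min (Real.rpow_nonneg hz _) (Real.rpow_nonneg hz _)

theorem dyadicProfile_le_one {z : ℝ} (hσ : 0 < σ) (hσ2 : σ < 2) (hz : 0 ≤ z) :
    dyadicProfile σ z ≤ 1 := by
  rcases le_total z 1 with h | h
  · exact (min_le_left _ _).trans (Real.rpow_le_one hz h hσ.le)
  · exact (min_le_right _ _).trans (Real.rpow_le_one_of_one_le_of_nonpos h (by linarith))

theorem measurable_dyadicProfile : Measurable (dyadicProfile σ) := by
  unfold dyadicProfile
  fun_prop

/-- With `2^n ≤ 1/y < 2^{n+1}`, the argument `y 2^{j+1}` lies between `2^{j-n}` and `2^{j-n+1}`, and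
the profile decays on both sides of `1` at rate at least `min σ (2-σ)`. The factor `4 = 2²` absorbs
the shift by one, since `σ < 2`. -/
theorem dyadicProfile_le_geometric (hσ : 0 < σ) (hσ2 : σ < 2) {y : ℝ} (hy : 0 < y) {n : ℤ}
    (h1 : (2 : ℝ) ^ n ≤ y⁻¹) (h2 : y⁻¹ < (2 : ℝ) ^ (n + 1)) (j : ℕ) :
    dyadicProfile σ (y * 2 ^ (j + 1)) ≤
      4 * ((2 : ℝ) ^ (-(min σ (2 - σ)))) ^ ((j : ℤ) - n).natAbs := by
  set ε := min σ (2 - σ) with hε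
  have hε0 : 0 < ε := lt_min hσ (by linarith)
  have hεσ : ε ≤ σ := min_le_left _ _
  have hεσ' : ε ≤ 2 - σ := min_le_right _ _
  have hpow : ∀ m : ℤ, (2 : ℝ) ^ m = (2 : ℝ) ^ (m : ℝ) := fun m => (Real.rpow_intCast 2 m).symm
  have hj : (2 : ℝ) ^ (j + 1) = (2 : ℝ) ^ (((j : ℤ) + 1 : ℤ) : ℝ) := by
    rw [← hpow]
    norm_cast
  have hr : ((2 : ℝ) ^ (-ε)) ^ ((j : ℤ) - n).natAbs = 2 ^ (-ε * |(j : ℝ) - n|) := by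
    rw [Real.rpow_mul zero_le_two, ← Real.rpow_natCast ((2 : ℝ) ^ (-ε))]
    congr 1
    rw [Nat.cast_natAbs]
    push_cast
    rfl
  have h4 : (4 : ℝ) = 2 ^ (2 : ℝ) := by norm_num
  rw [hr, h4, ← Real.rpow_add two_pos]
  have hy1 : y ≤ 2 ^ (-(n : ℝ)) := by
    rw [Real.rpow_neg zero_le_two, ← hpow]
    exact (le_inv_comm₀ (by positivity) hy).1 h1
  have hy2 : (2 : ℝ) ^ (-((n : ℝ) + 1)) ≤ y := by
    have : (2 : ℝ) ^ ((n : ℝ) + 1) = 2 ^ (n + 1) := by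
      rw [hpow]
      push_cast
      rfl
    rw [Real.rpow_neg zero_le_two, this]
    exact (inv_le_comm₀ (by positivity) hy).2 h2.le
  rcases le_total (j : ℝ) n with hjn | hjn
  · refine (min_le_left _ _).trans ?_
    have hz : y * 2 ^ (j + 1) ≤ 2 ^ ((j : ℝ) + 1 - n) := by
      rw [hj]
      calc y * 2 ^ (((j : ℤ) + 1 : ℤ) : ℝ) ≤ 2 ^ (-(n : ℝ)) * 2 ^ (((j : ℤ) + 1 : ℤ) : ℝ) := by
            gcongr
        _ = _ := by
          rw [← Real.rpow_add two_pos]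
          congr 1
          push_cast
          ring
    refine (Real.rpow_le_rpow (by positivity) hz hσ.le).trans ?_
    rw [← Real.rpow_mul zero_le_two]
    refine Real.rpow_le_rpow_of_exponent_le one_le_two ?_
    rw [abs_of_nonpos (by linarith)]
    nlinarith
  · refine (min_le_right _ _).trans ?_
    have hz : (2 : ℝ) ^ ((j : ℝ) - n) ≤ y * 2 ^ (j + 1) := by
      rw [hj]
      calc (2 : ℝ) ^ ((j : ℝ) - n) = 2 ^ (-((n : ℝ) + 1)) * 2 ^ (((j : ℤ) + 1 : ℤ) : ℝ) := by
            rw [← Real.rpow_add two_pos]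
            congr 1
            push_cast
            ring
        _ ≤ _ := by gcongr
    refine (Real.rpow_le_rpow_of_nonpos (by positivity) hz (by linarith)).trans ?_
    rw [← Real.rpow_mul zero_le_two]
    refine Real.rpow_le_rpow_of_exponent_le one_le_two ?_
    rw [abs_of_nonneg (by linarith)]
    nlinarith

theorem exists_tsum_dyadicProfile_le (hσ : 0 < σ) (hσ2 : σ < 2) :
    ∃ C : ℝ, 0 ≤ C ∧ ∀ y, 0 < y →
      ∑' j : ℕ, ENNReal.ofReal (dyadicProfile σ (y * 2 ^ (j + 1))) ≤ ENNReal.ofReal C := by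
  set r : ℝ := (2 : ℝ) ^ (-(min σ (2 - σ))) with hr
  have hr0 : 0 ≤ r := by positivity
  have hr1 : r < 1 := Real.rpow_lt_one_of_one_lt_of_neg one_lt_two
    (neg_lt_zero.2 (lt_min hσ (by linarith)))
  have hs : Summable fun m : ℤ => 4 * r ^ m.natAbs := by
    refine Summable.mul_left 4 (Summable.of_nat_of_neg ?_ ?_)
    · simpa using summable_geometric_of_lt_one hr0 hr1
    · simpa using summable_geometric_of_lt_one hr0 hr1
  have h0 : ∀ m : ℤ, 0 ≤ 4 * r ^ m.natAbs := fun m => by positivity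
  refine ⟨∑' m : ℤ, 4 * r ^ m.natAbs, tsum_nonneg h0, fun y hy => ?_⟩
  obtain ⟨n, hn1, hn2⟩ := exists_mem_Ico_zpow (inv_pos.2 hy) one_lt_two
  rw [ENNReal.ofReal_tsum_of_nonneg h0 hs]
  have hinj : Function.Injective fun j : ℕ => (j : ℤ) - n := fun a b h => by simpa using h
  refine le_trans (ENNReal.tsum_le_tsum fun j => ENNReal.ofReal_le_ofReal
    (dyadicProfile_le_geometric hσ hσ2 hy hn1 hn2 j)) ?_
  exact ENNReal.tsum_comp_le_tsum_of_injective hinj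
    fun m : ℤ => ENNReal.ofReal (4 * r ^ m.natAbs)

/-- The identity holds for every `σ`, which is the smoothness parameter to be chosen: a power of
`t`, a profile in the self-similar variable, and the Besov weight. -/
theorem min_eq_dyadicProfile (σ α : ℝ) {t : ℝ} (ht : 0 < t) (j : ℕ) :
    min t (t ^ (1 - α) * (4 ^ (j + 1))⁻¹) =
      t ^ (1 - α * σ / 2) * dyadicProfile σ (t ^ (α / 2) * 2 ^ (j + 1)) *
        2 ^ (-(σ * ((j : ℝ) + 1))) := by
  have h2 : (2 : ℝ) ^ (j + 1) = 2 ^ ((j : ℝ) + 1) := by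
    rw [← Real.rpow_natCast]
    push_cast
    rfl
  have h4 : ((4 : ℝ) ^ (j + 1))⁻¹ = 2 ^ (-(2 * ((j : ℝ) + 1))) := by
    have h22 : (2 : ℝ) ^ (2 : ℝ) = 4 := by norm_num
    rw [Real.rpow_neg zero_le_two, Real.rpow_mul zero_le_two, h22, ← Real.rpow_natCast 4]
    push_cast
    rfl
  have key : ∀ τ : ℝ, t ^ (1 - α * σ / 2) * (t ^ (α / 2) * 2 ^ (j + 1)) ^ τ *
      2 ^ (-(σ * ((j : ℝ) + 1))) =
      t ^ (1 - α * σ / 2 + α / 2 * τ) * 2 ^ (((j : ℝ) + 1) * τ - σ * ((j : ℝ) + 1)) := by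
    intro τ
    rw [Real.mul_rpow (by positivity) (by positivity), ← Real.rpow_mul ht.le, h2,
      ← Real.rpow_mul zero_le_two, Real.rpow_add ht, sub_eq_add_neg _ (σ * _),
      Real.rpow_add two_pos]
    ring
  rw [dyadicProfile, mul_min_of_nonneg _ _ (by positivity), min_mul_of_nonneg _ _ (by positivity),
    key, key, h4]
  congr 1
  · have e1 : 1 - α * σ / 2 + α / 2 * σ = 1 := by ring
    have e2 : ((j : ℝ) + 1) * σ - σ * ((j : ℝ) + 1) = 0 := by ring
    rw [e1, e2]
    simp
  · congr 2 <;> ring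

/-- Jensen's inequality for weighted sums. -/
theorem tsum_mul_rpow_le {ι : Type*} {p : ℝ} (hp : 1 ≤ p) (w f : ι → ℝ≥0∞) :
    (∑' i, w i * f i) ^ p ≤ (∑' i, w i) ^ (p - 1) * ∑' i, w i * f i ^ p := by
  have hp0 : 0 < p := by linarith
  have h1 : ∑' i, w i * f i ≤ (∑' i, w i) ^ (1 - p⁻¹) * (∑' i, w i * f i ^ p) ^ p⁻¹ := by
    refine ENNReal.summable.tsum_le_of_sum_le fun s => ?_
    refine (ENNReal.inner_le_weight_mul_Lp_of_nonneg s hp w f).trans ?_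
    have hq : 0 ≤ 1 - p⁻¹ := sub_nonneg.2 (inv_le_one_of_one_le₀ hp)
    gcongr
    · exact ENNReal.sum_le_tsum s
    · exact ENNReal.sum_le_tsum s
  refine (ENNReal.rpow_le_rpow h1 hp0.le).trans (le_of_eq ?_)
  rw [ENNReal.mul_rpow_of_nonneg _ _ hp0.le, ← ENNReal.rpow_mul, ← ENNReal.rpow_mul,
    inv_mul_cancel₀ hp0.ne', ENNReal.rpow_one, sub_mul, inv_mul_cancel₀ hp0.ne', one_mul]

/-- Schur's test for the dyadic kernel. -/
theorem exists_lintegral_tsum_le {α p T : ℝ} (hp : 1 < p) (hσ : 0 < σ) (hσ2 : σ < 2) {D : ℝ}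
    (hD : ∀ j : ℕ, ∫⁻ t in Ioc 0 T, ENNReal.ofReal (t ^ (p * (1 - α * σ / 2)) *
      dyadicProfile σ (t ^ (α / 2) * 2 ^ (j + 1))) ≤ ENNReal.ofReal D) :
    ∃ C : ℝ≥0, ∀ a : ℕ → ℝ≥0∞,
      ∫⁻ t in Ioc 0 T, (∑' j : ℕ, ENNReal.ofReal (min t (t ^ (1 - α) * (4 ^ (j + 1))⁻¹)) * a j) ^ p
        ≤ C * ∑' j : ℕ, ENNReal.ofReal (2 ^ (-σ * p * ((j : ℝ) + 1))) * a j ^ p := by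
  have hp0 : 0 < p := by linarith
  obtain ⟨A, hA0, hA⟩ := exists_tsum_dyadicProfile_le hσ hσ2
  refine ⟨(A ^ (p - 1)).toNNReal * D.toNNReal, fun a => ?_⟩
  -- The Besov weight goes into `b`, leaving Jensen weights `q φ(y 2^{j+1})` of total mass at most
  -- `qA`. Jensen yields `(qA)^{p-1}` times one more `q`, hence `q^p = t^{p(1-ασ/2)}`.
  set b : ℕ → ℝ≥0∞ := fun j => ENNReal.ofReal (2 ^ (-(σ * ((j : ℝ) + 1)))) * a j with hb
  have hbp : ∀ j, b j ^ p = ENNReal.ofReal (2 ^ (-σ * p * ((j : ℝ) + 1))) * a j ^ p := by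
    intro j
    rw [hb]
    simp only
    rw [ENNReal.mul_rpow_of_nonneg _ _ hp0.le, ENNReal.ofReal_rpow_of_pos (by positivity),
      ← Real.rpow_mul zero_le_two]
    congr 3
    ring
  have hpt : ∀ t ∈ Ioc 0 T,
      (∑' j : ℕ, ENNReal.ofReal (min t (t ^ (1 - α) * (4 ^ (j + 1))⁻¹)) * a j) ^ p ≤
        ∑' j : ℕ, ENNReal.ofReal (A ^ (p - 1)) * b j ^ p *
          ENNReal.ofReal (t ^ (p * (1 - α * σ / 2)) *
            dyadicProfile σ (t ^ (α / 2) * 2 ^ (j + 1))) := by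
    intro t ht
    have ht0 : 0 < t := ht.1
    set y := t ^ (α / 2) with hy
    have hy0 : 0 < y := Real.rpow_pos_of_pos ht0 _
    set q := t ^ (1 - α * σ / 2) with hq
    have hq0 : 0 < q := Real.rpow_pos_of_pos ht0 _
    set w : ℕ → ℝ≥0∞ := fun j => ENNReal.ofReal (q * dyadicProfile σ (y * 2 ^ (j + 1))) with hw
    have e1 : ∀ j : ℕ, ENNReal.ofReal (min t (t ^ (1 - α) * (4 ^ (j + 1))⁻¹)) * a j =
        w j * b j := by
      intro j
      rw [min_eq_dyadicProfile σ α ht0, ENNReal.ofReal_mul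
        (mul_nonneg hq0.le (dyadicProfile_nonneg (by positivity))), mul_assoc]
    have e2 : ∑' j, w j ≤ ENNReal.ofReal (q * A) := by
      simp only [hw, ENNReal.ofReal_mul hq0.le]
      rw [ENNReal.tsum_mul_left]
      exact mul_le_mul_right (hA y hy0) _
    simp only [e1]
    refine (tsum_mul_rpow_le hp.le w b).trans ?_
    rw [← ENNReal.tsum_mul_left]
    refine ENNReal.tsum_le_tsum fun j => ?_
    have e3 : (∑' j, w j) ^ (p - 1) ≤
        ENNReal.ofReal (q ^ (p - 1)) * ENNReal.ofReal (A ^ (p - 1)) := by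
      refine (ENNReal.rpow_le_rpow e2 (by linarith)).trans (le_of_eq ?_)
      rw [ENNReal.ofReal_rpow_of_nonneg (by positivity) (by linarith),
        Real.mul_rpow hq0.le hA0, ENNReal.ofReal_mul (by positivity)]
    have e4 : t ^ (p * (1 - α * σ / 2)) = q ^ (p - 1) * q := by
      rw [← Real.rpow_add_one hq0.ne', sub_add_cancel, hq, ← Real.rpow_mul ht0.le]
      congr 1
      ring
    refine (mul_le_mul_left e3 _).trans (le_of_eq ?_)
    rw [e4, mul_assoc (q ^ (p - 1)), ENNReal.ofReal_mul (by positivity : 0 ≤ q ^ (p - 1))]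
    ring
  have hmeas : ∀ j : ℕ, Measurable fun t : ℝ => ENNReal.ofReal (t ^ (p * (1 - α * σ / 2)) *
      dyadicProfile σ (t ^ (α / 2) * 2 ^ (j + 1))) := by
    intro j
    have h1 : Measurable fun t : ℝ => t ^ (α / 2) * 2 ^ (j + 1) := by fun_prop
    have h2 : Measurable fun t : ℝ => t ^ (p * (1 - α * σ / 2)) := by fun_prop
    exact (h2.mul (measurable_dyadicProfile.comp h1)).ennreal_ofReal
  refine (setLIntegral_mono' measurableSet_Ioc hpt).trans ?_
  rw [lintegral_tsum fun j => ((hmeas j).const_mul _).aemeasurable, ← ENNReal.tsum_mul_left]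
  refine ENNReal.tsum_le_tsum fun j => ?_
  rw [lintegral_const_mul _ (hmeas j), ← hbp]
  refine (mul_le_mul_right (hD j) _).trans (le_of_eq ?_)
  rw [ENNReal.ofReal, ENNReal.ofReal]
  push_cast
  ring

end Schur

end FracDiffusion

namespace FracDiffusion

/-! ### Integration in time and the choice of the smoothness. -/

section SpaceTime

open Filter

/-- The measure `dt/t` is scale invariant, so the bound does not depend on `c`; splitting at `t = c`
gives `1/a` and `1/b`. -/
theorem lintegral_inv_mul_min_le {a b c : ℝ} (ha : 0 < a) (hb : 0 < b) (hc : 0 < c) :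
    ∫⁻ t in Ioi (0 : ℝ), ENNReal.ofReal (t⁻¹ * min ((t / c) ^ a) ((t / c) ^ (-b))) ≤
      ENNReal.ofReal (1 / a + 1 / b) := by
  rw [← Ioc_union_Ioi_eq_Ioi hc.le, lintegral_union measurableSet_Ioi Ioc_disjoint_Ioi_same,
    ENNReal.ofReal_add (by positivity) (by positivity)]
  refine add_le_add ?_ ?_
  · have hi : IntegrableOn (fun t : ℝ => t ^ (a - 1) * (c ^ a)⁻¹) (Ioc 0 c) :=
      ((intervalIntegrable_iff_integrableOn_Ioc_of_le hc.le).1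
        (intervalIntegral.intervalIntegrable_rpow' (by linarith))).mul_const _
    have hv : ∫ t in Ioc 0 c, t ^ (a - 1) * (c ^ a)⁻¹ = 1 / a := by
      rw [integral_mul_const, ← intervalIntegral.integral_of_le hc.le,
        integral_rpow (Or.inl (by linarith)), sub_add_cancel, Real.zero_rpow ha.ne']
      have := (Real.rpow_pos_of_pos hc a).ne'
      field_simp
      ring
    rw [← hv, ofReal_integral_eq_lintegral_ofReal hi]
    · refine setLIntegral_mono' measurableSet_Ioc fun t ht => ENNReal.ofReal_le_ofReal ?_
      refine (mul_le_mul_of_nonneg_left (min_le_left _ _) (inv_nonneg.2 ht.1.le)).trans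
        (le_of_eq ?_)
      rw [Real.div_rpow ht.1.le hc.le, Real.rpow_sub_one ht.1.ne']
      ring
    · filter_upwards [ae_restrict_mem measurableSet_Ioc] with t ht
      have := ht.1
      simp only [Pi.zero_apply]
      positivity
  · have hi : IntegrableOn (fun t : ℝ => t ^ (-b - 1) * c ^ b) (Ioi c) :=
      (integrableOn_Ioi_rpow_of_lt (by linarith) hc).mul_const _
    have hv : ∫ t in Ioi c, t ^ (-b - 1) * c ^ b = 1 / b := by
      rw [integral_mul_const, integral_Ioi_rpow_of_lt (by linarith) hc, sub_add_cancel,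
        Real.rpow_neg hc.le]
      have := (Real.rpow_pos_of_pos hc b).ne'
      field_simp
    rw [← hv, ofReal_integral_eq_lintegral_ofReal hi]
    · refine setLIntegral_mono' measurableSet_Ioi fun t ht => ENNReal.ofReal_le_ofReal ?_
      have ht0 : 0 < t := hc.trans ht
      refine (mul_le_mul_of_nonneg_left (min_le_right _ _) (inv_nonneg.2 ht0.le)).trans
        (le_of_eq ?_)
      rw [Real.div_rpow ht0.le hc.le, Real.rpow_sub_one ht0.ne', Real.rpow_neg hc.le]
      have := (Real.rpow_pos_of_pos hc b).ne'
      field_simp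
    · filter_upwards [ae_restrict_mem measurableSet_Ioi] with t ht
      have ht0 : 0 < t := hc.trans ht
      simp only [Pi.zero_apply]
      positivity

theorem dyadicProfile_mul_eq {σ α t : ℝ} (hα : 0 < α) (ht : 0 < t) {z : ℝ} (hz : 0 < z) :
    dyadicProfile σ (t ^ (α / 2) * z) =
      min ((t / z ^ (-(2 / α))) ^ (α * σ / 2)) ((t / z ^ (-(2 / α))) ^ (-(α * (2 - σ) / 2))) := by
  have key : t ^ (α / 2) * z = (t / z ^ (-(2 / α))) ^ (α / 2) := by
    rw [Real.div_rpow ht.le (by positivity), ← Real.rpow_mul hz.le]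
    have : -(2 / α) * (α / 2) = -1 := by field_simp
    rw [this, Real.rpow_neg_one, div_inv_eq_mul]
  rw [dyadicProfile, key, ← Real.rpow_mul (by positivity), ← Real.rpow_mul (by positivity)]
  congr 2 <;> ring

/-- At exponent `-1` the measure is `dt/t`, so the integral over all `t > 0` is bounded uniformly in
`j`. The two branches of the profile cross at the time `2^{-2(j+1)/α}`. -/
theorem lintegral_dyadicProfile_le_of_critical {α p σ T : ℝ} (hα : 0 < α) (hσ : 0 < σ)
    (hσ2 : σ < 2) (hcrit : p * (1 - α * σ / 2) = -1) (j : ℕ) :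
    ∫⁻ t in Ioc 0 T, ENNReal.ofReal (t ^ (p * (1 - α * σ / 2)) *
      dyadicProfile σ (t ^ (α / 2) * 2 ^ (j + 1))) ≤
        ENNReal.ofReal (1 / (α * σ / 2) + 1 / (α * (2 - σ) / 2)) := by
  have h2 : 0 < 2 - σ := by linarith
  refine le_trans ?_ (lintegral_inv_mul_min_le (a := α * σ / 2) (b := α * (2 - σ) / 2)
    (c := ((2 : ℝ) ^ (j + 1)) ^ (-(2 / α))) (by positivity) (by positivity) (by positivity))
  refine (lintegral_mono_set Ioc_subset_Ioi_self).trans ?_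
  refine setLIntegral_mono' measurableSet_Ioi fun t ht => ENNReal.ofReal_le_ofReal (le_of_eq ?_)
  rw [hcrit, Real.rpow_neg_one, dyadicProfile_mul_eq hα ht (by positivity)]

theorem lintegral_dyadicProfile_le_of_subcritical {α p σ T : ℝ} (hσ : 0 < σ) (hσ2 : σ < 2)
    (hcrit : p * (1 - α * σ / 2) = 0) (j : ℕ) :
    ∫⁻ t in Ioc 0 T, ENNReal.ofReal (t ^ (p * (1 - α * σ / 2)) *
      dyadicProfile σ (t ^ (α / 2) * 2 ^ (j + 1))) ≤ ENNReal.ofReal T := by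
  refine (setLIntegral_mono' (g := fun _ => 1) measurableSet_Ioc fun t ht => ?_).trans ?_
  · rw [hcrit, Real.rpow_zero, one_mul, ENNReal.ofReal_le_one]
    have := ht.1
    exact dyadicProfile_le_one hσ hσ2 (by positivity)
  · simp

/-- From bounds on dyadic blocks to the space-time estimate. -/
theorem exists_lintegral_velocity_le {α p T C₀ σ D : ℝ} {d : ℕ}
    {Ψ : 𝓢(EuclideanSpace ℝ (Fin d), ℂ)} (hp : 1 < p) (hC₀ : 0 ≤ C₀) (hσ : 0 < σ) (hσ2 : σ < 2)
    (hD : ∀ j : ℕ, ∫⁻ t in Ioc 0 T, ENNReal.ofReal (t ^ (p * (1 - α * σ / 2)) *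
      dyadicProfile σ (t ^ (α / 2) * 2 ^ (j + 1))) ≤ ENNReal.ofReal D) :
    ∃ C : ℝ≥0, ∀ (u : ℝ → EuclideanSpace ℝ (Fin d) → ℝ) (g : EuclideanSpace ℝ (Fin d) → ℝ),
      (∀ t, 0 < t → eLpNorm (u t) (ENNReal.ofReal p) volume ≤
        ENNReal.ofReal (C₀ * t) * eLpNorm (dyadicBlock Ψ 0 g) (ENNReal.ofReal p) volume +
          ∑' j : ℕ, ENNReal.ofReal (C₀ * min t (t ^ (1 - α) * (4 ^ (j + 1))⁻¹)) *
            eLpNorm (dyadicBlock Ψ (j + 1) g) (ENNReal.ofReal p) volume) →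
      ∫⁻ t in Ioc 0 T, ∫⁻ x, ‖u t x‖ₑ ^ p ≤ C * besovNorm Ψ (-σ) p g ^ p := by
  have hp0 : 0 < p := by linarith
  obtain ⟨C₁, hC₁⟩ := exists_lintegral_tsum_le hp hσ hσ2 hD
  -- The constants come from `(a+b)^p ≤ 2^{p-1}(a^p+b^p)`, from the block bound, and from the
  -- low-frequency block, whose factor `t^p ≤ T^p` is integrated over `(0, T]`.
  set c₂ : ℝ≥0∞ := 2 ^ (p - 1) with hc₂
  have hc₂t : c₂ ≠ ⊤ := ENNReal.rpow_ne_top_of_nonneg (by linarith) (by simp)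
  set c₀ : ℝ≥0∞ := ENNReal.ofReal C₀ ^ p with hc₀
  have hc₀t : c₀ ≠ ⊤ := ENNReal.rpow_ne_top_of_nonneg hp0.le (by simp)
  set τ : ℝ≥0∞ := ENNReal.ofReal T ^ p * ENNReal.ofReal T with hτ
  have hτt : τ ≠ ⊤ := ENNReal.mul_ne_top (ENNReal.rpow_ne_top_of_nonneg hp0.le (by simp)) (by simp)
  have hKt : c₂ * c₀ * (τ + C₁) ≠ ⊤ :=
    ENNReal.mul_ne_top (ENNReal.mul_ne_top hc₂t hc₀t) (by simp [hτt])
  refine ⟨(c₂ * c₀ * (τ + C₁)).toNNReal, fun u g hu => ?_⟩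
  rw [ENNReal.coe_toNNReal hKt]
  set n : ℕ → ℝ≥0∞ := fun j => eLpNorm (dyadicBlock Ψ j g) (ENNReal.ofReal p) volume with hn
  set S : ℝ → ℝ≥0∞ := fun t => ∑' j : ℕ,
    ENNReal.ofReal (min t (t ^ (1 - α) * (4 ^ (j + 1))⁻¹)) * n (j + 1) with hS
  set M : ℝ≥0∞ := ∑' j : ℕ, ENNReal.ofReal (2 ^ (-σ * p * ((j : ℝ) + 1))) * n (j + 1) ^ p with hM
  have hpt : ∀ t ∈ Ioc 0 T, ∫⁻ x, ‖u t x‖ₑ ^ p ≤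
      c₂ * c₀ * (ENNReal.ofReal T ^ p * n 0 ^ p) + c₂ * c₀ * S t ^ p := by
    intro t ht
    have e1 : ∫⁻ x, ‖u t x‖ₑ ^ p = eLpNorm (u t) (ENNReal.ofReal p) volume ^ p := by
      rw [eLpNorm_eq_lintegral_rpow_enorm_toReal (by simpa using hp0) (by simp),
        ENNReal.toReal_ofReal hp0.le, ← ENNReal.rpow_mul, one_div, inv_mul_cancel₀ hp0.ne',
        ENNReal.rpow_one]
    have e2 : eLpNorm (u t) (ENNReal.ofReal p) volume ≤
        ENNReal.ofReal C₀ * (ENNReal.ofReal T * n 0) + ENNReal.ofReal C₀ * S t := by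
      refine (hu t ht.1).trans (add_le_add ?_ (le_of_eq ?_))
      · rw [ENNReal.ofReal_mul hC₀, mul_assoc]
        gcongr
        exact ht.2
      · rw [hS, ← ENNReal.tsum_mul_left]
        congr 1
        ext j
        rw [ENNReal.ofReal_mul hC₀, mul_assoc]
    rw [e1]
    refine (ENNReal.rpow_le_rpow e2 hp0.le).trans ?_
    refine (ENNReal.rpow_add_le_mul_rpow_add_rpow _ _ hp.le).trans (le_of_eq ?_)
    simp only [ENNReal.mul_rpow_of_nonneg _ _ hp0.le]
    rw [mul_add, ← mul_assoc c₂, ← mul_assoc c₂]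
  have hb : besovNorm Ψ (-σ) p g = n 0 + M ^ (1 / p) := rfl
  have hn0 : n 0 ^ p ≤ besovNorm Ψ (-σ) p g ^ p := by
    rw [hb]
    gcongr
    exact le_self_add
  have hMb : M ≤ besovNorm Ψ (-σ) p g ^ p := by
    calc M = (M ^ (1 / p)) ^ p := by
          rw [← ENNReal.rpow_mul, one_div, inv_mul_cancel₀ hp0.ne', ENNReal.rpow_one]
      _ ≤ _ := by
        rw [hb]
        gcongr
        exact le_add_self
  refine (setLIntegral_mono' measurableSet_Ioc hpt).trans ?_
  rw [lintegral_add_left measurable_const, lintegral_const, lintegral_const_mul' _ _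
    (ENNReal.mul_ne_top hc₂t hc₀t), Measure.restrict_apply_univ, Real.volume_Ioc, sub_zero]
  calc c₂ * c₀ * (ENNReal.ofReal T ^ p * n 0 ^ p) * ENNReal.ofReal T +
        c₂ * c₀ * ∫⁻ t in Ioc 0 T, S t ^ p
      ≤ c₂ * c₀ * (τ * besovNorm Ψ (-σ) p g ^ p) + c₂ * c₀ * (C₁ * besovNorm Ψ (-σ) p g ^ p) := by
        refine add_le_add ?_ ?_
        · rw [mul_assoc, mul_right_comm (ENNReal.ofReal T ^ p)]
          gcongr
        · refine mul_le_mul_right ((hC₁ fun j => n (j + 1)).trans ?_) _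
          gcongr
    _ = _ := by ring

/-- The interval `(π/2, π/α)` is nonempty because `α < 2`. -/
theorem exists_isRayAngle {α : ℝ} (hα : 1 < α) (hα' : α < 2) : ∃ θ, IsRayAngle α θ := by
  have hpi := Real.pi_pos
  obtain ⟨θ, h1, h2⟩ := exists_between (show Real.pi / 2 < Real.pi / α by gcongr)
  refine ⟨θ, ⟨hα, h1, ?_⟩⟩
  rwa [lt_div_iff₀ (by linarith), mul_comm] at h2

end SpaceTime

end FracDiffusion

end

/-! ### The theorem. -/

open FracDiffusion in
theorem theorem3p10 (d : ℕ) (hd : 0 < d) (α p T : ℝ) (hα : 1 < α) (hα' : α < 2) (hp : 1 < p)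
    (hT : 0 < T) (Ψ : 𝓢(EuclideanSpace ℝ (Fin d), ℂ)) (hΨ : IsLittlewoodPaley Ψ) :
    (∃ k : ℝ → EuclideanSpace ℝ (Fin d) → ℝ, IsFundamentalSolution α k) ∧
    ∃ C : ℝ≥0, ∀ k : ℝ → EuclideanSpace ℝ (Fin d) → ℝ, IsFundamentalSolution α k →
      ∀ h : EuclideanSpace ℝ (Fin d) → ℝ, ContDiff ℝ ∞ h → HasCompactSupport h →
        (1 + 1 / p < α →
          ∫⁻ t in Ioc 0 T, ∫⁻ x,
              ‖(velocityKernel k t ⋆[ContinuousLinearMap.mul ℝ ℝ, volume] h) x‖ₑ ^ p ≤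
            C * besovNorm Ψ (-(2 / (α * p)) - 2 / α) p h ^ p) ∧
        (α ≤ 1 + 1 / p →
          ∫⁻ t in Ioc 0 T, ∫⁻ x,
              ‖(velocityKernel k t ⋆[ContinuousLinearMap.mul ℝ ℝ, volume] h) x‖ₑ ^ p ≤
            C * besovNorm Ψ (-(2 / α)) p h ^ p) := by
  obtain ⟨θ, hθ⟩ := exists_isRayAngle hα hα'
  obtain ⟨k₀, hk₀, B, hB⟩ := hθ.exists_fundamentalSolution hd
  refine ⟨⟨k₀, hk₀⟩, ?_⟩
  obtain ⟨C₀, hC₀, hbound⟩ := hθ.exists_eLpNorm_velocity_le hd hΨ hp hB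
  have hα0 : 0 < α := by linarith
  have hp0 : 0 < p := by linarith
  -- All constants come from the one explicit kernel `k₀`; uniqueness of the time primitive carries
  -- the bounds over to every `k`.
  have hall : ∀ k, IsFundamentalSolution α k → ∀ h : EuclideanSpace ℝ (Fin d) → ℝ,
      ContDiff ℝ ∞ h → HasCompactSupport h → ∀ t, 0 < t →
      eLpNorm (velocityKernel k t ⋆[ContinuousLinearMap.mul ℝ ℝ, volume] h)
          (ENNReal.ofReal p) volume ≤
        ENNReal.ofReal (C₀ * t) * eLpNorm (dyadicBlock Ψ 0 h) (ENNReal.ofReal p) volume +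
          ∑' j : ℕ, ENNReal.ofReal (C₀ * min t (t ^ (1 - α) * (4 ^ (j + 1))⁻¹)) *
            eLpNorm (dyadicBlock Ψ (j + 1) h) (ENNReal.ofReal p) volume := by
    intro k hk h hh hc t ht
    rw [eLpNorm_congr_ae (hk.velocityKernel_convolution_ae_eq hα hk₀ hh hc ht)]
    exact hbound t ht h hh hc
  have hσ : 0 < 2 / α := by positivity
  have hσ2 : 2 / α < 2 := by
    rw [div_lt_iff₀ hα0]
    linarith
  -- With `σ = 2/α` the power of `t` is `p(1-ασ/2) = 0`.
  obtain ⟨C₂, hC₂⟩ := exists_lintegral_velocity_le (Ψ := Ψ) hp hC₀ hσ hσ2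
    (lintegral_dyadicProfile_le_of_subcritical (α := α) (p := p) (T := T) hσ hσ2 (by
      field_simp
      ring))
  by_cases hcase : 1 + 1 / p < α
  · have hτ : 0 < 2 / (α * p) + 2 / α := by positivity
    have hτe : 2 / (α * p) + 2 / α = 2 * (1 + 1 / p) / α := by
      field_simp
      ring
    -- This is the case hypothesis `α > 1 + 1/p`; with this smoothness the power of `t` is `-1`.
    have hτ2 : 2 / (α * p) + 2 / α < 2 := by
      rw [hτe, div_lt_iff₀ hα0]
      linarith
    obtain ⟨C₁, hC₁⟩ := exists_lintegral_velocity_le (Ψ := Ψ) hp hC₀ hτ hτ2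
      (lintegral_dyadicProfile_le_of_critical (α := α) (p := p) (T := T) hα0 hτ hτ2 (by
        field_simp
        ring))
    refine ⟨C₁, fun k hk h hh hc => ⟨fun _ => ?_, fun hle => absurd hcase hle.not_gt⟩⟩
    have := hC₁ (fun t => velocityKernel k t ⋆[ContinuousLinearMap.mul ℝ ℝ, volume] h) h
      (hall k hk h hh hc)
    rwa [neg_add'] at this
  · exact ⟨C₂, fun k hk h hh hc => ⟨fun hlt => absurd hlt hcase, fun _ =>
      hC₂ (fun t => velocityKernel k t ⋆[ContinuousLinearMap.mul ℝ ℝ, volume] h) h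
        (hall k hk h hh hc)⟩⟩
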